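/- **Theorem 1.3 (ill-posedness for $p>2$).** Write $(x,y)\in\mathbb R\times\mathbb R^2$ for the space variables, $(\xi,\eta)\in\mathbb R\times\mathbb R^2$ for the frequencies, and $\hat f$ for the unitary Fourier transform. For $\lambda\in 2^{\mathbb Z}$ and $k\in\lambda\mathbb Z^2$ let $$\Gamma_{\lambda,k}=\Big\{(\xi,\eta):\ \lambda\le|\xi|<2\lambda,\ \Big|\frac{\eta}{\xi}-k\Big|_\infty\le\frac{\lambda}{2}\Big\},$$ let $f_{\Gamma_{\lambda,k}}$ be the Fourier projection of $f$ to $\Gamma_{\lambda,k}$, and let $l^ql^pL^2$ be the closure of $C_0^\infty(\mathbb R\times\mathbb R^2;\mathbb C)$ in the space of the tempered distributions (modulo those whose Fourier transform is supported in $\{\xi=0\}$) for which the norm $$\|f\|_{l^ql^pL^2}=\Big(\sum_{\lambda\in2^{\mathbb Z}}\lambda^{q/2}\Big(\sum_{k\in\lambda\mathbb Z^2}\|f_{\Gamma_{\lambda,k}}\|_{L^2}^p\Big)^{q/p}\Big)^{1/q}$$ is finite (a supremum over $\lambda$ if $q=\infty$). Consider the three-dimensional KP-II equation $$\partial_x\big(\partial_tu+\partial_x^3u+\partial_x(u^2)\big)+\Delta_yu=0,\qquad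 u(0)=u_0. \tag{KP}$$ A solution of (KP) on $[-T,T]$ is a function $u\in C([-T,T];l^ql^pL^2)$ with $u(0)=u_0$ that satisfies Duhamel's formula $$u(t)=S(t)u_0-\int_0^tS(t-s)\,\partial_x\big(u(s)^2\big)\,ds,\qquad \widehat{S(t)f}(\xi,\eta)=e^{it(\xi^3-|\eta|^2/\xi)}\hat f(\xi,\eta),$$ for all $t\in[-T,T]$. Here both sides are compared as distributions in $(\xi,\eta)$ on $\{\xi\neq0\}$, and the integral is the limit in this sense, along the finite index sets $A$ directed by inclusion, of the integrals with $u$ replaced by $u_A=\sum_{(\lambda,k)\in A}u_{\Gamma_{\lambda,k}}$. Let $1\le q\le\infty$, $2<p<\infty$, $T>0$ and $\varepsilon>0$. Let $\mathcal K$ be a class of functions $u:[-T,T]\to l^ql^pL^2$ that contains every solution (for any initial data in $l^ql^pL^2$) which is bounded on $[-T,T]$ with values in $H^N(\mathbb R^3)$ for every $N$; for instance, $\mathcal K$ may consist of all functions. Suppose that for every $u_0\in l^ql^pL^2$ with $\|u_0\|_{l^ql^pL^2}<\varepsilon$ there is exactly one solution $u\in\mathcal K$ of (KP) on $[-T,T]$.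 Then for every $t\in[-T,T]$ with $t\ne0$ the flow map $$F_t:\ u_0\mapsto u(t)$$ is not twice (real Fréchet) differentiable at $u_0=0$ as a map from $l^ql^pL^2$ to itself. -/

import Mathlib

open MeasureTheory Filter Topology Set
open scoped ENNReal FourierTransform ContDiff

namespace KPII

noncomputable section

/-- Points `(x, y)` of `ℝ × ℝ²`, and frequencies `ζ = (ξ, η)` in `ℝ × ℝ²`.  Coordinate `0` is `x`
(resp. `ξ`), coordinates `1, 2` are `y` (resp. `η`). -/
abbrev Space : Type := EuclideanSpace ℝ (Fin 3)

/-- Indices `(j, m)` of the frequency pieces: `λ = 2 ^ j` and `k = λ m ∈ λ ℤ²`. -/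
abbrev Index : Type := ℤ × (ℤ × ℤ)

/-- `Γ_{λ,k}` with `λ = 2 ^ j`, `k = λ m`: the set of the `(ξ, η)` with `λ ≤ |ξ| < 2 λ` and
`|η / ξ - k|_∞ ≤ λ / 2`. -/
def Gam (j : ℤ) (m : ℤ × ℤ) : Set Space :=
  {ζ | (2 : ℝ) ^ j ≤ |ζ 0| ∧ |ζ 0| < 2 * (2 : ℝ) ^ j ∧
    |ζ 1 / ζ 0 - (2 : ℝ) ^ j * m.1| ≤ (2 : ℝ) ^ j / 2 ∧
    |ζ 2 / ζ 0 - (2 : ℝ) ^ j * m.2| ≤ (2 : ℝ) ^ j / 2}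

/-- `λ` times Lebesgue measure on `Γ_{λ,k}`; the norm of `L²` of this measure is
`λ^{1/2} ‖·‖_{L²(Γ_{λ,k})}`. -/
def gamMeasure (j : ℤ) (m : ℤ × ℤ) : Measure Space :=
  ENNReal.ofReal ((2 : ℝ) ^ j) • volume.restrict (Gam j m)

/-- Families `(f̂|_{Γ_{λ,k}})_{λ,k}` of square integrable functions with finite norm
`(∑_λ λ^{q/2} (∑_k ‖f̂‖_{L²(Γ_{λ,k})}^p)^{q/p})^{1/q}` (suprema if an exponent is infinite).

By Plancherel, `‖f̂‖_{L²(Γ_{λ,k})} = ‖f_{Γ_{λ,k}}‖_{L²}`.  The sets `Γ_{λ,k}` cover `{ξ ≠ 0}` and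
overlap in null sets only, so such a family is the same as a measurable function on `{ξ ≠ 0}` up
to null sets, i.e. as a tempered distribution modulo those whose Fourier transform is supported in
`{ξ = 0}` (the distributions of norm zero). -/
abbrev Ambient (q p : ℝ≥0∞) [Fact (1 ≤ p)] [Fact (1 ≤ q)] : Type :=
  lp (fun j : ℤ => lp (fun m : ℤ × ℤ => Lp ℂ 2 (gamMeasure j m)) p) q

/-- The unitary Fourier transform
`f̂(ζ) = (2π)^{-3/2} ∫ e^{-i z · ζ} f(z) dz` on `ℝ × ℝ²`. -/
def fourierHat (f : Space → ℂ) (ζ : Space) : ℂ :=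
  (((2 * Real.pi) ^ (-(3 / 2) : ℝ) : ℝ) : ℂ) * 𝓕 f ((2 * Real.pi)⁻¹ • ζ)

/-- The elements of the ambient space that come from functions in `C_0^∞(ℝ × ℝ²)`. -/
def testElements (q p : ℝ≥0∞) [Fact (1 ≤ p)] [Fact (1 ≤ q)] : Set (Ambient q p) :=
  {g | ∃ f : Space → ℂ, ContDiff ℝ ∞ f ∧ HasCompactSupport f ∧
    ∀ (j : ℤ) (m : ℤ × ℤ), (g j m : Space → ℂ) =ᵐ[gamMeasure j m] fourierHat f}

/-- The space `l^q l^p L²`: the closure of `C_0^∞` with respect to the norm. -/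
def LqLpL2 (q p : ℝ≥0∞) [Fact (1 ≤ p)] [Fact (1 ≤ q)] : Submodule ℂ (Ambient q p) :=
  (Submodule.span ℂ (testElements q p)).topologicalClosure

section Solutions

variable {q p : ℝ≥0∞} [Fact (1 ≤ p)] [Fact (1 ≤ q)]

/-- The Fourier transform of the piece `u_{Γ_{λ,k}}`, a function on all of `ℝ × ℝ²`. -/
def piece (u : LqLpL2 q p) (i : Index) : Space → ℂ :=
  (Gam i.1 i.2).indicator ((u : Ambient q p) i.1 i.2 : Space → ℂ)

/-- The Fourier transform `û`, an almost everywhere defined function on `ℝ × ℝ²`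
(every sum here has at most four nonzero terms). -/
def hat (u : LqLpL2 q p) (ζ : Space) : ℂ := ∑' i : Index, piece u i ζ

/-- The Fourier transform of `u_A = ∑_{(λ,k) ∈ A} u_{Γ_{λ,k}}` for a finite set `A` of indices. It is
square integrable with bounded support. -/
def hatTrunc (A : Finset Index) (u : LqLpL2 q p) (ζ : Space) : ℂ := ∑ i ∈ A, piece u i ζ

/-- The Fourier transform of `(u_A)²`, that is `(2π)^{-3/2} û_A * û_A`. -/
def hatSq (A : Finset Index) (u : LqLpL2 q p) (ζ : Space) : ℂ :=
  (((2 * Real.pi) ^ (-(3 / 2) : ℝ) : ℝ) : ℂ) *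
    ∫ ζ₁ : Space, hatTrunc A u ζ₁ * hatTrunc A u (ζ - ζ₁)

/-- The dispersion function `ω(ξ, η) = ξ³ - |η|² / ξ`. -/
def omega (ζ : Space) : ℝ := ζ 0 ^ 3 - (ζ 1 ^ 2 + ζ 2 ^ 2) / ζ 0

/-- The multiplier `e^{itω}` of the unitary group `S(t)` of the linear equation. -/
def propagator (t : ℝ) (ζ : Space) : ℂ := Complex.exp (Complex.I * ((t * omega ζ : ℝ) : ℂ))

/-- `u` is a solution on `[-T, T]` of
`∂_x (∂_t u + ∂_x³ u + ∂_x (u²)) + Δ_y u = 0`, `u(0) = u₀`: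
it is continuous with values in `l^q l^p L²` and satisfies Duhamel's formula
`u(t) = S(t) u₀ - ∫_0^t S(t - s) ∂_x (u(s)²) ds`.

The formula is tested on the Fourier side against `θ ∈ C_0^∞({ξ ≠ 0})`, and the quadratic term is
the limit of the corresponding terms for the finite partial sums `u_A` of `u = ∑ u_{Γ_{λ,k}}` (the
limit along the directed set of the finite sets `A`).  When `û(s)` is square integrable with norm
bounded in `s`, the limit is the term formed with the Fourier transform of the ordinary square. -/
structure IsSolution (T : ℝ) (u₀ : LqLpL2 q p) (u : ℝ → LqLpL2 q p) : Prop where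
  continuousOn : ContinuousOn u (Icc (-T) T)
  initial : u 0 = u₀
  duhamel : ∀ t ∈ Icc (-T) T, ∀ θ : Space → ℂ, ContDiff ℝ ∞ θ → HasCompactSupport θ →
    (∀ ζ ∈ tsupport θ, ζ 0 ≠ 0) →
    Tendsto
      (fun A : Finset Index => ∫ s in (0 : ℝ)..t, ∫ ζ : Space,
        propagator (t - s) ζ * (Complex.I * (ζ 0 : ℂ)) * hatSq A (u s) ζ * θ ζ)
      atTop
      (𝓝 ((∫ ζ : Space, propagator t ζ * hat u₀ ζ * θ ζ) - ∫ ζ : Space, hat (u t) ζ * θ ζ))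

/-- `u` is bounded on `[-T, T]` with values in the Sobolev space `H^N(ℝ × ℝ²)`, for every `N`. -/
def IsRegular (T : ℝ) (u : ℝ → LqLpL2 q p) : Prop :=
  ∀ N : ℕ, ∃ C : ℝ, ∀ t ∈ Icc (-T) T,
    ∫⁻ ζ : Space, ENNReal.ofReal ((1 + ‖ζ‖ ^ 2) ^ N * ‖hat (u t) ζ‖ ^ 2) ≤ ENNReal.ofReal C

end Solutions

/-- `f` is twice (Fréchet) differentiable at `x`: it is differentiable near `x`, and its derivative
is differentiable at `x`. -/
def TwiceDifferentiableAt {V : Type*} [NormedAddCommGroup V] [NormedSpace ℝ V]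
    (f : V → V) (x : V) : Prop :=
  (∀ᶠ z in 𝓝 x, DifferentiableAt ℝ f z) ∧ DifferentiableAt ℝ (fderiv ℝ f) x

end

end KPII

/-! ### The frequency pieces tile `{ξ ≠ 0}` up to null sets. -/

namespace KPII

/-! If the flow map were twice differentiable at zero, its second derivative would be twice the
quadratic Duhamel term `duh` of the linear evolution, so each frequency piece of that term would be
bounded by `C ‖φ‖²` with `C` independent of `φ`. For `p > 2` this fails for an interaction of low
with high frequencies.

Take `μ = c / L²` with `L → ∞`. The low part is the indicator of the box `ξ ∈ [μ, 3μ/2]`, `|η| ≤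
μL`, which spreads over about `(L/μ)²` pieces; the high part is the indicator of `ξ ∈ [L, L + μ]`,
`|η| ≤ 2μL`. The resonance function is at most `16 μL²` on these boxes (`resonance_le`), so for
small `c` the phases hardly move on `[-T, T]` and the interaction is coherent (`le_norm_duh`). With
both parts normalised, the output has size at least a constant times `|t| s / A`, where `s = Lμ(μL)²
∼ L⁻³` and `A` bounds the low part. Interpolation between the largest piece and the `l²` sum gives
`A ∼ L^(-6+6/p)` (`norm_elem_low_le`). Hence `L^(3-6/p)` would stay bounded, which is false for `p >
2` (`low_high_inequality`, `false_of_scaling`). The data lie in two dyadic shells and the output is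
measured in a single piece, so `q` plays no role.

The flow must also be identified with the Picard expansion. For data with exponentially decaying
Fourier transform the Duhamel equation is solved in weights whose radius of analyticity shrinks at
unit speed in `|t|`; integrating these weights in time recovers the derivative in the nonlinearity
(`Bdd.duh`, `exists_fixedPoint`). The solution is regular, hence in the uniqueness class, and
therefore equals the flow. It agrees with its second iterate up to a cubic error
(`norm_sub_second_order_le`). How small the data must be depends on `φ`, but only the behaviour
along the line `x φ` as `x → 0` is needed (`exists_bound_of_twiceDifferentiableAt`). -/

lemma measurable_coord (i : Fin 3) : Measurable (fun ζ : Space => ζ i) :=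
  (EuclideanSpace.proj (𝕜 := ℝ) i).continuous.measurable

lemma abs_coord_le (ζ : Space) (i : Fin 3) : |ζ i| ≤ ‖ζ‖ := by
  simpa using PiLp.norm_apply_le ζ i

lemma measurableSet_Gam (j : ℤ) (m : ℤ × ℤ) : MeasurableSet (Gam j m) := by
  have h := measurable_coord
  unfold Gam
  have h0 := h 0; have h1 := h 1; have h2 := h 2
  have e1 : Measurable fun ζ : Space => |ζ 0| := h0.abs
  have e2 : Measurable fun ζ : Space => |ζ 1 / ζ 0 - (2 : ℝ) ^ j * m.1| :=
    ((h1.div h0).sub_const _).abs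
  have e3 : Measurable fun ζ : Space => |ζ 2 / ζ 0 - (2 : ℝ) ^ j * m.2| :=
    ((h2.div h0).sub_const _).abs
  exact (measurableSet_le measurable_const e1).inter ((measurableSet_lt e1 measurable_const).inter
    ((measurableSet_le e2 measurable_const).inter (measurableSet_le e3 measurable_const)))

lemma level_unique {j j' : ℤ} {x : ℝ} (h : (2 : ℝ) ^ j ≤ x ∧ x < 2 * 2 ^ j)
    (h' : (2 : ℝ) ^ j' ≤ x ∧ x < 2 * 2 ^ j') : j = j' := by
  have e : ∀ k : ℤ, (2 : ℝ) * 2 ^ k = 2 ^ (k + 1) := fun k => by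
    rw [zpow_add₀ (by norm_num), zpow_one, mul_comm]
  rw [e] at h h'
  have h1 : (2 : ℝ) ^ j < 2 ^ (j' + 1) := h.1.trans_lt h'.2
  have h2 : (2 : ℝ) ^ j' < 2 ^ (j + 1) := h'.1.trans_lt h.2
  rw [zpow_lt_zpow_iff_right₀ (by norm_num)] at h1 h2
  omega

/-- The faces `η_i / ξ = c` of the pieces lie in proper linear subspaces, and only countably many of
these occur. -/
lemma volume_plane (i : Fin 3) (hi : i ≠ 0) (c : ℝ) :
    volume {ζ : Space | ζ i = c * ζ 0} = 0 := by
  let L : Space →ₗ[ℝ] ℝ :=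
    (EuclideanSpace.proj (𝕜 := ℝ) i : Space →L[ℝ] ℝ).toLinearMap -
      c • (EuclideanSpace.proj (𝕜 := ℝ) 0 : Space →L[ℝ] ℝ).toLinearMap
  have h := Measure.addHaar_submodule (volume : Measure Space) (LinearMap.ker L) (by
    intro h
    have : EuclideanSpace.single i (1 : ℝ) ∈ LinearMap.ker L := by rw [h]; trivial
    simp [L, hi.symm] at this)
  convert h using 2
  ext ζ
  simp [L, sub_eq_zero]

lemma volume_plane_zero : volume {ζ : Space | ζ 0 = 0} = 0 := by
  let L : Space →ₗ[ℝ] ℝ := (EuclideanSpace.proj (𝕜 := ℝ) 0 : Space →L[ℝ] ℝ).toLinearMap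
  have h := Measure.addHaar_submodule (volume : Measure Space) (LinearMap.ker L) (by
    intro h
    have : EuclideanSpace.single (0 : Fin 3) (1 : ℝ) ∈ LinearMap.ker L := by rw [h]; trivial
    simp [L] at this)
  convert h using 2
  ext ζ
  simp [L]

/-- A point has two nearest points in `l ℤ` only at odd multiples of `l / 2`; these ties are the
faces shared by neighbouring pieces. -/
lemma round_unique {l x : ℝ} (hl : 0 < l) (hx : ∀ m : ℤ, x ≠ l * (m + 1 / 2)) (m : ℤ) :
    |x - l * m| ≤ l / 2 ↔ m = round (x / l) := by
  have key : ∀ k : ℤ, |x - l * k| ≤ l / 2 → |x / l - k| < 1 / 2 := by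
    intro k hk
    have e : x - l * k = l * (x / l - k) := by field_simp
    rw [e, abs_mul, abs_of_pos hl] at hk
    have h1 : |x / l - k| ≤ 1 / 2 := by
      by_contra hcon
      push Not at hcon
      nlinarith
    refine lt_of_le_of_ne h1 fun h2 => ?_
    rcases abs_eq (by norm_num : (0 : ℝ) ≤ 1 / 2) |>.1 h2 with h3 | h3
    · apply hx k
      field_simp at h3 ⊢
      linarith
    · apply hx (k - 1)
      push_cast
      field_simp at h3 ⊢
      linarith
  have hr : |x - l * round (x / l)| ≤ l / 2 := by
    have h := abs_sub_round (x / l)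
    have e : x - l * round (x / l) = l * (x / l - round (x / l)) := by field_simp
    rw [e, abs_mul, abs_of_pos hl]
    nlinarith
  constructor
  · intro h
    have h1 := abs_lt.1 (key _ h)
    have h2 := abs_lt.1 (key _ hr)
    have h3 : ((m - round (x / l) : ℤ) : ℝ) < 1 := by push_cast; linarith
    have h4 : (-1 : ℝ) < ((m - round (x / l) : ℤ) : ℝ) := by push_cast; linarith
    have h5 : m - round (x / l) < 1 := by exact_mod_cast h3
    have h6 : -1 < m - round (x / l) := by exact_mod_cast h4
    omega
  · rintro rfl
    exact hr

/-- Almost every frequency lies in exactly one piece. -/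
lemma ae_existsUnique_Gam : ∀ᵐ ζ : Space, ∃ i : Index, ∀ i' : Index, ζ ∈ Gam i'.1 i'.2 ↔ i' = i := by
  have h0 : ∀ᵐ ζ : Space, ζ 0 ≠ 0 := by
    rw [ae_iff]; simpa using volume_plane_zero
  have h1 : ∀ (i : Fin 3), i ≠ 0 → ∀ᵐ ζ : Space, ∀ (j m : ℤ), ζ i ≠ (2 : ℝ) ^ j * (m + 1 / 2) * ζ 0 := by
    intro i hi
    rw [ae_all_iff]; intro j
    rw [ae_all_iff]; intro m
    rw [ae_iff]
    simpa using volume_plane i hi ((2 : ℝ) ^ j * (m + 1 / 2))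
  filter_upwards [h0, h1 1 (by decide), h1 2 (by decide)] with ζ hz h1 h2
  obtain ⟨j, hj⟩ := exists_mem_Ico_zpow (x := |ζ 0|) (y := (2 : ℝ)) (abs_pos.2 hz) (by norm_num)
  rw [zpow_add₀ (by norm_num), zpow_one, mul_comm] at hj
  have hj' : (2 : ℝ) ^ j ≤ |ζ 0| ∧ |ζ 0| < 2 * 2 ^ j := hj
  have hp : (0 : ℝ) < 2 ^ j := by positivity
  have q1 : ∀ m : ℤ, ζ 1 / ζ 0 ≠ (2 : ℝ) ^ j * (m + 1 / 2) := fun m h => h1 j m (by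
    rw [← h]; field_simp)
  have q2 : ∀ m : ℤ, ζ 2 / ζ 0 ≠ (2 : ℝ) ^ j * (m + 1 / 2) := fun m h => h2 j m (by
    rw [← h]; field_simp)
  refine ⟨(j, (round (ζ 1 / ζ 0 / 2 ^ j), round (ζ 2 / ζ 0 / 2 ^ j))), ?_⟩
  rintro ⟨j', m1, m2⟩
  constructor
  · rintro ⟨a, b, c, d⟩
    obtain rfl : j' = j := level_unique ⟨a, b⟩ hj'
    have c' := (round_unique hp q1 m1).1 c
    have d' := (round_unique hp q2 m2).1 d
    simp only [c', d']
  · intro h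
    simp only [Prod.mk.injEq] at h
    obtain ⟨rfl, e1, e2⟩ := h
    exact ⟨hj'.1, hj'.2, (round_unique hp q1 m1).2 e1, (round_unique hp q2 m2).2 e2⟩

lemma aedisjoint_Gam {i i' : Index} (h : i ≠ i') :
    AEDisjoint volume (Gam i.1 i.2) (Gam i'.1 i'.2) := by
  change volume _ = 0
  have := ae_existsUnique_Gam
  rw [ae_iff] at this
  refine measure_mono_null ?_ this
  rintro ζ ⟨h1, h2⟩ ⟨i0, h0⟩
  exact h (((h0 i).1 h1).trans ((h0 i').1 h2).symm)

/-- The set of the `ζ` in the dyadic shell `2 ^ j ≤ |ξ| < 2 ^ (j + 1)`. -/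
def shell (j : ℤ) : Set Space := {ζ | (2 : ℝ) ^ j ≤ |ζ 0| ∧ |ζ 0| < 2 * (2 : ℝ) ^ j}

lemma Gam_subset_shell (j : ℤ) (m : ℤ × ℤ) : Gam j m ⊆ shell j := fun _ h => ⟨h.1, h.2.1⟩

lemma measurableSet_shell (j : ℤ) : MeasurableSet (shell j) := by
  have e1 : Measurable fun ζ : Space => |ζ 0| := (measurable_coord 0).abs
  exact (measurableSet_le measurable_const e1).inter (measurableSet_lt e1 measurable_const)

lemma sum_lintegral_Gam_le (j : ℤ) (s : Finset (ℤ × ℤ)) (f : Space → ℝ≥0∞) :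
    ∑ m ∈ s, ∫⁻ ζ in Gam j m, f ζ ≤ ∫⁻ ζ in shell j, f ζ := by
  rw [← lintegral_biUnion_finset₀]
  · exact lintegral_mono_set (iUnion₂_subset fun m _ => Gam_subset_shell j m)
  · intro m _ m' _ h
    exact aedisjoint_Gam (i := (j, m)) (i' := (j, m')) (by simpa using h)
  · exact fun m _ => (measurableSet_Gam j m).nullMeasurableSet

end KPII

/-! ### The Fourier side of `H¹` embeds in the ambient space for `2 < p < ∞` and every `q`. -/

namespace KPII

noncomputable section

/-- The weight `1 + |ζ|²` times Lebesgue measure: its `L²` space is the Fourier side of `H¹`. -/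
def sobMeasure : Measure Space := volume.withDensity fun ζ => ENNReal.ofReal (1 + ‖ζ‖ ^ 2)

lemma measurable_sobWeight : Measurable fun ζ : Space => ENNReal.ofReal (1 + ‖ζ‖ ^ 2) := by
  fun_prop

lemma volume_le_sobMeasure : (volume : Measure Space) ≤ sobMeasure := by
  intro s
  refine le_trans ?_ (withDensity_apply_le _ s)
  calc volume s = ∫⁻ _ in s, 1 := by simp
    _ ≤ _ := lintegral_mono fun ζ => by
        rw [ENNReal.one_le_ofReal]; nlinarith [sq_nonneg ‖ζ‖]

lemma gamMeasure_le (j : ℤ) (m : ℤ × ℤ) :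
    gamMeasure j m ≤ ENNReal.ofReal ((2 : ℝ) ^ j) • sobMeasure := by
  unfold gamMeasure
  gcongr
  exact Measure.restrict_le_self.trans volume_le_sobMeasure

lemma gamMeasure_absolutelyContinuous (j : ℤ) (m : ℤ × ℤ) : gamMeasure j m ≪ volume :=
  (Measure.smul_absolutelyContinuous).trans Measure.restrict_le_self.absolutelyContinuous

lemma gamMeasure_absolutelyContinuous_sob (j : ℤ) (m : ℤ × ℤ) : gamMeasure j m ≪ sobMeasure :=
  (gamMeasure_absolutelyContinuous j m).trans volume_le_sobMeasure.absolutelyContinuous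

lemma memLp_gam {f : Space → ℂ} (hf : MemLp f 2 sobMeasure) (j : ℤ) (m : ℤ × ℤ) :
    MemLp f 2 (gamMeasure j m) :=
  hf.of_measure_le_smul ENNReal.ofReal_ne_top (gamMeasure_le j m)

lemma lintegral_gamMeasure (j : ℤ) (m : ℤ × ℤ) (g : Space → ℝ≥0∞) :
    ∫⁻ ζ, g ζ ∂gamMeasure j m = ENNReal.ofReal ((2 : ℝ) ^ j) * ∫⁻ ζ in Gam j m, g ζ := by
  rw [gamMeasure, lintegral_smul_measure, smul_eq_mul]

lemma norm_toLp_sq {α : Type*} [MeasurableSpace α] {μ : Measure α} {f : α → ℂ} (hf : MemLp f 2 μ) :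
    ENNReal.ofReal (‖hf.toLp f‖ ^ 2) = ∫⁻ x, ‖f x‖ₑ ^ 2 ∂μ := by
  rw [Lp.norm_toLp, ENNReal.ofReal_pow ENNReal.toReal_nonneg, ENNReal.ofReal_toReal hf.2.ne,
    eLpNorm_eq_lintegral_rpow_enorm_toReal (by norm_num) (by norm_num)]
  rw [← ENNReal.rpow_natCast, ← ENNReal.rpow_mul]
  simp

/-- The decay rate of the dyadic pieces of a function in `H¹`. -/
def rate (j : ℤ) : ℝ := (Real.sqrt 2)⁻¹ ^ j.natAbs

lemma rate_pos (j : ℤ) : 0 < rate j := by unfold rate; positivity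

lemma rate_sq (j : ℤ) : rate j ^ 2 = (1 / 2 : ℝ) ^ j.natAbs := by
  unfold rate
  rw [← pow_mul, mul_comm, pow_mul, inv_pow, Real.sq_sqrt (by norm_num)]
  norm_num

lemma summable_rate : Summable rate := by
  have h : Summable fun n : ℕ => (Real.sqrt 2)⁻¹ ^ n := by
    apply summable_geometric_of_lt_one (by positivity)
    apply inv_lt_one_of_one_lt₀
    rw [Real.lt_sqrt] <;> norm_num
  apply Summable.of_nat_of_neg
  · simpa [rate] using h
  · simpa [rate] using h

/-- Here `rate j ^ 2 = 2^(-|j|)`. For `j ≤ 0` this is `2^j` itself; for `j ≥ 0` the bound `|ζ| ≥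
2^j` supplies the missing factor `2^(2j)`. The gain in both directions makes the shells summable. -/
lemma weight_on_shell {j : ℤ} {ζ : Space} (h : ζ ∈ shell j) :
    (2 : ℝ) ^ j ≤ rate j ^ 2 * (1 + ‖ζ‖ ^ 2) := by
  rw [rate_sq]
  rcases le_total j 0 with hj | hj
  · have e : (2 : ℝ) ^ j = (1 / 2 : ℝ) ^ j.natAbs := by
      obtain ⟨n, rfl⟩ := Int.exists_eq_neg_ofNat hj
      simp
    rw [e]
    have : (0 : ℝ) < (1 / 2 : ℝ) ^ j.natAbs := by positivity
    nlinarith [sq_nonneg ‖ζ‖]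
  · obtain ⟨n, rfl⟩ := Int.eq_ofNat_of_zero_le hj
    have h1 : (2 : ℝ) ^ (n : ℤ) ≤ ‖ζ‖ := h.1.trans (abs_coord_le ζ 0)
    simp only [zpow_natCast] at h1 ⊢
    have h2 : (0 : ℝ) < 2 ^ n := by positivity
    have h3 : ((1 : ℝ) / 2) ^ n = (2 ^ n)⁻¹ := by simp
    simp only [Int.natAbs_natCast, h3]
    rw [inv_mul_eq_div, le_div_iff₀ h2]
    nlinarith

/-- `2 ^ j` times the squared `L²` norm on the shell is controlled by the `H¹` norm. -/
lemma shell_energy_le (j : ℤ) (g : Space → ℝ≥0∞) :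
    ENNReal.ofReal ((2 : ℝ) ^ j) * ∫⁻ ζ in shell j, g ζ ≤
      ENNReal.ofReal (rate j ^ 2) * ∫⁻ ζ, g ζ ∂sobMeasure := by
  rw [sobMeasure, lintegral_withDensity_eq_lintegral_mul_non_measurable _ measurable_sobWeight
    (by filter_upwards with x using ENNReal.ofReal_lt_top),
    ← lintegral_const_mul' _ _ ENNReal.ofReal_ne_top, ← lintegral_const_mul' _ _ ENNReal.ofReal_ne_top]
  calc ∫⁻ ζ in shell j, ENNReal.ofReal ((2 : ℝ) ^ j) * g ζ
      ≤ ∫⁻ ζ in shell j, ENNReal.ofReal (rate j ^ 2) *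
        (ENNReal.ofReal (1 + ‖ζ‖ ^ 2) * g ζ) := by
        refine setLIntegral_mono' (measurableSet_shell j) fun ζ hζ => ?_
        rw [← mul_assoc, ← ENNReal.ofReal_mul (sq_nonneg _)]
        gcongr
        exact weight_on_shell hζ
    _ ≤ _ := setLIntegral_le_lintegral _ _

lemma sum_norm_sq_gam_le {f : Space → ℂ} (hf : MemLp f 2 sobMeasure) (j : ℤ) (s : Finset (ℤ × ℤ)) :
    ENNReal.ofReal (∑ m ∈ s, ‖(memLp_gam hf j m).toLp f‖ ^ 2) ≤
      ENNReal.ofReal ((2 : ℝ) ^ j) * ∫⁻ ζ in shell j, ‖f ζ‖ₑ ^ 2 := by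
  rw [ENNReal.ofReal_sum_of_nonneg fun _ _ => sq_nonneg _]
  simp only [norm_toLp_sq, lintegral_gamMeasure]
  rw [← Finset.mul_sum]
  gcongr
  exact sum_lintegral_Gam_le j s _

/-- Write `x^r = x^(r-2) x²` and bound the first factor by the supremum. This is where `p > 2` gains
when the mass is spread over many pieces. -/
lemma sum_rpow_le {ι : Type*} (s : Finset ι) (x : ι → ℝ) (hx : ∀ i, 0 ≤ x i) {B S r : ℝ}
    (hB : ∀ i, x i ≤ B) (hS : ∑ i ∈ s, x i ^ 2 ≤ S) (hr : 2 ≤ r) (hB0 : 0 ≤ B) :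
    ∑ i ∈ s, x i ^ r ≤ B ^ (r - 2) * S := by
  calc ∑ i ∈ s, x i ^ r ≤ ∑ i ∈ s, B ^ (r - 2) * x i ^ 2 := by
        refine Finset.sum_le_sum fun i _ => ?_
        have : x i ^ r = x i ^ (r - 2) * x i ^ 2 := by
          rw [← Real.rpow_natCast (x i) 2, ← Real.rpow_add_of_nonneg (hx i) (by linarith) (by norm_num)]
          congr 1
          push_cast; ring
        rw [this]
        gcongr
        · exact hx i
        · exact hB i
    _ = B ^ (r - 2) * ∑ i ∈ s, x i ^ 2 := (Finset.mul_sum ..).symm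
    _ ≤ _ := by gcongr

section

variable {p q : ℝ≥0∞}

lemma two_le_toReal (hp : 2 < p) (hp' : p < ⊤) : 2 ≤ p.toReal := by
  have := ENNReal.toReal_mono hp'.ne hp.le
  simpa using this

/-- The family of `L²` norms, over the pieces in a shell, of a function in `H¹`. -/
lemma memℓp_shell {f : Space → ℂ} (hf : MemLp f 2 sobMeasure) (j : ℤ) (hp : 2 < p) :
    Memℓp (fun m : ℤ × ℤ => (memLp_gam hf j m).toLp f) p := by
  have h2 : Memℓp (fun m : ℤ × ℤ => (memLp_gam hf j m).toLp f) 2 := by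
    refine memℓp_gen' (C := (ENNReal.ofReal ((2 : ℝ) ^ j) *
      ∫⁻ ζ in shell j, ‖f ζ‖ₑ ^ 2).toReal) fun s => ?_
    have := sum_norm_sq_gam_le hf j s
    simp only [ENNReal.toReal_ofNat, Real.rpow_ofNat]
    rwa [ENNReal.ofReal_le_iff_le_toReal] at this
    refine ((shell_energy_le j _).trans_lt ?_).ne
    refine ENNReal.mul_lt_top ENNReal.ofReal_lt_top ?_
    rw [← norm_toLp_sq hf]
    exact ENNReal.ofReal_lt_top
  exact h2.of_exponent_ge hp.le

/-- The pieces of a function in `H¹` in the shell `|ξ| ∼ 2 ^ j`. -/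
def shellElem (hp : 2 < p) {f : Space → ℂ} (hf : MemLp f 2 sobMeasure) (j : ℤ) :
    lp (fun m : ℤ × ℤ => Lp ℂ 2 (gamMeasure j m)) p :=
  ⟨fun m => (memLp_gam hf j m).toLp f, memℓp_shell hf j hp⟩

/-- Interpolation between the supremum and the square sum of the norms of the pieces. -/
lemma norm_shellElem_le (hp : 2 < p) (hp' : p < ⊤) {f : Space → ℂ} (hf : MemLp f 2 sobMeasure) (j : ℤ)
    {B S : ℝ} (hB0 : 0 ≤ B) (hS0 : 0 ≤ S)
    (hB : ∀ m, ENNReal.ofReal ((2 : ℝ) ^ j) * ∫⁻ ζ in Gam j m, ‖f ζ‖ₑ ^ 2 ≤ ENNReal.ofReal (B ^ 2))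
    (hS : ENNReal.ofReal ((2 : ℝ) ^ j) * ∫⁻ ζ in shell j, ‖f ζ‖ₑ ^ 2 ≤ ENNReal.ofReal S) :
    ‖shellElem hp hf j‖ ≤ (B ^ (p.toReal - 2) * S) ^ (p.toReal)⁻¹ := by
  have hp2 := two_le_toReal hp hp'
  refine lp.norm_le_of_forall_sum_le (by linarith) (by positivity) fun s => ?_
  rw [← Real.rpow_mul (by positivity), inv_mul_cancel₀ (by linarith), Real.rpow_one]
  refine sum_rpow_le s _ (fun _ => norm_nonneg _) (fun m => ?_) ?_ hp2 hB0
  · have := hB m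
    rw [← lintegral_gamMeasure, ← norm_toLp_sq (memLp_gam hf j m),
      ENNReal.ofReal_le_ofReal_iff (sq_nonneg _)] at this
    exact le_of_sq_le_sq this hB0
  · have := (sum_norm_sq_gam_le hf j s).trans hS
    rwa [ENNReal.ofReal_le_ofReal_iff hS0] at this

/-- The crude case of the interpolation: no piece carries more energy than its shell, so `B = S` is
allowed there and the `l^p` norm is at most the `l²` norm. -/
lemma norm_shellElem_le_of_energy (hp : 2 < p) (hp' : p < ⊤) {f : Space → ℂ}
    (hf : MemLp f 2 sobMeasure) (j : ℤ) {S : ℝ} (hS0 : 0 ≤ S)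
    (hS : ENNReal.ofReal ((2 : ℝ) ^ j) * ∫⁻ ζ in shell j, ‖f ζ‖ₑ ^ 2 ≤ ENNReal.ofReal (S ^ 2)) :
    ‖shellElem hp hf j‖ ≤ S := by
  have hp2 := two_le_toReal hp hp'
  refine (norm_shellElem_le hp hp' hf j hS0 (sq_nonneg S) (fun m => ?_) hS).trans_eq ?_
  · refine le_trans ?_ hS
    gcongr
    exact Gam_subset_shell j m
  · rw [← Real.rpow_natCast S 2, ← Real.rpow_add_of_nonneg hS0 (by linarith) (by norm_num),
      ← Real.rpow_mul hS0]
    have : (p.toReal - 2 + (2 : ℕ)) * (p.toReal)⁻¹ = 1 := by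
      push_cast
      rw [sub_add_cancel, mul_inv_cancel₀ (by linarith)]
    rw [this, Real.rpow_one]

lemma norm_shellElem_le_rate (hp : 2 < p) (hp' : p < ⊤) {f : Space → ℂ} (hf : MemLp f 2 sobMeasure) (j : ℤ) :
    ‖shellElem hp hf j‖ ≤ rate j * ‖hf.toLp f‖ := by
  refine norm_shellElem_le_of_energy hp hp' hf j (mul_nonneg (rate_pos j).le (norm_nonneg _)) ?_
  rw [mul_pow, ENNReal.ofReal_mul (sq_nonneg _), norm_toLp_sq hf]
  exact shell_energy_le j _

variable [Fact (1 ≤ q)]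

/-- The `ℓ^q` norm is bounded by the sum of the norms. -/
lemma lp_norm_le_tsum {ι : Type*} {E : ι → Type*} [∀ i, NormedAddCommGroup (E i)] (x : lp E q)
    (hx : Summable fun i => ‖x i‖) : ‖x‖ ≤ ∑' i, ‖x i‖ := by
  have h1 : (1 : ℝ≥0∞) ≤ q := Fact.out
  have hS : 0 ≤ ∑' i, ‖x i‖ := tsum_nonneg fun _ => norm_nonneg _
  have hle : ∀ i, ‖x i‖ ≤ ∑' i, ‖x i‖ := fun i => hx.le_tsum i fun _ _ => norm_nonneg _
  rcases eq_or_ne q ⊤ with rfl | hq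
  · exact lp.norm_le_of_forall_le hS hle
  · have hq1 : 1 ≤ q.toReal := by
      have := ENNReal.toReal_mono hq h1
      simpa using this
    refine lp.norm_le_of_forall_sum_le (by linarith) hS fun s => ?_
    have key : ∀ y : ℝ, 0 ≤ y → y ^ q.toReal = y ^ (q.toReal - 1) * y := fun y hy => by
      conv_rhs => rw [← Real.rpow_one y, ← Real.rpow_mul hy]
      rw [one_mul, ← Real.rpow_add_of_nonneg hy (by linarith) (by norm_num), sub_add_cancel]
    rw [key _ hS]
    calc ∑ i ∈ s, ‖x i‖ ^ q.toReal ≤ ∑ i ∈ s, (∑' i, ‖x i‖) ^ (q.toReal - 1) * ‖x i‖ := by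
          refine Finset.sum_le_sum fun i _ => ?_
          rw [key _ (norm_nonneg _)]
          have := Real.rpow_le_rpow (norm_nonneg _) (hle i) (by linarith : 0 ≤ q.toReal - 1)
          gcongr
      _ = (∑' i, ‖x i‖) ^ (q.toReal - 1) * ∑ i ∈ s, ‖x i‖ := (Finset.mul_sum ..).symm
      _ ≤ _ := by
          gcongr
          exact hx.sum_le_tsum s fun _ _ => norm_nonneg _

variable [Fact (1 ≤ p)]

lemma summable_norm_shellElem (hp : 2 < p) (hp' : p < ⊤) {f : Space → ℂ} (hf : MemLp f 2 sobMeasure) :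
    Summable fun j => ‖shellElem hp hf j‖ :=
  Summable.of_nonneg_of_le (fun _ => norm_nonneg _) (norm_shellElem_le_rate hp hp' hf)
    (summable_rate.mul_right _)

/-- A function in `H¹` as an element of the ambient space. -/
def ambElem (q : ℝ≥0∞) [Fact (1 ≤ q)] (hp : 2 < p) (hp' : p < ⊤) {f : Space → ℂ}
    (hf : MemLp f 2 sobMeasure) : Ambient q p :=
  ⟨fun j => shellElem hp hf j, by
    have h1 : Memℓp (fun j => shellElem hp hf j) 1 :=
      memℓp_gen (by simpa using summable_norm_shellElem hp hp' hf)
    exact h1.of_exponent_ge Fact.out⟩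

lemma norm_ambElem_le_tsum (hp : 2 < p) (hp' : p < ⊤) {f : Space → ℂ} (hf : MemLp f 2 sobMeasure) :
    ‖ambElem q hp hp' hf‖ ≤ ∑' j, ‖shellElem hp hf j‖ :=
  lp_norm_le_tsum _ (summable_norm_shellElem hp hp' hf)

lemma norm_ambElem_le (hp : 2 < p) (hp' : p < ⊤) {f : Space → ℂ} (hf : MemLp f 2 sobMeasure) :
    ‖ambElem q hp hp' hf‖ ≤ (∑' j, rate j) * ‖hf.toLp f‖ := by
  refine (norm_ambElem_le_tsum hp hp' hf).trans ?_
  rw [← tsum_mul_right]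
  exact (summable_norm_shellElem hp hp' hf).tsum_le_tsum (norm_shellElem_le_rate hp hp' hf)
    (summable_rate.mul_right _)

lemma ambElem_congr (hp : 2 < p) (hp' : p < ⊤) {f g : Space → ℂ} (hf : MemLp f 2 sobMeasure)
    (hg : MemLp g 2 sobMeasure) (h : f =ᵐ[sobMeasure] g) :
    ambElem q hp hp' hf = ambElem q hp hp' hg := by
  apply lp.ext; funext j; apply lp.ext; funext m
  change (memLp_gam hf j m).toLp f = (memLp_gam hg j m).toLp g
  rw [MemLp.toLp_eq_toLp_iff]
  exact (gamMeasure_absolutelyContinuous_sob j m).ae_eq h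

/-- The embedding of (the Fourier side of) `H¹` in the ambient space. -/
def embed (q : ℝ≥0∞) [Fact (1 ≤ q)] (hp : 2 < p) (hp' : p < ⊤) :
    Lp ℂ 2 sobMeasure →L[ℂ] Ambient q p :=
  LinearMap.mkContinuous
    { toFun := fun f => ambElem q hp hp' (Lp.memLp f)
      map_add' := fun f g => by
        rw [ambElem_congr hp hp' (Lp.memLp (f + g)) ((Lp.memLp f).add (Lp.memLp g)) (Lp.coeFn_add f g)]
        rfl
      map_smul' := fun c f => by
        rw [ambElem_congr hp hp' (Lp.memLp (c • f)) ((Lp.memLp f).const_smul c) (Lp.coeFn_smul c f)]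
        rfl }
    (∑' j, rate j) (fun f => by
      have := norm_ambElem_le (q := q) hp hp' (Lp.memLp f)
      rwa [Lp.toLp_coeFn] at this)

lemma embed_toLp (hp : 2 < p) (hp' : p < ⊤) {f : Space → ℂ} (hf : MemLp f 2 sobMeasure) :
    embed q hp hp' (hf.toLp f) = ambElem q hp hp' hf :=
  ambElem_congr hp hp' _ _ hf.coeFn_toLp

end

end

end KPII

/-! ### Density of test functions, and elements of the space given by their Fourier transform. -/

namespace KPII

noncomputable section

section Cutoff

variable {E : Type*} [NormedAddCommGroup E] [InnerProductSpace ℝ E] [FiniteDimensional ℝ E]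

/-- Schwartz functions are limits of compactly supported ones. -/
lemma schwartz_mem_closure_hasCompactSupport (ψ : SchwartzMap E ℂ) :
    ψ ∈ closure {φ : SchwartzMap E ℂ | HasCompactSupport φ} := by
  let χ : ContDiffBump (0 : E) := ⟨1, 2, one_pos, one_lt_two⟩
  have hχ : ContDiff ℝ ∞ χ := χ.contDiff
  let R : ℕ → ℝ := fun n => n + 1
  have hR : ∀ n, 1 ≤ R n := fun n => by simp [R]
  let L : ℕ → E →L[ℝ] E := fun n => (R n)⁻¹ • ContinuousLinearMap.id ℝ E
  have hL : ∀ n x, L n x = (R n)⁻¹ • x := fun n x => rfl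
  have hLn : ∀ n, ‖L n‖ ≤ 1 := fun n => by
    refine ContinuousLinearMap.opNorm_le_bound _ zero_le_one fun x => ?_
    rw [hL, norm_smul, norm_inv, Real.norm_of_nonneg (by linarith [hR n])]
    gcongr
    exact inv_le_one_of_one_le₀ (hR n)
  -- The cutoff error at scale `R n` is `η ∘ L n`. It vanishes for `|x| ≤ R n`, and its derivatives
  -- are bounded uniformly in `n` because `‖L n‖ ≤ 1`.
  let η : E → ℝ := fun x => χ x - 1
  have hη : ContDiff ℝ ∞ η := hχ.sub contDiff_const
  have hηR : ∀ n, ContDiff ℝ ∞ (η ∘ L n) := fun n => hη.comp (L n).contDiff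
  have hηb : ∀ i : ℕ, ∃ C, ∀ x, ‖iteratedFDeriv ℝ i η x‖ ≤ C := by
    intro i
    obtain ⟨C, hC⟩ := (hχ.continuous_iteratedFDeriv (m := i) (by exact_mod_cast le_top)).bounded_above_of_compact_support
      (χ.hasCompactSupport.iteratedFDeriv i)
    refine ⟨C + 1, fun x => ?_⟩
    have e : iteratedFDeriv ℝ i η x = iteratedFDeriv ℝ i χ x - iteratedFDeriv ℝ i (fun _ => (1 : ℝ)) x :=
      iteratedFDeriv_sub_apply (hχ.contDiffAt.of_le (by exact_mod_cast le_top)) contDiff_const.contDiffAt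
    rw [e]
    refine (norm_sub_le _ _).trans (add_le_add (hC x) ?_)
    rcases Nat.eq_zero_or_pos i with rfl | hi
    · simp
    · rw [iteratedFDeriv_const_of_ne hi.ne']; simp
  choose C hC using hηb
  have hηRb : ∀ n i x, ‖iteratedFDeriv ℝ i (η ∘ L n) x‖ ≤ C i := by
    intro n i x
    rw [(L n).iteratedFDeriv_comp_right hη x (i := i) (by exact_mod_cast le_top)]
    refine (ContinuousMultilinearMap.norm_compContinuousLinearMap_le _ _).trans ?_
    have h1 : ∏ _j : Fin i, ‖L n‖ ≤ 1 := Finset.prod_le_one (fun _ _ => norm_nonneg _) fun _ _ => hLn n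
    exact (mul_le_of_le_one_right (norm_nonneg _) h1).trans (hC i _)
  have hc : ∀ n, HasCompactSupport fun x => χ (L n x) • ψ x := fun n => by
    have : HasCompactSupport (χ ∘ L n) := by
      refine HasCompactSupport.intro (isCompact_closedBall (0 : E) (2 * R n)) fun x hx => ?_
      apply χ.zero_of_le_dist
      rw [dist_zero_right, hL, norm_smul, norm_inv, Real.norm_of_nonneg (by linarith [hR n])]
      rw [mem_closedBall_zero_iff, not_le] at hx
      change 2 ≤ _
      rw [inv_mul_eq_div, le_div_iff₀ (by linarith [hR n])]
      exact hx.le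
    exact this.smul_right
  have hs : ∀ n, ContDiff ℝ ∞ fun x => χ (L n x) • ψ x := fun n =>
    (hχ.comp (L n).contDiff).smul ψ.smooth'
  let φ : ℕ → SchwartzMap E ℂ := fun n => (hc n).toSchwartzMap (hs n)
  have hφ : ∀ n, ((φ n - ψ : SchwartzMap E ℂ) : E → ℂ) = fun x => (η ∘ L n) x • ψ x := by
    intro n
    funext x
    change χ (L n x) • ψ x - ψ x = (χ (L n x) - 1) • ψ x
    rw [sub_smul, one_smul]
  refine mem_closure_of_tendsto (f := φ) (b := atTop) ?_ (Eventually.of_forall fun n => hc n)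
  rw [(schwartz_withSeminorms ℝ E ℂ).tendsto_nhds]
  rintro ⟨k, l⟩ ε hε
  let M : ℝ := ∑ i ∈ Finset.range (l + 1), (l.choose i : ℝ) * C i * SchwartzMap.seminorm ℝ (k + 1) (l - i) ψ
  have hC0 : ∀ i, 0 ≤ C i := fun i => (norm_nonneg _).trans (hC i 0)
  have hM : 0 ≤ M := Finset.sum_nonneg fun i _ =>
    mul_nonneg (mul_nonneg (by positivity) (hC0 i)) (apply_nonneg _ _)
  -- Inside the ball of radius `R n` the error vanishes identically; outside it `1 ≤ |x| / R n`,
  -- which trades a factor `1 / R n` for one more power of `|x|` in the seminorm of `ψ`.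
  have key : ∀ n, SchwartzMap.seminorm ℝ k l (φ n - ψ) ≤ M / R n := by
    intro n
    have hRn : 0 < R n := by linarith [hR n]
    refine SchwartzMap.seminorm_le_bound ℝ k l _ (by positivity) fun x => ?_
    rw [hφ n]
    rcases lt_or_ge ‖x‖ (R n) with hx | hx
    · have : (fun x => (η ∘ L n) x • ψ x) =ᶠ[𝓝 x] fun _ => (0 : ℂ) := by
        filter_upwards [Metric.isOpen_ball.mem_nhds (mem_ball_zero_iff.2 hx)] with y hy
        have : χ (L n y) = 1 := by
          apply χ.one_of_mem_closedBall
          rw [mem_closedBall_zero_iff, hL, norm_smul, norm_inv, Real.norm_of_nonneg hRn.le]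
          change _ ≤ (1 : ℝ)
          rw [inv_mul_eq_div, div_le_one hRn]
          exact (mem_ball_zero_iff.1 hy).le
        simp [η, this]
      rw [(Filter.EventuallyEq.iteratedFDeriv ℝ this l).eq_of_nhds]
      have : iteratedFDeriv ℝ l (fun _ : E => (0 : ℂ)) x = 0 := by
        have := iteratedFDeriv_fun_zero (𝕜 := ℝ) (E := E) (F := ℂ) (n := l)
        rw [this]; rfl
      rw [this]
      simp
      positivity
    · have h1 := norm_iteratedFDeriv_smul_le (𝕜 := ℝ) (hηR n) ψ.smooth' x (n := l) (by exact_mod_cast le_top)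
      calc ‖x‖ ^ k * ‖iteratedFDeriv ℝ l (fun x => (η ∘ L n) x • ψ x) x‖
          ≤ ‖x‖ ^ k * ∑ i ∈ Finset.range (l + 1), (l.choose i : ℝ) * C i * ‖iteratedFDeriv ℝ (l - i) ψ x‖ := by
            gcongr
            refine h1.trans (Finset.sum_le_sum fun i _ => ?_)
            exact mul_le_mul_of_nonneg_right
              (mul_le_mul_of_nonneg_left (hηRb n i x) (by positivity)) (norm_nonneg _)
        _ ≤ (‖x‖ ^ (k + 1) / R n) * ∑ i ∈ Finset.range (l + 1), (l.choose i : ℝ) * C i * ‖iteratedFDeriv ℝ (l - i) ψ x‖ := by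
            gcongr
            · exact Finset.sum_nonneg fun i _ => mul_nonneg (mul_nonneg (by positivity) (hC0 i)) (norm_nonneg _)
            · rw [le_div_iff₀ hRn, pow_succ]
              gcongr
        _ = (∑ i ∈ Finset.range (l + 1), (l.choose i : ℝ) * C i * (‖x‖ ^ (k + 1) * ‖iteratedFDeriv ℝ (l - i) ψ x‖)) / R n := by
            rw [div_mul_eq_mul_div, Finset.mul_sum]
            congr 1
            refine Finset.sum_congr rfl fun i _ => by ring
        _ ≤ M / R n := by
            refine div_le_div_of_nonneg_right (Finset.sum_le_sum fun i _ => ?_) hRn.le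
            exact mul_le_mul_of_nonneg_left (SchwartzMap.le_seminorm ℝ (k + 1) (l - i) ψ x)
              (mul_nonneg (by positivity) (hC0 i))
  have hlim : Tendsto (fun n => M / R n) atTop (𝓝 0) :=
    Tendsto.const_div_atTop (tendsto_atTop_add_const_right _ _ tendsto_natCast_atTop_atTop) _
  filter_upwards [hlim.eventually (gt_mem_nhds hε)] with n hn
  exact (key n).trans_lt hn

end Cutoff

/-- The exponent 6 spends 2 on the weight `1 + |ζ|²` and leaves 4, more than the dimension 3. -/
instance : sobMeasure.HasTemperateGrowth := by
  refine ⟨6, ?_⟩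
  unfold sobMeasure
  rw [integrable_withDensity_iff_integrable_smul' measurable_sobWeight
    (by filter_upwards with x using ENNReal.ofReal_lt_top)]
  have h := integrable_one_add_norm (E := Space) (μ := volume) (r := 4) (by simp; norm_num)
  refine h.mono' (by fun_prop) ?_
  filter_upwards with x
  rw [ENNReal.toReal_ofReal (by positivity), smul_eq_mul, Real.norm_of_nonneg (by positivity)]
  have h0 : 0 < 1 + ‖x‖ := by positivity
  have e : (1 + ‖x‖) ^ (-4 : ℝ) = (1 + ‖x‖) ^ 2 * (1 + ‖x‖) ^ (-6 : ℝ) := by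
    rw [← Real.rpow_natCast, ← Real.rpow_add h0]; norm_num
  push_cast
  rw [e]
  gcongr
  nlinarith [norm_nonneg x]

instance : IsFiniteMeasureOnCompacts sobMeasure := by
  refine ⟨fun K hK => ?_⟩
  rw [sobMeasure, withDensity_apply _ hK.measurableSet]
  obtain ⟨C, hC⟩ := hK.exists_bound_of_continuousOn (f := fun ζ : Space => 1 + ‖ζ‖ ^ 2) (by fun_prop)
  calc ∫⁻ ζ in K, ENNReal.ofReal (1 + ‖ζ‖ ^ 2) ≤ ∫⁻ ζ in K, ENNReal.ofReal C :=
        setLIntegral_mono' hK.measurableSet fun ζ hζ =>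
          ENNReal.ofReal_le_ofReal ((le_abs_self _).trans (hC ζ hζ))
    _ < ⊤ := by
        rw [setLIntegral_const]
        exact ENNReal.mul_lt_top ENNReal.ofReal_lt_top hK.measure_lt_top

/-- The frequency scaling that turns `𝓕` into the unitary Fourier transform. -/
def scaling : Space ≃L[ℝ] Space :=
  ContinuousLinearEquiv.smulLeft (Units.mk0 ((2 * Real.pi)⁻¹ : ℝ) (by positivity))

/-- The unitary Fourier transform on the Schwartz space. -/
def schwartzHat : SchwartzMap Space ℂ →L[ℝ] SchwartzMap Space ℂ :=
  ((2 * Real.pi) ^ (-(3 / 2) : ℝ) : ℝ) •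
    ((SchwartzMap.compCLMOfContinuousLinearEquiv ℝ scaling).comp
      (FourierTransform.fourierCLE ℝ (SchwartzMap Space ℂ)).toContinuousLinearMap)

lemma schwartzHat_apply (ψ : SchwartzMap Space ℂ) : (schwartzHat ψ : Space → ℂ) = fourierHat ψ := by
  funext ζ
  change ((2 * Real.pi) ^ (-(3 / 2) : ℝ) : ℝ) • (𝓕 ψ) ((2 * Real.pi)⁻¹ • ζ) = _
  rw [fourierHat, Complex.real_smul, SchwartzMap.fourier_coe]

lemma schwartzHat_surjective : Function.Surjective schwartzHat := by
  intro g
  have h2 : ((2 * Real.pi) ^ (-(3 / 2) : ℝ) : ℝ) ≠ 0 := by positivity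
  refine ⟨(FourierTransform.fourierCLE ℝ (SchwartzMap Space ℂ)).symm
    (((2 * Real.pi) ^ (-(3 / 2) : ℝ) : ℝ)⁻¹ •
      SchwartzMap.compCLMOfContinuousLinearEquiv ℝ scaling.symm g), ?_⟩
  ext ζ
  change ((2 * Real.pi) ^ (-(3 / 2) : ℝ) : ℝ) • ((FourierTransform.fourierCLE ℝ (SchwartzMap Space ℂ))
    ((FourierTransform.fourierCLE ℝ (SchwartzMap Space ℂ)).symm _)) (scaling ζ) = _
  rw [ContinuousLinearEquiv.apply_symm_apply]
  change ((2 * Real.pi) ^ (-(3 / 2) : ℝ) : ℝ) • (((2 * Real.pi) ^ (-(3 / 2) : ℝ) : ℝ)⁻¹ • g (scaling.symm (scaling ζ))) = _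
  rw [smul_inv_smul₀ h2, ContinuousLinearEquiv.symm_apply_apply]

variable {p q : ℝ≥0∞} [Fact (1 ≤ p)] [Fact (1 ≤ q)]

/-- Membership is a closed condition, so it passes from compactly supported smooth functions to
Schwartz functions, and from their Fourier transforms, which are all Schwartz functions, to the
whole weighted `L²` space. -/
lemma embed_mem (hp : 2 < p) (hp' : p < ⊤) (f : Lp ℂ 2 sobMeasure) :
    embed q hp hp' f ∈ LqLpL2 q p := by
  have hclosed : IsClosed {f | embed q hp hp' f ∈ LqLpL2 q p} :=
    (Submodule.isClosed_topologicalClosure _).preimage (embed q hp hp').continuous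
  let S : SchwartzMap Space ℂ →L[ℝ] Lp ℂ 2 sobMeasure :=
    (SchwartzMap.toLpCLM ℝ ℂ 2 sobMeasure).comp schwartzHat
  have h1 : ∀ ψ : SchwartzMap Space ℂ, HasCompactSupport ψ → embed q hp hp' (S ψ) ∈ LqLpL2 q p := by
    intro ψ hψ
    refine Submodule.le_topologicalClosure _ (Submodule.subset_span ⟨ψ, ψ.smooth', hψ, fun j m => ?_⟩)
    have e : S ψ =ᵐ[sobMeasure] fourierHat ψ := by
      rw [← schwartzHat_apply]
      exact SchwartzMap.coeFn_toLp _ 2 sobMeasure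
    refine EventuallyEq.trans (MemLp.coeFn_toLp (memLp_gam (Lp.memLp (S ψ)) j m)) ?_
    exact (gamMeasure_absolutelyContinuous_sob j m).ae_eq e
  have h2 : ∀ ψ : SchwartzMap Space ℂ, embed q hp hp' (S ψ) ∈ LqLpL2 q p := by
    intro ψ
    have hc : IsClosed {ψ | embed q hp hp' (S ψ) ∈ LqLpL2 q p} := hclosed.preimage S.continuous
    exact closure_minimal (fun ψ hψ => h1 ψ hψ) hc (schwartz_mem_closure_hasCompactSupport ψ)
  have hd : DenseRange (SchwartzMap.toLpCLM ℝ ℂ 2 sobMeasure) :=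
    SchwartzMap.denseRange_toLpCLM (by norm_num)
  refine closure_minimal ?_ hclosed (hd f)
  rintro _ ⟨g, rfl⟩
  obtain ⟨ψ, rfl⟩ := schwartzHat_surjective g
  exact h2 ψ

open Classical in
/-- The element of `l^q l^p L²` whose Fourier transform is a given function in `L²((1 + |ζ|²) dζ)`
(and zero for other functions). -/
def elem (q : ℝ≥0∞) [Fact (1 ≤ q)] (hp : 2 < p) (hp' : p < ⊤) (f : Space → ℂ) : LqLpL2 q p :=
  if hf : MemLp f 2 sobMeasure then ⟨ambElem q hp hp' hf, embed_toLp (q := q) hp hp' hf ▸ embed_mem hp hp' _⟩ else 0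

lemma coe_elem (hp : 2 < p) (hp' : p < ⊤) {f : Space → ℂ} (hf : MemLp f 2 sobMeasure) :
    (elem q hp hp' f : Ambient q p) = ambElem q hp hp' hf := by
  rw [elem, dif_pos hf]

lemma norm_elem_le_tsum (hp : 2 < p) (hp' : p < ⊤) {f : Space → ℂ} (hf : MemLp f 2 sobMeasure) :
    ‖elem q hp hp' f‖ ≤ ∑' j, ‖shellElem hp hf j‖ := by
  change ‖(elem q hp hp' f : Ambient q p)‖ ≤ _
  rw [coe_elem hp hp' hf]
  exact norm_ambElem_le_tsum hp hp' hf

lemma elem_sub (hp : 2 < p) (hp' : p < ⊤) {f g : Space → ℂ} (hf : MemLp f 2 sobMeasure)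
    (hg : MemLp g 2 sobMeasure) : elem q hp hp' (f - g) = elem q hp hp' f - elem q hp hp' g := by
  ext1
  rw [Submodule.coe_sub, coe_elem hp hp' hf, coe_elem hp hp' hg, coe_elem hp hp' (hf.sub hg)]
  rfl

lemma elem_add (hp : 2 < p) (hp' : p < ⊤) {f g : Space → ℂ} (hf : MemLp f 2 sobMeasure)
    (hg : MemLp g 2 sobMeasure) : elem q hp hp' (f + g) = elem q hp hp' f + elem q hp hp' g := by
  ext1
  rw [Submodule.coe_add, coe_elem hp hp' hf, coe_elem hp hp' hg, coe_elem hp hp' (hf.add hg)]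
  rfl

lemma elem_smul (hp : 2 < p) (hp' : p < ⊤) {f : Space → ℂ} (hf : MemLp f 2 sobMeasure) (c : ℂ) :
    elem q hp hp' (c • f) = c • elem q hp hp' f := by
  ext1
  rw [Submodule.coe_smul, coe_elem hp hp' hf, coe_elem hp hp' (hf.const_smul c)]
  rfl

lemma elem_apply_ae (hp : 2 < p) (hp' : p < ⊤) {f : Space → ℂ} (hf : MemLp f 2 sobMeasure)
    (j : ℤ) (m : ℤ × ℤ) :
    ((elem q hp hp' f : Ambient q p) j m : Space → ℂ) =ᵐ[gamMeasure j m] f := by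
  rw [coe_elem hp hp' hf]
  exact MemLp.coeFn_toLp (memLp_gam hf j m)

lemma norm_elem_le (hp : 2 < p) (hp' : p < ⊤) {f : Space → ℂ} (hf : MemLp f 2 sobMeasure) :
    ‖elem q hp hp' f‖ ≤ (∑' j, rate j) * ‖hf.toLp f‖ := by
  change ‖(elem q hp hp' f : Ambient q p)‖ ≤ _
  rw [coe_elem hp hp' hf]
  exact norm_ambElem_le hp hp' hf

lemma piece_elem_ae (hp : 2 < p) (hp' : p < ⊤) {f : Space → ℂ} (hf : MemLp f 2 sobMeasure) :
    ∀ᵐ ζ : Space, ∀ i : Index, piece (elem q hp hp' f) i ζ = (Gam i.1 i.2).indicator f ζ := by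
  rw [ae_all_iff]
  intro i
  have h := elem_apply_ae (q := q) hp hp' hf i.1 i.2
  have h' : ((elem q hp hp' f : Ambient q p) i.1 i.2 : Space → ℂ) =ᵐ[volume.restrict (Gam i.1 i.2)] f := by
    refine Measure.AbsolutelyContinuous.ae_eq ?_ h
    refine Measure.absolutelyContinuous_smul ?_
    rw [Ne, ENNReal.ofReal_eq_zero, not_le]
    positivity
  have h3 := (ae_restrict_iff' (measurableSet_Gam i.1 i.2)).1 h'
  filter_upwards [h3] with ζ hζ
  unfold piece
  by_cases hm : ζ ∈ Gam i.1 i.2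
  · rw [indicator_of_mem hm, indicator_of_mem hm, hζ hm]
  · rw [indicator_of_notMem hm, indicator_of_notMem hm]

lemma hat_elem_ae (hp : 2 < p) (hp' : p < ⊤) {f : Space → ℂ} (hf : MemLp f 2 sobMeasure) :
    hat (elem q hp hp' f) =ᵐ[volume] f := by
  filter_upwards [piece_elem_ae (q := q) hp hp' hf, ae_existsUnique_Gam] with ζ h1 ⟨i, hi⟩
  unfold hat
  simp only [h1]
  rw [tsum_eq_single i fun i' hi' => indicator_of_notMem (fun h => hi' ((hi i').1 h)) _,
    indicator_of_mem ((hi i).2 rfl)]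

/-- The multiplicity of `ζ` in the pieces indexed by `A`. -/
def cover (A : Finset Index) (ζ : Space) : ℂ := ∑ i ∈ A, (Gam i.1 i.2).indicator 1 ζ

lemma measurable_cover (A : Finset Index) : Measurable (cover A) := by
  unfold cover
  exact Finset.measurable_fun_sum _ fun i _ => measurable_one.indicator (measurableSet_Gam i.1 i.2)

lemma hatTrunc_elem_ae (hp : 2 < p) (hp' : p < ⊤) {f : Space → ℂ} (hf : MemLp f 2 sobMeasure)
    (A : Finset Index) : hatTrunc A (elem q hp hp' f) =ᵐ[volume] fun ζ => cover A ζ * f ζ := by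
  filter_upwards [piece_elem_ae (q := q) hp hp' hf] with ζ h1
  unfold hatTrunc cover
  simp only [h1, Finset.sum_mul]
  refine Finset.sum_congr rfl fun i _ => ?_
  by_cases hm : ζ ∈ Gam i.1 i.2 <;> simp [hm]

/-- At a point lying in exactly one piece `i`, `cover A` is 1 or 0 according as `i ∈ A`. These are
the bound and the pointwise limit needed for dominated convergence along `A`. -/
lemma ae_cover : ∀ᵐ ζ : Space, (∀ A, ‖cover A ζ‖ ≤ 1) ∧ ∀ᶠ A in atTop, cover A ζ = 1 := by
  filter_upwards [ae_existsUnique_Gam] with ζ ⟨i, hi⟩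
  have hs : ∀ A : Finset Index, cover A ζ = if i ∈ A then 1 else 0 := by
    intro A
    unfold cover
    rw [← Finset.sum_ite_eq' A i (fun _ => (1 : ℂ))]
    refine Finset.sum_congr rfl fun i' _ => ?_
    by_cases h : i' = i
    · rw [if_pos h, indicator_of_mem ((hi i').2 h)]; rfl
    · rw [if_neg h, indicator_of_notMem fun h' => h ((hi i').1 h')]
  constructor
  · intro A
    rw [hs]
    split_ifs <;> simp
  · filter_upwards [eventually_ge_atTop ({i} : Finset Index)] with A hA
    rw [hs, if_pos (hA (Finset.mem_singleton_self i))]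

end

end KPII

/-! ### Solving the Duhamel equation in analytic weights. -/

namespace KPII

noncomputable section

/-- The integrable weight `(1 + |ζ|²)⁻²`. -/
def bracket (ζ : Space) : ℝ := ((1 + ‖ζ‖ ^ 2) ^ 2)⁻¹

lemma bracket_pos (ζ : Space) : 0 < bracket ζ := by unfold bracket; positivity

lemma bracket_le_one (ζ : Space) : bracket ζ ≤ 1 := by
  unfold bracket
  apply inv_le_one_of_one_le₀
  apply one_le_pow₀
  nlinarith [sq_nonneg ‖ζ‖]

lemma measurable_bracket : Measurable bracket := by unfold bracket; fun_prop

lemma integrable_bracket : Integrable bracket := by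
  have h := integrable_rpow_neg_one_add_norm_sq (E := Space) (μ := volume) (r := 4) (by simp; norm_num)
  refine h.congr ?_
  filter_upwards with ζ
  unfold bracket
  rw [show (-4 / 2 : ℝ) = -(2 : ℕ) by norm_num, Real.rpow_neg (by positivity), Real.rpow_natCast]

/-- One of the two frequencies is comparable to the sum or larger: with `A, B, C` the three values
of `1 + |·|²`, `C ≤ 2(A + B)` and so `C² ≤ 8(A² + B²)`. -/
lemma bracket_mul_le (a b : Space) :
    bracket a * bracket b ≤ 8 * bracket (a + b) * (bracket a + bracket b) := by
  unfold bracket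
  have hA : 1 ≤ 1 + ‖a‖ ^ 2 := by nlinarith [sq_nonneg ‖a‖]
  have hB : 1 ≤ 1 + ‖b‖ ^ 2 := by nlinarith [sq_nonneg ‖b‖]
  have hC : 1 ≤ 1 + ‖a + b‖ ^ 2 := by nlinarith [sq_nonneg ‖a + b‖]
  have h : 1 + ‖a + b‖ ^ 2 ≤ 2 * ((1 + ‖a‖ ^ 2) + (1 + ‖b‖ ^ 2)) := by
    have := norm_add_le a b
    nlinarith [norm_nonneg (a + b), sq_nonneg (‖a‖ - ‖b‖)]
  generalize 1 + ‖a‖ ^ 2 = A at *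
  generalize 1 + ‖b‖ ^ 2 = B at *
  generalize 1 + ‖a + b‖ ^ 2 = C at *
  have e : 8 * (C ^ 2)⁻¹ * ((A ^ 2)⁻¹ + (B ^ 2)⁻¹) = (A ^ 2)⁻¹ * (B ^ 2)⁻¹ * (8 * (A ^ 2 + B ^ 2) / C ^ 2) := by
    field_simp
    ring
  rw [e]
  refine le_mul_of_one_le_right (by positivity) ?_
  rw [one_le_div (by positivity)]
  nlinarith [sq_nonneg (A - B)]

/-- The weights of the analytic norm; the radius of analyticity shrinks at unit speed. -/
def weight (T t : ℝ) (ζ : Space) : ℝ := Real.exp (-(T + 1 - |t|) * ‖ζ‖) * bracket ζ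

lemma weight_pos (T t : ℝ) (ζ : Space) : 0 < weight T t ζ := mul_pos (Real.exp_pos _) (bracket_pos ζ)

lemma abs_le_of_mem {T t : ℝ} (ht : t ∈ Icc (-T) T) : |t| ≤ T := abs_le.2 ht

lemma weight_le {T t : ℝ} (ht : t ∈ Icc (-T) T) (ζ : Space) :
    weight T t ζ ≤ Real.exp (-‖ζ‖) * bracket ζ := by
  have := abs_le_of_mem ht
  unfold weight
  gcongr
  · exact (bracket_pos ζ).le
  · nlinarith [norm_nonneg ζ]

lemma weight_le_bracket {T t : ℝ} (ht : t ∈ Icc (-T) T) (ζ : Space) : weight T t ζ ≤ bracket ζ := by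
  refine (weight_le ht ζ).trans (mul_le_of_le_one_left (bracket_pos ζ).le ?_)
  rw [Real.exp_le_one_iff]
  exact neg_nonpos.2 (norm_nonneg _)

/-- The weights grow with `|t|`, so the unitary linear evolution of data bounded by the weight at
time 0 stays in the class. -/
lemma weight_zero_le (T t : ℝ) (ζ : Space) : weight T 0 ζ ≤ weight T t ζ := by
  refine mul_le_mul_of_nonneg_right (Real.exp_le_exp.2 ?_) (bracket_pos ζ).le
  rw [abs_zero]
  nlinarith [mul_nonneg (abs_nonneg t) (norm_nonneg ζ)]

/-- The constant `∫ (1 + |ζ|²)⁻² dζ`. -/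
def bracketInt : ℝ := ∫ ζ, bracket ζ

lemma bracketInt_nonneg : 0 ≤ bracketInt := integral_nonneg fun ζ => (bracket_pos ζ).le

/-- The exponential factors are submultiplicative by the triangle inequality, since `T + 1 - |t| ≥
0`; the brackets leave an integrable function of `ζ₁`, so convolution preserves the class. -/
lemma weight_mul_le {T t : ℝ} (ht : t ∈ Icc (-T) T) (ζ ζ₁ : Space) :
    weight T t ζ₁ * weight T t (ζ - ζ₁) ≤ 8 * weight T t ζ * (bracket ζ₁ + bracket (ζ - ζ₁)) := by
  have h1 := abs_le_of_mem ht
  have h2 : Real.exp (-(T + 1 - |t|) * ‖ζ₁‖) * Real.exp (-(T + 1 - |t|) * ‖ζ - ζ₁‖) ≤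
      Real.exp (-(T + 1 - |t|) * ‖ζ‖) := by
    rw [← Real.exp_add, Real.exp_le_exp]
    have : ‖ζ‖ ≤ ‖ζ₁‖ + ‖ζ - ζ₁‖ := by simpa using norm_add_le ζ₁ (ζ - ζ₁)
    nlinarith
  have h3 := bracket_mul_le ζ₁ (ζ - ζ₁)
  rw [add_sub_cancel] at h3
  unfold weight
  calc _ = (Real.exp (-(T + 1 - |t|) * ‖ζ₁‖) * Real.exp (-(T + 1 - |t|) * ‖ζ - ζ₁‖)) *
        (bracket ζ₁ * bracket (ζ - ζ₁)) := by ring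
    _ ≤ Real.exp (-(T + 1 - |t|) * ‖ζ‖) * (8 * bracket ζ * (bracket ζ₁ + bracket (ζ - ζ₁))) := by
        gcongr
        exact (mul_pos (bracket_pos _) (bracket_pos _)).le
    _ = _ := by ring

/-- Functions of time and frequency bounded by a multiple of the analytic weights. -/
structure Bdd (T : ℝ) (U : ℝ → Space → ℂ) (D : ℝ) : Prop where
  meas : StronglyMeasurable (Function.uncurry U)
  le : ∀ t ∈ Icc (-T) T, ∀ ζ, ‖U t ζ‖ ≤ D * weight T t ζ

/-- The convolution. -/
def conv (f g : Space → ℂ) (ζ : Space) : ℂ := ∫ ζ₁, f ζ₁ * g (ζ - ζ₁)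

/-- The constant in the convolution theorem for the unitary Fourier transform. -/
def c₀ : ℝ := (2 * Real.pi) ^ (-(3 / 2) : ℝ)

lemma c₀_pos : 0 < c₀ := by unfold c₀; positivity

/-- The bilinear Duhamel term `-∫_0^t S(t - s) ∂_x (u(s) v(s)) ds` on the Fourier side. -/
def duh (U V : ℝ → Space → ℂ) (t : ℝ) (ζ : Space) : ℂ :=
  -(Complex.I * (ζ 0 : ℂ) * (c₀ : ℂ)) * ∫ s in (0 : ℝ)..t, propagator (t - s) ζ * conv (U s) (V s) ζ

lemma measurable_omega : Measurable omega := by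
  have h := measurable_coord
  unfold omega
  exact ((h 0).pow_const 3).sub ((((h 1).pow_const 2).add ((h 2).pow_const 2)).div (h 0))

lemma measurable_propagator : Measurable (fun x : ℝ × Space => propagator x.1 x.2) := by
  unfold propagator
  have : Measurable fun x : ℝ × Space => x.1 * omega x.2 :=
    measurable_fst.mul (measurable_omega.comp measurable_snd)
  fun_prop

lemma norm_propagator (t : ℝ) (ζ : Space) : ‖propagator t ζ‖ = 1 := by
  unfold propagator
  rw [mul_comm, Complex.norm_exp_ofReal_mul_I]

lemma propagator_add (s t : ℝ) (ζ : Space) : propagator (s + t) ζ = propagator s ζ * propagator t ζ := by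
  unfold propagator
  rw [← Complex.exp_add]
  congr 1
  push_cast
  ring

lemma propagator_zero (ζ : Space) : propagator 0 ζ = 1 := by simp [propagator]

lemma continuous_propagator (ζ : Space) : Continuous fun t => propagator t ζ := by
  unfold propagator; fun_prop

section

variable {T D D' : ℝ} {U V : ℝ → Space → ℂ}

lemma Bdd.measurable_slice (hU : Bdd T U D) (t : ℝ) : Measurable (U t) :=
  hU.meas.measurable.comp measurable_prodMk_left

lemma Bdd.nonneg (hT : 0 < T) (hU : Bdd T U D) : 0 ≤ D := by
  have h := (norm_nonneg _).trans (hU.le 0 ⟨by linarith, hT.le⟩ 0)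
  exact nonneg_of_mul_nonneg_left h (weight_pos _ _ _)

lemma Bdd.add (hU : Bdd T U D) (hV : Bdd T V D') : Bdd T (fun t ζ => U t ζ + V t ζ) (D + D') :=
  ⟨hU.meas.add hV.meas, fun t ht ζ => (norm_add_le _ _).trans (by
    rw [add_mul]; exact add_le_add (hU.le t ht ζ) (hV.le t ht ζ))⟩

lemma Bdd.sub (hU : Bdd T U D) (hV : Bdd T V D') : Bdd T (fun t ζ => U t ζ - V t ζ) (D + D') :=
  ⟨hU.meas.sub hV.meas, fun t ht ζ => (norm_sub_le _ _).trans (by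
    rw [add_mul]; exact add_le_add (hU.le t ht ζ) (hV.le t ht ζ))⟩

lemma Bdd.mono (hU : Bdd T U D) (h : D ≤ D') : Bdd T U D' :=
  ⟨hU.meas, fun t ht ζ => (hU.le t ht ζ).trans
    (mul_le_mul_of_nonneg_right h (weight_pos _ _ _).le)⟩

lemma norm_mul_slice_le (hU : Bdd T U D) (hV : Bdd T V D') (hD : 0 ≤ D) (hD' : 0 ≤ D') {t : ℝ}
    (ht : t ∈ Icc (-T) T) (ζ ζ₁ : Space) : ‖U t ζ₁ * V t (ζ - ζ₁)‖ ≤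
      D * D' * (8 * weight T t ζ) * (bracket ζ₁ + bracket (ζ - ζ₁)) := by
  rw [norm_mul]
  calc ‖U t ζ₁‖ * ‖V t (ζ - ζ₁)‖ ≤ (D * weight T t ζ₁) * (D' * weight T t (ζ - ζ₁)) :=
        mul_le_mul (hU.le t ht _) (hV.le t ht _) (norm_nonneg _) (mul_nonneg hD (weight_pos _ _ _).le)
    _ = D * D' * (weight T t ζ₁ * weight T t (ζ - ζ₁)) := by ring
    _ ≤ D * D' * (8 * weight T t ζ * (bracket ζ₁ + bracket (ζ - ζ₁))) := by
        exact mul_le_mul_of_nonneg_left (weight_mul_le ht ζ ζ₁) (mul_nonneg hD hD')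
    _ = _ := by ring

lemma integrable_bracket_pair (ζ : Space) : Integrable fun ζ₁ => bracket ζ₁ + bracket (ζ - ζ₁) :=
  integrable_bracket.add (integrable_bracket.comp_sub_left ζ)

lemma integral_bracket_pair (ζ : Space) : ∫ ζ₁, (bracket ζ₁ + bracket (ζ - ζ₁)) = 2 * bracketInt := by
  rw [integral_add integrable_bracket (integrable_bracket.comp_sub_left ζ),
    integral_sub_left_eq_self bracket volume ζ, bracketInt]
  ring

lemma integrable_conv (hU : Bdd T U D) (hV : Bdd T V D') (hD : 0 ≤ D) (hD' : 0 ≤ D') {t : ℝ}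
    (ht : t ∈ Icc (-T) T) (ζ : Space) : Integrable fun ζ₁ => U t ζ₁ * V t (ζ - ζ₁) := by
  refine ((integrable_bracket_pair ζ).const_mul (D * D' * (8 * weight T t ζ))).mono' ?_
    (Eventually.of_forall fun ζ₁ => norm_mul_slice_le hU hV hD hD' ht ζ ζ₁)
  exact ((hU.measurable_slice t).mul
    ((hV.measurable_slice t).comp (measurable_const.sub measurable_id))).aestronglyMeasurable

lemma norm_conv_le (hU : Bdd T U D) (hV : Bdd T V D') (hD : 0 ≤ D) (hD' : 0 ≤ D') {t : ℝ}
    (ht : t ∈ Icc (-T) T) (ζ : Space) :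
    ‖conv (U t) (V t) ζ‖ ≤ 16 * bracketInt * (D * D') * weight T t ζ := by
  refine (norm_integral_le_of_norm_le ((integrable_bracket_pair ζ).const_mul _)
    (Eventually.of_forall fun ζ₁ => norm_mul_slice_le hU hV hD hD' ht ζ ζ₁)).trans_eq ?_
  rw [integral_const_mul, integral_bracket_pair]
  ring

lemma stronglyMeasurable_conv (hU : StronglyMeasurable (Function.uncurry U))
    (hV : StronglyMeasurable (Function.uncurry V)) :
    StronglyMeasurable (Function.uncurry fun s ζ => conv (U s) (V s) ζ) := by
  have : StronglyMeasurable (Function.uncurry fun (x : ℝ × Space) (ζ₁ : Space) =>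
      U x.1 ζ₁ * V x.1 (x.2 - ζ₁)) := by
    have m1 : Measurable fun y : (ℝ × Space) × Space => (y.1.1, y.2) := by fun_prop
    have m2 : Measurable fun y : (ℝ × Space) × Space => (y.1.1, y.1.2 - y.2) := by fun_prop
    exact (hU.comp_measurable m1).mul (hV.comp_measurable m2)
  exact this.integral_prod_right

lemma stronglyMeasurable_duh (hU : StronglyMeasurable (Function.uncurry U))
    (hV : StronglyMeasurable (Function.uncurry V)) :
    StronglyMeasurable (Function.uncurry (duh U V)) := by
  have hc := stronglyMeasurable_conv hU hV
  have hg : StronglyMeasurable fun y : (ℝ × Space) × ℝ =>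
      propagator (y.1.1 - y.2) y.1.2 * conv (U y.2) (V y.2) y.1.2 := by
    have m1 : Measurable fun y : (ℝ × Space) × ℝ => (y.1.1 - y.2, y.1.2) := by fun_prop
    have m2 : Measurable fun y : (ℝ × Space) × ℝ => (y.2, y.1.2) := by fun_prop
    exact (measurable_propagator.comp m1).stronglyMeasurable.mul (hc.comp_measurable m2)
  -- The interval integral is a difference of integrals over `Ioc` with variable endpoints; an
  -- indicator moves the endpoints into a jointly measurable integrand.
  have key : ∀ (l r : (ℝ × Space) → ℝ), Measurable l → Measurable r →
      StronglyMeasurable fun x : ℝ × Space => ∫ s in Ioc (l x) (r x),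
        propagator (x.1 - s) x.2 * conv (U s) (V s) x.2 := by
    intro l r hl hr
    have : StronglyMeasurable (Function.uncurry fun (x : ℝ × Space) (s : ℝ) =>
        (Ioc (l x) (r x)).indicator (fun s => propagator (x.1 - s) x.2 * conv (U s) (V s) x.2) s) := by
      have hm : MeasurableSet {y : (ℝ × Space) × ℝ | l y.1 < y.2 ∧ y.2 ≤ r y.1} :=
        (measurableSet_lt (hl.comp measurable_fst) measurable_snd).inter
          (measurableSet_le measurable_snd (hr.comp measurable_fst))
      exact hg.indicator hm
    convert this.integral_prod_right (ν := volume) using 2 with x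
    rw [integral_indicator measurableSet_Ioc]
  have h1 : StronglyMeasurable fun x : ℝ × Space => -(Complex.I * (x.2 0 : ℂ) * (c₀ : ℂ)) := by
    have : Measurable fun x : ℝ × Space => x.2 0 := (measurable_coord 0).comp measurable_snd
    exact (by fun_prop : Measurable fun x : ℝ × Space =>
      -(Complex.I * (x.2 0 : ℂ) * (c₀ : ℂ))).stronglyMeasurable
  exact h1.mul ((key (fun _ => 0) (fun x => x.1) measurable_const measurable_fst).sub
    (key (fun x => x.1) (fun _ => 0) measurable_fst measurable_const))

lemma uIcc_subset {t : ℝ} (hT : 0 < T) (ht : t ∈ Icc (-T) T) : uIcc 0 t ⊆ Icc (-T) T :=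
  uIcc_subset_Icc ⟨by linarith, hT.le⟩ ht

lemma uIoc_subset {t : ℝ} (hT : 0 < T) (ht : t ∈ Icc (-T) T) : uIoc 0 t ⊆ Icc (-T) T :=
  uIoc_subset_uIcc.trans (uIcc_subset hT ht)

lemma norm_integrand_le (hU : Bdd T U D) (hV : Bdd T V D') (hD : 0 ≤ D) (hD' : 0 ≤ D') {s : ℝ}
    (hs : s ∈ Icc (-T) T) (r : ℝ) (ζ : Space) :
    ‖propagator r ζ * conv (U s) (V s) ζ‖ ≤ 16 * bracketInt * (D * D') * weight T s ζ := by
  rw [norm_mul, norm_propagator, one_mul]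
  exact norm_conv_le hU hV hD hD' hs ζ

lemma integrableOn_integrand (hU : Bdd T U D) (hV : Bdd T V D') (hD : 0 ≤ D) (hD' : 0 ≤ D')
    (t : ℝ) (ζ : Space) :
    IntegrableOn (fun s => propagator (t - s) ζ * conv (U s) (V s) ζ) (Icc (-T) T) := by
  refine Measure.integrableOn_of_bounded (M := 16 * bracketInt * (D * D') * bracket ζ)
    (by simp) ?_ ?_
  · have m1 : Measurable fun s : ℝ => (t - s, ζ) := by fun_prop
    have m2 : Measurable fun s : ℝ => (s, ζ) := by fun_prop
    exact ((measurable_propagator.comp m1).mul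
      ((stronglyMeasurable_conv hU.meas hV.meas).measurable.comp m2)).aestronglyMeasurable
  · filter_upwards [ae_restrict_mem measurableSet_Icc] with s hs
    refine (norm_integrand_le hU hV hD hD' hs _ ζ).trans ?_
    have := bracketInt_nonneg
    gcongr
    exact weight_le_bracket hs ζ

lemma intervalIntegrable_integrand (hT : 0 < T) (hU : Bdd T U D) (hV : Bdd T V D') {t : ℝ}
    (ht : t ∈ Icc (-T) T) (r : ℝ) (ζ : Space) :
    IntervalIntegrable (fun s => propagator (r - s) ζ * conv (U s) (V s) ζ) volume 0 t := by
  rw [intervalIntegrable_iff]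
  exact (integrableOn_integrand hU hV (hU.nonneg hT) (hV.nonneg hT) r ζ).mono_set (uIoc_subset hT ht)

/-- The time integral of the weights gains a derivative. -/
lemma mul_abs_integral_exp_le (T t r : ℝ) :
    r * |∫ s in (0 : ℝ)..t, Real.exp (-(T + 1 - |s|) * r)| ≤ Real.exp (-(T + 1 - |t|) * r) := by
  have key : ∀ t : ℝ, 0 ≤ t →
      r * |∫ s in (0 : ℝ)..t, Real.exp (-(T + 1 - |s|) * r)| ≤ Real.exp (-(T + 1 - |t|) * r) := by
    intro t ht
    have h1 : ∫ s in (0 : ℝ)..t, r * Real.exp (-(T + 1 - |s|) * r) =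
        Real.exp (-(T + 1 - t) * r) - Real.exp (-(T + 1 - 0) * r) := by
      rw [← intervalIntegral.integral_eq_sub_of_hasDerivAt (a := 0) (b := t)
        (f := fun s => Real.exp (-(T + 1 - s) * r)) (f' := fun s => r * Real.exp (-(T + 1 - s) * r))]
      · refine intervalIntegral.integral_congr fun s hs => ?_
        rw [uIcc_of_le ht] at hs
        simp only [abs_of_nonneg hs.1]
      · intro s _
        have : HasDerivAt (fun s => -(T + 1 - s) * r) r s := by
          have := (((hasDerivAt_id s).const_sub (T + 1)).neg).mul_const r
          simpa using this
        have := this.exp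
        rwa [mul_comm] at this
      · exact (by fun_prop : Continuous fun s => r * Real.exp (-(T + 1 - s) * r)).intervalIntegrable _ _
    have h2 : 0 ≤ ∫ s in (0 : ℝ)..t, Real.exp (-(T + 1 - |s|) * r) :=
      intervalIntegral.integral_nonneg ht fun _ _ => (Real.exp_pos _).le
    rw [abs_of_nonneg h2, ← intervalIntegral.integral_const_mul, h1, abs_of_nonneg ht]
    linarith [Real.exp_pos (-(T + 1 - 0) * r)]
  rcases le_total 0 t with ht | ht
  · exact key t ht
  · have h := key (-t) (by linarith)
    have e : ∫ s in (0 : ℝ)..t, Real.exp (-(T + 1 - |s|) * r) =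
        - ∫ s in (0 : ℝ)..(-t), Real.exp (-(T + 1 - |s|) * r) := by
      rw [← intervalIntegral.integral_symm]
      have := intervalIntegral.integral_comp_neg (a := 0) (b := t)
        (fun s => Real.exp (-(T + 1 - |s|) * r))
      simpa using this
    rw [e, abs_neg]
    rwa [abs_neg] at h

/-- The norm of the bilinear Duhamel term. -/
def bilConst : ℝ := 16 * bracketInt * c₀

/-- The convolution costs no weight, and the factor `|ξ| ≤ |ζ|` of the derivative is absorbed by the
time integral of `exp(-(T + 1 - |s|)|ζ|)`. -/
lemma Bdd.duh (hT : 0 < T) (hU : Bdd T U D) (hV : Bdd T V D') :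
    Bdd T (duh U V) (bilConst * (D * D')) := by
  have hD := hU.nonneg hT
  have hD' := hV.nonneg hT
  refine ⟨stronglyMeasurable_duh hU.meas hV.meas, fun t ht ζ => ?_⟩
  have h1 : ‖∫ s in (0 : ℝ)..t, propagator (t - s) ζ * conv (U s) (V s) ζ‖ ≤
      |∫ s in (0 : ℝ)..t, 16 * bracketInt * (D * D') * bracket ζ * Real.exp (-(T + 1 - |s|) * ‖ζ‖)| := by
    refine intervalIntegral.norm_integral_le_abs_of_norm_le ?_ ?_
    · filter_upwards [ae_restrict_mem measurableSet_uIoc] with s hs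
      refine (norm_integrand_le hU hV hD hD' (uIoc_subset hT ht hs) _ ζ).trans_eq ?_
      unfold weight
      ring
    · exact (by fun_prop : Continuous fun s : ℝ => 16 * bracketInt * (D * D') * bracket ζ *
        Real.exp (-(T + 1 - |s|) * ‖ζ‖)).intervalIntegrable _ _
  have hK : 0 ≤ 16 * bracketInt * (D * D') * bracket ζ :=
    mul_nonneg (mul_nonneg (mul_nonneg (by norm_num) bracketInt_nonneg) (mul_nonneg hD hD')) (bracket_pos ζ).le
  rw [intervalIntegral.integral_const_mul, abs_mul, abs_of_nonneg hK] at h1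
  unfold KPII.duh
  rw [norm_mul]
  have h2 : ‖-(Complex.I * (ζ 0 : ℂ) * (c₀ : ℂ))‖ ≤ c₀ * ‖ζ‖ := by
    rw [norm_neg, norm_mul, norm_mul, Complex.norm_I, one_mul, Complex.norm_real, Complex.norm_real,
      Real.norm_of_nonneg c₀_pos.le, mul_comm]
    exact mul_le_mul_of_nonneg_left (abs_coord_le ζ 0) c₀_pos.le
  calc _ ≤ (c₀ * ‖ζ‖) * (16 * bracketInt * (D * D') * bracket ζ *
        |∫ s in (0 : ℝ)..t, Real.exp (-(T + 1 - |s|) * ‖ζ‖)|) :=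
        mul_le_mul h2 h1 (norm_nonneg _) (mul_nonneg c₀_pos.le (norm_nonneg _))
    _ = c₀ * (16 * bracketInt * (D * D') * bracket ζ) *
        (‖ζ‖ * |∫ s in (0 : ℝ)..t, Real.exp (-(T + 1 - |s|) * ‖ζ‖)|) := by ring
    _ ≤ c₀ * (16 * bracketInt * (D * D') * bracket ζ) * Real.exp (-(T + 1 - |t|) * ‖ζ‖) :=
        mul_le_mul_of_nonneg_left (mul_abs_integral_exp_le T t ‖ζ‖)
          (mul_nonneg c₀_pos.le hK)
    _ = _ := by unfold bilConst weight; ring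

lemma conv_sub_conv (hU : Bdd T U D) (hV : Bdd T V D) (hD : 0 ≤ D) {t : ℝ} (ht : t ∈ Icc (-T) T)
    (ζ : Space) : conv (U t) (U t) ζ - conv (V t) (V t) ζ =
      conv (U t - V t) (U t) ζ + conv (V t) (U t - V t) ζ := by
  have hE := hU.sub hV
  have hDD : 0 ≤ D + D := by linarith
  change (∫ ζ₁, U t ζ₁ * U t (ζ - ζ₁)) - (∫ ζ₁, V t ζ₁ * V t (ζ - ζ₁)) =
    (∫ ζ₁, (U t ζ₁ - V t ζ₁) * U t (ζ - ζ₁)) + ∫ ζ₁, V t ζ₁ * (U t (ζ - ζ₁) - V t (ζ - ζ₁))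
  rw [← integral_sub (integrable_conv hU hU hD hD ht ζ) (integrable_conv hV hV hD hD ht ζ),
    ← integral_add (integrable_conv hE hU hDD hD ht ζ) (integrable_conv hV hE hD hDD ht ζ)]
  congr 1
  funext ζ₁
  ring

lemma duh_sub_duh (hT : 0 < T) (hU : Bdd T U D) (hV : Bdd T V D) {t : ℝ} (ht : t ∈ Icc (-T) T)
    (ζ : Space) : duh U U t ζ - duh V V t ζ =
      duh (fun t ζ => U t ζ - V t ζ) U t ζ + duh V (fun t ζ => U t ζ - V t ζ) t ζ := by
  have hE := hU.sub hV
  unfold duh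
  rw [← mul_sub, ← mul_add, ← intervalIntegral.integral_sub (intervalIntegrable_integrand hT hU hU ht t ζ)
    (intervalIntegrable_integrand hT hV hV ht t ζ),
    ← intervalIntegral.integral_add (intervalIntegrable_integrand hT hE hU ht t ζ)
    (intervalIntegrable_integrand hT hV hE ht t ζ)]
  congr 1
  refine intervalIntegral.integral_congr fun s hs => ?_
  have := conv_sub_conv hU hV (hU.nonneg hT) (uIcc_subset hT ht hs) ζ
  change propagator (t - s) ζ * conv (U s) (U s) ζ - propagator (t - s) ζ * conv (V s) (V s) ζ = _
  rw [← mul_sub, this, mul_add]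
  rfl

lemma norm_duh_sub_duh_le (hT : 0 < T) (hU : Bdd T U D) (hV : Bdd T V D) {E : ℝ}
    (hE : ∀ t ∈ Icc (-T) T, ∀ ζ, ‖U t ζ - V t ζ‖ ≤ E * weight T t ζ) {t : ℝ} (ht : t ∈ Icc (-T) T)
    (ζ : Space) : ‖duh U U t ζ - duh V V t ζ‖ ≤ 2 * bilConst * D * E * weight T t ζ := by
  have hB : Bdd T (fun t ζ => U t ζ - V t ζ) E := ⟨(hU.sub hV).meas, hE⟩
  rw [duh_sub_duh hT hU hV ht ζ]
  refine (norm_add_le _ _).trans ((add_le_add ((hB.duh hT hU).le t ht ζ) ((hV.duh hT hB).le t ht ζ)).trans_eq ?_)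
  ring

/-- The Picard iterates. -/
def picard (L : ℝ → Space → ℂ) : ℕ → ℝ → Space → ℂ
  | 0 => fun _ _ => 0
  | k + 1 => fun t ζ => L t ζ + duh (picard L k) (picard L k) t ζ

/-- Invariance of the ball of radius `2d` needs only `4 bilConst d ≤ 1`; the constant 8 makes the
contraction factor `4 bilConst d` at most `1/2`. -/
lemma bdd_picard (hT : 0 < T) {L : ℝ → Space → ℂ} {d : ℝ} (hL : Bdd T L d)
    (hd : 8 * bilConst * d ≤ 1) (k : ℕ) : Bdd T (picard L k) (2 * d) := by
  have hd0 := hL.nonneg hT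
  induction k with
  | zero => exact ⟨stronglyMeasurable_const, fun t ht ζ => by
      simp only [picard, norm_zero]
      exact mul_nonneg (by linarith) (weight_pos _ _ _).le⟩
  | succ k ih =>
    refine (hL.add (ih.duh hT ih)).mono ?_
    nlinarith

lemma picard_succ_sub (hT : 0 < T) {L : ℝ → Space → ℂ} {d : ℝ} (hL : Bdd T L d)
    (hd : 8 * bilConst * d ≤ 1) (k : ℕ) : ∀ t ∈ Icc (-T) T, ∀ ζ,
      ‖picard L (k + 1) t ζ - picard L k t ζ‖ ≤ d * (1 / 2) ^ k * weight T t ζ := by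
  have hd0 := hL.nonneg hT
  induction k with
  | zero =>
    intro t ht ζ
    simpa [picard, KPII.duh, conv] using hL.le t ht ζ
  | succ k ih =>
    intro t ht ζ
    have h := norm_duh_sub_duh_le hT (bdd_picard hT hL hd (k + 1)) (bdd_picard hT hL hd k) ih ht ζ
    have e : picard L (k + 1 + 1) t ζ - picard L (k + 1) t ζ =
        duh (picard L (k + 1)) (picard L (k + 1)) t ζ - duh (picard L k) (picard L k) t ζ := by
      change (L t ζ + _) - (L t ζ + _) = _
      ring
    rw [e]
    refine h.trans (mul_le_mul_of_nonneg_right ?_ (weight_pos _ _ _).le)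
    have : (0 : ℝ) ≤ d * (1 / 2) ^ k := by positivity
    calc 2 * bilConst * (2 * d) * (d * (1 / 2) ^ k) = (8 * bilConst * d) / 2 * (d * (1 / 2) ^ k) := by ring
      _ ≤ 1 / 2 * (d * (1 / 2) ^ k) := by gcongr
      _ = _ := by ring

/-- The Duhamel equation with small data in the analytic norm has a solution. -/
lemma exists_fixedPoint (hT : 0 < T) {L : ℝ → Space → ℂ} {d : ℝ} (hL : Bdd T L d)
    (hd : 8 * bilConst * d ≤ 1) :
    ∃ U, Bdd T U (2 * d) ∧ ∀ t ∈ Icc (-T) T, ∀ ζ, U t ζ = L t ζ + duh U U t ζ := by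
  have hd0 := hL.nonneg hT
  let P := picard L
  -- For `t` outside `[-T, T]` convergence is not known and the value is arbitrary; only joint
  -- measurability is needed there.
  let U : ℝ → Space → ℂ := fun t ζ => limUnder atTop fun k => P k t ζ
  have hdist : ∀ t ∈ Icc (-T) T, ∀ ζ k, dist (P k t ζ) (P (k + 1) t ζ) ≤
      2 * d * weight T t ζ / 2 / 2 ^ k := by
    intro t ht ζ k
    rw [dist_comm, dist_eq_norm]
    refine (picard_succ_sub hT hL hd k t ht ζ).trans_eq ?_
    rw [div_pow, one_pow]; ring
  have hlim : ∀ t ∈ Icc (-T) T, ∀ ζ, Tendsto (fun k => P k t ζ) atTop (𝓝 (U t ζ)) := by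
    intro t ht ζ
    exact (cauchySeq_of_le_geometric_two (hdist t ht ζ)).tendsto_limUnder
  have hclose : ∀ t ∈ Icc (-T) T, ∀ ζ k, ‖U t ζ - P k t ζ‖ ≤ 2 * d / 2 ^ k * weight T t ζ := by
    intro t ht ζ k
    rw [← dist_eq_norm, dist_comm]
    refine (dist_le_of_le_geometric_two_of_tendsto (hdist t ht ζ) (hlim t ht ζ) k).trans_eq ?_
    ring
  have hU : Bdd T U (2 * d) := by
    refine ⟨StronglyMeasurable.limUnder fun k => (bdd_picard hT hL hd k).meas, fun t ht ζ => ?_⟩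
    exact le_of_tendsto (hlim t ht ζ).norm
      (Eventually.of_forall fun k => (bdd_picard hT hL hd k).le t ht ζ)
  refine ⟨U, hU, fun t ht ζ => ?_⟩
  refine tendsto_nhds_unique ((tendsto_add_atTop_iff_nat 1).2 (hlim t ht ζ)) ?_
  refine Tendsto.const_add (L t ζ) ?_
  rw [tendsto_iff_norm_sub_tendsto_zero]
  have hz : Tendsto (fun k : ℕ => 2 * bilConst * (2 * d) * (2 * d / 2 ^ k) * weight T t ζ) atTop (𝓝 0) := by
    have h1 : Tendsto (fun k : ℕ => ((1 : ℝ) / 2) ^ k) atTop (𝓝 0) :=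
      tendsto_pow_atTop_nhds_zero_of_lt_one (by norm_num) (by norm_num)
    have h2 := h1.const_mul (2 * bilConst * (2 * d) * (2 * d) * weight T t ζ)
    rw [mul_zero] at h2
    refine h2.congr fun k => ?_
    rw [div_pow, one_pow]; ring
  refine squeeze_zero (fun _ => norm_nonneg _) (fun k => ?_) hz
  rw [norm_sub_rev]
  exact norm_duh_sub_duh_le hT hU (bdd_picard hT hL hd k) (fun t ht ζ => hclose t ht ζ k) ht ζ

/-- The linear evolution. -/
def linEvol (φ : Space → ℂ) (t : ℝ) (ζ : Space) : ℂ := propagator t ζ * φ ζ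

lemma bdd_linEvol {φ : Space → ℂ} {d : ℝ} (hφ : Measurable φ) (hd : 0 ≤ d)
    (hb : ∀ ζ, ‖φ ζ‖ ≤ d * weight T 0 ζ) : Bdd T (linEvol φ) d := by
  refine ⟨(measurable_propagator.mul (hφ.comp measurable_snd)).stronglyMeasurable, fun t _ ζ => ?_⟩
  rw [linEvol, norm_mul, norm_propagator, one_mul]
  exact (hb ζ).trans (mul_le_mul_of_nonneg_left (weight_zero_le T t ζ) hd)

lemma duh_linEvol_smul (φ : Space → ℂ) (c : ℂ) (t : ℝ) (ζ : Space) :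
    duh (linEvol (c • φ)) (linEvol (c • φ)) t ζ = c ^ 2 * duh (linEvol φ) (linEvol φ) t ζ := by
  have h : ∀ s, conv (linEvol (c • φ) s) (linEvol (c • φ) s) ζ = c ^ 2 * conv (linEvol φ s) (linEvol φ s) ζ := by
    intro s
    unfold conv linEvol
    rw [← integral_const_mul]
    congr 1
    funext ζ₁
    simp only [Pi.smul_apply, smul_eq_mul]
    ring
  unfold duh
  simp only [h]
  rw [mul_left_comm]
  congr 1
  rw [← intervalIntegral.integral_const_mul]
  congr 1
  funext s
  ring

/-- Solutions of the Duhamel equation agree to third order with their second Picard iterate. -/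
lemma norm_sub_second_order_le (hT : 0 < T) {φ : Space → ℂ} {d : ℝ} (hL : Bdd T (linEvol φ) d)
    (hU : Bdd T U (2 * d)) (hfix : ∀ t ∈ Icc (-T) T, ∀ ζ, U t ζ = linEvol φ t ζ + duh U U t ζ)
    {t : ℝ} (ht : t ∈ Icc (-T) T) (ζ : Space) :
    ‖U t ζ - linEvol φ t ζ - duh (linEvol φ) (linEvol φ) t ζ‖ ≤ 16 * bilConst ^ 2 * d ^ 3 * weight T t ζ := by
  have hd := hL.nonneg hT
  have h1 : ∀ t ∈ Icc (-T) T, ∀ ζ, ‖U t ζ - linEvol φ t ζ‖ ≤ bilConst * (2 * d * (2 * d)) * weight T t ζ := by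
    intro t ht ζ
    have := (hU.duh hT hU).le t ht ζ
    rw [hfix t ht ζ, add_sub_cancel_left]
    exact this
  -- Both functions lie in the ball of radius `2d` and differ by `4 bilConst d²`, so the constant is
  -- `2 bilConst · 2d · 4 bilConst d²`.
  have h2 := norm_duh_sub_duh_le hT hU (hL.mono (by linarith)) h1 ht ζ
  have e : U t ζ - linEvol φ t ζ = duh U U t ζ := by
    rw [sub_eq_iff_eq_add', ← hfix t ht ζ]
  rw [e]
  refine h2.trans_eq ?_
  ring

end

end

end KPII

/-! ### Fixed points are regular solutions in the sense of `IsSolution`. -/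

namespace KPII

noncomputable section

/-- Shows that `bracket` is square integrable for `sobMeasure`, so it can serve as a majorant in
`H¹`. -/
lemma bracket_sq_mul_le (ζ : Space) : (1 + ‖ζ‖ ^ 2) * bracket ζ ^ 2 ≤ bracket ζ := by
  have h : 1 ≤ 1 + ‖ζ‖ ^ 2 := by nlinarith [sq_nonneg ‖ζ‖]
  unfold bracket
  generalize 1 + ‖ζ‖ ^ 2 = A at *
  have e : A * ((A ^ 2)⁻¹) ^ 2 = (A ^ 2)⁻¹ * A⁻¹ := by field_simp
  rw [e]
  exact mul_le_of_le_one_right (by positivity) (inv_le_one_of_one_le₀ h)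

lemma integrable_sob_iff {g : Space → ℝ} : Integrable g sobMeasure ↔
    Integrable fun ζ => (1 + ‖ζ‖ ^ 2) * g ζ := by
  unfold sobMeasure
  rw [integrable_withDensity_iff_integrable_smul' measurable_sobWeight
    (by filter_upwards with x using ENNReal.ofReal_lt_top)]
  have : ∀ ζ : Space, (ENNReal.ofReal (1 + ‖ζ‖ ^ 2)).toReal • g ζ = (1 + ‖ζ‖ ^ 2) * g ζ := fun ζ => by
    rw [ENNReal.toReal_ofReal (by positivity), smul_eq_mul]
  simp only [this]

lemma integrable_bracket_sq_sob (D : ℝ) : Integrable (fun ζ => (D * bracket ζ) ^ 2) sobMeasure := by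
  rw [integrable_sob_iff]
  have hb := measurable_bracket
  refine (integrable_bracket.const_mul (D ^ 2)).mono' (by fun_prop) (Eventually.of_forall fun ζ => ?_)
  rw [Real.norm_of_nonneg (by positivity), mul_pow, mul_left_comm]
  exact mul_le_mul_of_nonneg_left (bracket_sq_mul_le ζ) (sq_nonneg D)

lemma memLp_of_le_bracket {f : Space → ℂ} (hf : Measurable f) {D : ℝ} (h : ∀ ζ, ‖f ζ‖ ≤ D * bracket ζ) :
    MemLp f 2 sobMeasure := by
  rw [memLp_two_iff_integrable_sq_norm hf.aestronglyMeasurable]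
  refine (integrable_bracket_sq_sob D).mono' (by fun_prop) (Eventually.of_forall fun ζ => ?_)
  rw [Real.norm_of_nonneg (by positivity)]
  exact pow_le_pow_left₀ (norm_nonneg _) (h ζ) 2

lemma integrable_of_le_bracket {f : Space → ℂ} (hf : Measurable f) {D : ℝ} (h : ∀ ζ, ‖f ζ‖ ≤ D * bracket ζ) :
    Integrable f :=
  (integrable_bracket.const_mul D).mono' hf.aestronglyMeasurable (Eventually.of_forall h)

section

variable {T D : ℝ} {U : ℝ → Space → ℂ}

lemma Bdd.le_bracket (hT : 0 < T) (hU : Bdd T U D) {t : ℝ} (ht : t ∈ Icc (-T) T) (ζ : Space) :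
    ‖U t ζ‖ ≤ D * bracket ζ :=
  (hU.le t ht ζ).trans (mul_le_mul_of_nonneg_left (weight_le_bracket ht ζ) (hU.nonneg hT))

lemma Bdd.memLp (hT : 0 < T) (hU : Bdd T U D) {t : ℝ} (ht : t ∈ Icc (-T) T) :
    MemLp (U t) 2 sobMeasure :=
  memLp_of_le_bracket (hU.measurable_slice t) (hU.le_bracket hT ht)

/-- By the group property `S(t)` comes out of the integral, and what remains is a primitive of a
function independent of `t`. -/
lemma continuousOn_duh (hT : 0 < T) (hU : Bdd T U D) (ζ : Space) :
    ContinuousOn (fun t => duh U U t ζ) (Icc (-T) T) := by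
  have hD := hU.nonneg hT
  have h1 : ContinuousOn (fun t => ∫ s in (0 : ℝ)..t, propagator (0 - s) ζ * conv (U s) (U s) ζ) (Icc (-T) T) := by
    rw [← uIcc_of_le (by linarith : -T ≤ T)]
    refine intervalIntegral.continuousOn_primitive_interval' ?_ ?_
    · rw [intervalIntegrable_iff_integrableOn_Icc_of_le (by linarith)]
      exact integrableOn_integrand hU hU hD hD 0 ζ
    · rw [uIcc_of_le (by linarith)]
      exact ⟨by linarith, hT.le⟩
  have h2 : (fun t => duh U U t ζ) = fun t => -(Complex.I * (ζ 0 : ℂ) * (c₀ : ℂ)) *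
      (propagator t ζ * ∫ s in (0 : ℝ)..t, propagator (0 - s) ζ * conv (U s) (U s) ζ) := by
    funext t
    unfold duh
    congr 1
    rw [← intervalIntegral.integral_const_mul]
    congr 1
    funext s
    rw [← mul_assoc, ← propagator_add]
    congr 2
    ring
  rw [h2]
  exact continuousOn_const.mul ((continuous_propagator ζ).continuousOn.mul h1)

variable {p q : ℝ≥0∞} [Fact (1 ≤ p)] [Fact (1 ≤ q)]

/-- Continuity at each frequency becomes continuity in `H¹` by dominated convergence with majorant
`2 D bracket`, and `H¹` embeds continuously. -/
lemma continuousOn_elem (hp : 2 < p) (hp' : p < ⊤) (hT : 0 < T) (hU : Bdd T U D)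
    (hc : ∀ ζ, ContinuousOn (fun t => U t ζ) (Icc (-T) T)) :
    ContinuousOn (fun t => elem q hp hp' (U t)) (Icc (-T) T) := by
  intro t₀ ht₀
  have hlim : Tendsto (fun t => ∫⁻ ζ, ‖U t ζ - U t₀ ζ‖ₑ ^ 2 ∂sobMeasure) (𝓝[Icc (-T) T] t₀) (𝓝 0) := by
    have : (0 : ℝ≥0∞) = ∫⁻ ζ : Space, 0 ∂sobMeasure := by simp
    rw [this]
    refine tendsto_lintegral_filter_of_dominated_convergence
      (fun ζ => ENNReal.ofReal (((2 * D) * bracket ζ) ^ 2)) ?_ ?_ ?_ ?_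
    · exact Eventually.of_forall fun t =>
        (((hU.measurable_slice t).sub (hU.measurable_slice t₀)).enorm).pow_const 2
    · filter_upwards [self_mem_nhdsWithin] with t ht
      refine Eventually.of_forall fun ζ => ?_
      rw [← ofReal_norm, ← ENNReal.ofReal_pow (norm_nonneg _)]
      refine ENNReal.ofReal_le_ofReal (pow_le_pow_left₀ (norm_nonneg _) ?_ 2)
      refine (norm_sub_le _ _).trans ?_
      linarith [hU.le_bracket hT ht ζ, hU.le_bracket hT ht₀ ζ]
    · rw [← ofReal_integral_eq_lintegral_ofReal (integrable_bracket_sq_sob _)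
        (Eventually.of_forall fun ζ => sq_nonneg _)]
      exact ENNReal.ofReal_ne_top
    · refine Eventually.of_forall fun ζ => ?_
      have h1 : Tendsto (fun t => U t ζ - U t₀ ζ) (𝓝[Icc (-T) T] t₀) (𝓝 0) := by
        have := (hc ζ t₀ ht₀).tendsto.sub_const (U t₀ ζ)
        simpa using this
      have h2 := ((continuous_enorm.tendsto (0 : ℂ)).comp h1)
      have h3 := ENNReal.Tendsto.pow (n := 2) h2
      simpa using h3
  have hlim2 : Tendsto (fun t => (∑' j, rate j) *
      Real.sqrt (∫⁻ ζ, ‖U t ζ - U t₀ ζ‖ₑ ^ 2 ∂sobMeasure).toReal) (𝓝[Icc (-T) T] t₀) (𝓝 0) := by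
    have h1 := (ENNReal.tendsto_toReal ENNReal.zero_ne_top).comp hlim
    have h2 := ((Real.continuous_sqrt.tendsto _).comp h1).const_mul (∑' j, rate j)
    simpa using h2
  rw [ContinuousWithinAt, tendsto_iff_norm_sub_tendsto_zero]
  refine squeeze_zero' (Eventually.of_forall fun _ => norm_nonneg _) ?_ hlim2
  filter_upwards [self_mem_nhdsWithin] with t ht
  have m1 := hU.memLp hT ht
  have m2 := hU.memLp hT ht₀
  rw [← elem_sub hp hp' m1 m2]
  refine (norm_elem_le hp hp' (m1.sub m2)).trans_eq ?_
  congr 1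
  have := norm_toLp_sq (m1.sub m2)
  simp only [Pi.sub_apply] at this
  rw [← this, ENNReal.toReal_ofReal (sq_nonneg _), Real.sqrt_sq (norm_nonneg _)]

/-- Use `1 + x² ≤ (1 + x)²` and one term of the exponential series at `1 + x`. -/
lemma pow_mul_exp_le (N : ℕ) {x : ℝ} (hx : 0 ≤ x) :
    (1 + x ^ 2) ^ N * Real.exp (-x) ≤ (2 * N).factorial * Real.exp 1 := by
  have h1 := Real.pow_div_factorial_le_exp (1 + x) (by linarith) (2 * N)
  rw [div_le_iff₀ (by positivity)] at h1
  have h2 : (1 + x ^ 2) ^ N ≤ (1 + x) ^ (2 * N) := by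
    rw [pow_mul]
    gcongr
    nlinarith
  calc (1 + x ^ 2) ^ N * Real.exp (-x) ≤ (Real.exp (1 + x) * (2 * N).factorial) * Real.exp (-x) := by
        gcongr
        exact h2.trans h1
    _ = (2 * N).factorial * Real.exp 1 := by
        rw [mul_assoc, mul_comm, mul_assoc, ← Real.exp_add]
        congr 2
        ring

/-- The summand 1 in the radius `T + 1 - |t|` leaves a factor `exp(-|ζ|)` at every time in `[-T,
T]`, which beats every Sobolev weight uniformly in `t`. -/
lemma isRegular_elem (hp : 2 < p) (hp' : p < ⊤) (hT : 0 < T) (hU : Bdd T U D) :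
    IsRegular T fun t => elem q hp hp' (U t) := by
  intro N
  have hD := hU.nonneg hT
  refine ⟨∫ ζ, D ^ 2 * ((2 * N).factorial * Real.exp 1) * bracket ζ, fun t ht => ?_⟩
  rw [ofReal_integral_eq_lintegral_ofReal (integrable_bracket.const_mul _)
    (Eventually.of_forall fun ζ => mul_nonneg (by positivity) (bracket_pos ζ).le)]
  refine lintegral_mono_ae ?_
  filter_upwards [hat_elem_ae (q := q) hp hp' (hU.memLp hT ht)] with ζ hζ
  rw [hζ]
  refine ENNReal.ofReal_le_ofReal ?_
  have h1 : ‖U t ζ‖ ^ 2 ≤ D ^ 2 * (Real.exp (-‖ζ‖) * bracket ζ) := by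
    have h2 := (hU.le t ht ζ).trans (mul_le_mul_of_nonneg_left (weight_le ht ζ) hD)
    have h3 : Real.exp (-‖ζ‖) * bracket ζ ≤ 1 := by
      refine mul_le_one₀ ?_ (bracket_pos ζ).le (bracket_le_one ζ)
      rw [Real.exp_le_one_iff]
      exact neg_nonpos.2 (norm_nonneg _)
    have h4 : 0 ≤ Real.exp (-‖ζ‖) * bracket ζ := mul_nonneg (Real.exp_pos _).le (bracket_pos ζ).le
    calc ‖U t ζ‖ ^ 2 ≤ (D * (Real.exp (-‖ζ‖) * bracket ζ)) ^ 2 := pow_le_pow_left₀ (norm_nonneg _) h2 2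
      _ = D ^ 2 * ((Real.exp (-‖ζ‖) * bracket ζ) * (Real.exp (-‖ζ‖) * bracket ζ)) := by ring
      _ ≤ D ^ 2 * (Real.exp (-‖ζ‖) * bracket ζ) := by
          exact mul_le_mul_of_nonneg_left (mul_le_of_le_one_right h4 h3) (sq_nonneg D)
  calc (1 + ‖ζ‖ ^ 2) ^ N * ‖U t ζ‖ ^ 2 ≤ (1 + ‖ζ‖ ^ 2) ^ N * (D ^ 2 * (Real.exp (-‖ζ‖) * bracket ζ)) := by
        gcongr
    _ = D ^ 2 * ((1 + ‖ζ‖ ^ 2) ^ N * Real.exp (-‖ζ‖)) * bracket ζ := by ring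
    _ ≤ _ := by
        exact mul_le_mul_of_nonneg_right (mul_le_mul_of_nonneg_left
          (pow_mul_exp_le N (norm_nonneg ζ)) (sq_nonneg D)) (bracket_pos ζ).le

/-! Frequency multipliers bounded by one almost everywhere. -/

lemma ae_sub_left {P : Space → Prop} (h : ∀ᵐ ζ, P ζ) (ζ : Space) : ∀ᵐ ζ₁, P (ζ - ζ₁) :=
  (quasiMeasurePreserving_sub_left volume ζ).ae h

lemma norm_mult_le (hU : Bdd T U D) (hD : 0 ≤ D) {W : Space → ℂ} (hW : ∀ᵐ ζ, ‖W ζ‖ ≤ 1)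
    {t : ℝ} (ht : t ∈ Icc (-T) T) (ζ : Space) : ∀ᵐ ζ₁,
      ‖(W ζ₁ * U t ζ₁) * (W (ζ - ζ₁) * U t (ζ - ζ₁))‖ ≤
        D * D * (8 * weight T t ζ) * (bracket ζ₁ + bracket (ζ - ζ₁)) := by
  filter_upwards [hW, ae_sub_left hW ζ] with ζ₁ h1 h2
  refine le_trans ?_ (norm_mul_slice_le hU hU hD hD ht ζ ζ₁)
  rw [norm_mul, norm_mul, norm_mul, norm_mul]
  gcongr
  · exact mul_le_of_le_one_left (norm_nonneg _) h1
  · exact mul_le_of_le_one_left (norm_nonneg _) h2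

lemma norm_conv_mult_le (hU : Bdd T U D) (hD : 0 ≤ D) {W : Space → ℂ} (hW : ∀ᵐ ζ, ‖W ζ‖ ≤ 1)
    {t : ℝ} (ht : t ∈ Icc (-T) T) (ζ : Space) :
    ‖conv (fun ζ => W ζ * U t ζ) (fun ζ => W ζ * U t ζ) ζ‖ ≤ 16 * bracketInt * (D * D) * bracket ζ := by
  refine (norm_integral_le_of_norm_le ((integrable_bracket_pair ζ).const_mul _)
    (norm_mult_le hU hD hW ht ζ)).trans ?_
  rw [integral_const_mul, integral_bracket_pair]
  have := bracketInt_nonneg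
  calc D * D * (8 * weight T t ζ) * (2 * bracketInt) = 16 * bracketInt * (D * D) * weight T t ζ := by ring
    _ ≤ _ := by
      gcongr
      exact weight_le_bracket ht ζ

lemma tendsto_conv_cover (hU : Bdd T U D) (hD : 0 ≤ D) {t : ℝ} (ht : t ∈ Icc (-T) T) (ζ : Space) :
    Tendsto (fun A => conv (fun ζ => cover A ζ * U t ζ) (fun ζ => cover A ζ * U t ζ) ζ) atTop
      (𝓝 (conv (U t) (U t) ζ)) := by
  -- Dominated convergence applies along finite sets because the index set is countable, so that
  -- `atTop` is countably generated.
  refine tendsto_integral_filter_of_dominated_convergence _ ?_ ?_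
    ((integrable_bracket_pair ζ).const_mul (D * D * (8 * weight T t ζ))) ?_
  · refine Eventually.of_forall fun A => Measurable.aestronglyMeasurable ?_
    have h : Measurable fun ζ => cover A ζ * U t ζ := (measurable_cover A).mul (hU.measurable_slice t)
    exact h.mul (h.comp (measurable_const.sub measurable_id))
  · exact Eventually.of_forall fun A => norm_mult_le hU hD (ae_cover.mono fun ζ h => h.1 A) ht ζ
  · filter_upwards [ae_cover, ae_sub_left ae_cover ζ] with ζ₁ h1 h2
    refine tendsto_nhds_of_eventually_eq ?_
    filter_upwards [h1.2, h2.2] with A e1 e2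
    rw [e1, e2, one_mul, one_mul]

lemma hatSq_elem (hp : 2 < p) (hp' : p < ⊤) {f : Space → ℂ} (hf : MemLp f 2 sobMeasure)
    (A : Finset Index) (ζ : Space) : hatSq A (elem q hp hp' f) ζ =
      c₀ * conv (fun ζ => cover A ζ * f ζ) (fun ζ => cover A ζ * f ζ) ζ := by
  unfold hatSq conv
  congr 1
  have h := hatTrunc_elem_ae (q := q) hp hp' hf A
  refine integral_congr_ae ?_
  filter_upwards [h, ae_sub_left h ζ] with ζ₁ h1 h2
  rw [h1, h2]

/-- The integrand of the Duhamel formula tested against `θ`, with a frequency multiplier. -/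
def testIntegrand (U : ℝ → Space → ℂ) (θ W : Space → ℂ) (t s : ℝ) (ζ : Space) : ℂ :=
  propagator (t - s) ζ * (Complex.I * (ζ 0 : ℂ)) *
    (c₀ * conv (fun ζ => W ζ * U s ζ) (fun ζ => W ζ * U s ζ) ζ) * θ ζ

lemma stronglyMeasurable_testIntegrand (hU : Bdd T U D) {θ W : Space → ℂ} (hθ : Measurable θ)
    (hW : Measurable W) (t : ℝ) :
    StronglyMeasurable (Function.uncurry (testIntegrand U θ W t)) := by
  have hWU : StronglyMeasurable (Function.uncurry fun s ζ => W ζ * U s ζ) :=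
    ((hW.comp measurable_snd).mul hU.meas.measurable).stronglyMeasurable
  have h1 := (stronglyMeasurable_conv hWU hWU).measurable
  have h2 : Measurable fun x : ℝ × Space => propagator (t - x.1) x.2 := by
    have m : Measurable fun x : ℝ × Space => (t - x.1, x.2) := by fun_prop
    exact measurable_propagator.comp m
  have h3 : Measurable fun x : ℝ × Space => Complex.I * ((x.2 0 : ℝ) : ℂ) := by
    have : Measurable fun x : ℝ × Space => x.2 0 := (measurable_coord 0).comp measurable_snd
    fun_prop
  exact (((h2.mul h3).mul (h1.const_mul _)).mul (hθ.comp measurable_snd)).stronglyMeasurable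

lemma norm_testIntegrand_le (hU : Bdd T U D) (hD : 0 ≤ D) {θ W : Space → ℂ}
    (hW : ∀ᵐ ζ, ‖W ζ‖ ≤ 1) (t : ℝ) {s : ℝ} (hs : s ∈ Icc (-T) T) (ζ : Space) :
    ‖testIntegrand U θ W t s ζ‖ ≤ c₀ * (16 * bracketInt * (D * D)) * (‖ζ‖ * ‖θ ζ‖) := by
  unfold testIntegrand
  rw [norm_mul, norm_mul, norm_mul, norm_mul, norm_mul, norm_propagator, Complex.norm_I, one_mul, one_mul,
    Complex.norm_real, Complex.norm_real, Real.norm_of_nonneg c₀_pos.le]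
  have h1 := norm_conv_mult_le hU hD hW hs ζ
  have h2 : ‖ζ 0‖ ≤ ‖ζ‖ := abs_coord_le ζ 0
  have hK := bracketInt_nonneg
  have hc := c₀_pos
  have h3 : 16 * bracketInt * (D * D) * bracket ζ ≤ 16 * bracketInt * (D * D) :=
    mul_le_of_le_one_right (by positivity) (bracket_le_one ζ)
  calc _ ≤ ‖ζ‖ * (c₀ * (16 * bracketInt * (D * D))) * ‖θ ζ‖ := by
        gcongr
        exact h1.trans h3
    _ = _ := by ring

lemma tendsto_integral_testIntegrand (hU : Bdd T U D) (hD : 0 ≤ D) {θ : Space → ℂ} (hθ : Measurable θ)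
    (t : ℝ) {s : ℝ} (hs : s ∈ Icc (-T) T)
    (hθi : Integrable fun ζ : Space => c₀ * (16 * bracketInt * (D * D)) * (‖ζ‖ * ‖θ ζ‖)) :
    Tendsto (fun A => ∫ ζ, testIntegrand U θ (cover A) t s ζ) atTop
      (𝓝 (∫ ζ, testIntegrand U θ 1 t s ζ)) := by
  refine tendsto_integral_filter_of_dominated_convergence _ ?_ ?_ hθi ?_
  · exact Eventually.of_forall fun A => (stronglyMeasurable_testIntegrand hU hθ
      (measurable_cover A) t).measurable.of_uncurry_left.aestronglyMeasurable
  · exact Eventually.of_forall fun A => Eventually.of_forall fun ζ =>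
      norm_testIntegrand_le hU hD (ae_cover.mono fun ζ h => h.1 A) t hs ζ
  · refine Eventually.of_forall fun ζ => ?_
    have h := tendsto_conv_cover hU hD hs ζ
    have h1 : testIntegrand U θ 1 t s ζ = propagator (t - s) ζ * (Complex.I * (ζ 0 : ℂ)) *
        (c₀ * conv (U s) (U s) ζ) * θ ζ := by
      simp only [testIntegrand, Pi.one_apply, one_mul]
    rw [h1]
    exact ((h.const_mul _).const_mul _).mul_const _

/-- The truncations act as the multipliers `cover A`, bounded by 1 and tending to 1 almost
everywhere. Hence the limit along `A` is the untruncated term, and after Fubini Duhamel's formula is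
the fixed point identity at each frequency. -/
lemma isSolution_elem (hp : 2 < p) (hp' : p < ⊤) (hT : 0 < T) (hU : Bdd T U D) {φ : Space → ℂ} {d : ℝ}
    (hφ : Measurable φ) (hφd : ∀ ζ, ‖φ ζ‖ ≤ d * bracket ζ)
    (hfix : ∀ t ∈ Icc (-T) T, ∀ ζ, U t ζ = linEvol φ t ζ + duh U U t ζ) :
    IsSolution T (elem q hp hp' φ) fun t => elem q hp hp' (U t) := by
  have hD := hU.nonneg hT
  have h0 : (0 : ℝ) ∈ Icc (-T) T := ⟨by linarith, hT.le⟩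
  refine ⟨continuousOn_elem hp hp' hT hU fun ζ => ?_, ?_, ?_⟩
  · refine ContinuousOn.congr ?_ fun t ht => hfix t ht ζ
    exact ((continuous_propagator ζ).mul continuous_const).continuousOn.add (continuousOn_duh hT hU ζ)
  · have : U 0 = φ := by
      funext ζ
      rw [hfix 0 h0 ζ]
      simp [linEvol, propagator_zero, KPII.duh]
    simp only [this]
  intro t ht θ hθ hθc _
  have hsub := uIcc_subset hT ht
  have hsub' := uIoc_subset hT ht
  have hθm : Measurable θ := hθ.continuous.measurable
  let B : ℝ := c₀ * (16 * bracketInt * (D * D))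
  have hBi : Integrable fun ζ : Space => B * (‖ζ‖ * ‖θ ζ‖) := by
    refine Integrable.const_mul ?_ _
    have hc : Continuous fun ζ : Space => ‖ζ‖ * ‖θ ζ‖ := by
      have := hθ.continuous
      fun_prop
    exact hc.integrable_of_hasCompactSupport hθc.norm.mul_left
  have hW1 : ∀ᵐ ζ : Space, ‖(1 : Space → ℂ) ζ‖ ≤ 1 := Eventually.of_forall fun ζ => by simp
  have hcov : ∀ A, ∀ᵐ ζ, ‖cover A ζ‖ ≤ 1 := fun A => ae_cover.mono fun ζ h => h.1 A
  have hleft : ∀ A : Finset Index, (∫ s in (0 : ℝ)..t, ∫ ζ : Space,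
      propagator (t - s) ζ * (Complex.I * (ζ 0 : ℂ)) * hatSq A (elem q hp hp' (U s)) ζ * θ ζ) =
      ∫ s in (0 : ℝ)..t, ∫ ζ : Space, testIntegrand U θ (cover A) t s ζ := by
    intro A
    refine intervalIntegral.integral_congr fun s hs => ?_
    refine integral_congr_ae (Eventually.of_forall fun ζ => ?_)
    simp only [hatSq_elem hp hp' (hU.memLp hT (hsub hs)), testIntegrand]
  have hright : (∫ ζ : Space, propagator t ζ * hat (elem q hp hp' φ) ζ * θ ζ) -
      ∫ ζ : Space, hat (elem q hp hp' (U t)) ζ * θ ζ =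
      ∫ s in (0 : ℝ)..t, ∫ ζ : Space, testIntegrand U θ 1 t s ζ := by
    have hbd : ∃ C, ∀ ζ, ‖θ ζ‖ ≤ C := hθ.continuous.bounded_above_of_compact_support hθc
    obtain ⟨C, hC⟩ := hbd
    have e1 : (∫ ζ : Space, propagator t ζ * hat (elem q hp hp' φ) ζ * θ ζ) =
        ∫ ζ, linEvol φ t ζ * θ ζ := by
      refine integral_congr_ae ?_
      filter_upwards [hat_elem_ae (q := q) hp hp' (memLp_of_le_bracket hφ hφd)] with ζ h
      rw [h, linEvol]
    have e2 : (∫ ζ : Space, hat (elem q hp hp' (U t)) ζ * θ ζ) = ∫ ζ, U t ζ * θ ζ := by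
      refine integral_congr_ae ?_
      filter_upwards [hat_elem_ae (q := q) hp hp' (hU.memLp hT ht)] with ζ h
      rw [h]
    have mL : Measurable (linEvol φ t) :=
      (measurable_propagator.comp measurable_prodMk_left).mul hφ
    have i1 : Integrable fun ζ => linEvol φ t ζ * θ ζ := by
      refine Integrable.mul_bdd (c := C) ?_ hθm.aestronglyMeasurable (Eventually.of_forall hC)
      refine integrable_of_le_bracket mL (D := d) fun ζ => ?_
      rw [linEvol, norm_mul, norm_propagator, one_mul]
      exact hφd ζ
    have i2 : Integrable fun ζ => U t ζ * θ ζ := by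
      refine Integrable.mul_bdd (c := C) ?_ hθm.aestronglyMeasurable (Eventually.of_forall hC)
      exact integrable_of_le_bracket (hU.measurable_slice t) (hU.le_bracket hT ht)
    -- The exchange of time and frequency integrals is justified by the bound `B |ζ| |θ(ζ)|`, which
    -- does not depend on time.
    rw [e1, e2, ← integral_sub i1 i2, intervalIntegral_integral_swap]
    · refine integral_congr_ae (Eventually.of_forall fun ζ => ?_)
      simp only [testIntegrand, Pi.one_apply, one_mul]
      rw [← sub_mul, hfix t ht ζ, intervalIntegral.integral_mul_const, sub_add_cancel_left]
      congr 1
      unfold KPII.duh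
      rw [neg_mul, neg_neg, ← intervalIntegral.integral_const_mul]
      congr 1
      funext s
      change _ = propagator (t - s) ζ * (Complex.I * (ζ 0 : ℂ)) * (c₀ * conv (U s) (U s) ζ)
      ring
    · have hfin : IsFiniteMeasure (volume.restrict (uIoc 0 t)) := by
        rw [uIoc]; infer_instance
      have hprod : Integrable (fun x : ℝ × Space => (1 : ℝ) * (B * (‖x.2‖ * ‖θ x.2‖)))
          ((volume.restrict (uIoc 0 t)).prod volume) :=
        Integrable.mul_prod (integrable_const (1 : ℝ)) hBi
      refine hprod.mono' (stronglyMeasurable_testIntegrand hU hθm measurable_one t).aestronglyMeasurable ?_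
      have hm : ∀ᵐ x : ℝ × Space ∂((volume.restrict (uIoc 0 t)).prod volume), x.1 ∈ uIoc 0 t :=
        Measure.quasiMeasurePreserving_fst.ae (ae_restrict_mem measurableSet_uIoc)
      filter_upwards [hm] with x hx
      rw [one_mul]
      exact norm_testIntegrand_le hU hD hW1 t (hsub' hx) x.2
  simp only [hleft]
  rw [hright]
  -- The frequency integrals are bounded uniformly in `s` and `A`, so their limit for fixed `s`
  -- passes through the time integral.
  refine intervalIntegral.tendsto_integral_filter_of_dominated_convergence
    (fun _ => ∫ ζ, B * (‖ζ‖ * ‖θ ζ‖)) ?_ ?_ intervalIntegrable_const ?_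
  · exact Eventually.of_forall fun A =>
      (stronglyMeasurable_testIntegrand hU hθm (measurable_cover A) t).integral_prod_right.aestronglyMeasurable
  · refine Eventually.of_forall fun A => Eventually.of_forall fun s hs => ?_
    exact norm_integral_le_of_norm_le hBi (Eventually.of_forall fun ζ =>
      norm_testIntegrand_le hU hD (hcov A) t (hsub' hs) ζ)
  · exact Eventually.of_forall fun s hs =>
      tendsto_integral_testIntegrand hU hD hθm t (hsub' hs) hBi

end

end

end KPII

/-! ### Twice differentiability of the flow bounds the second Picard iterate. -/

namespace KPII

noncomputable section

/-- A function on the line with second derivative `c` at zero and of size `O(x³)` has `c = 0`. -/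
lemma second_deriv_eq_zero {g g' : ℝ → ℂ} {c : ℂ} (hg : ∀ᶠ x in 𝓝 0, HasDerivAt g (g' x) x)
    (hg' : HasDerivAt g' c 0) {M : ℝ} (hM : ∀ᶠ x in 𝓝 (0 : ℝ), ‖g x‖ ≤ M * |x| ^ 3) : c = 0 := by
  have g0 : g 0 = 0 := by simpa using hM.self_of_nhds
  have hO : g =o[𝓝 0] fun x => x := by
    have h1 : g =O[𝓝 0] fun x => x ^ 3 :=
      Asymptotics.IsBigO.of_bound M (by simpa [norm_pow] using hM)
    refine h1.trans_isLittleO ?_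
    simpa using Asymptotics.isLittleO_pow_pow (𝕜 := ℝ) (m := 1) (n := 3) (by norm_num)
  have d0 : g' 0 = 0 := by
    have h1 := hg.self_of_nhds
    have h2 : HasDerivAt g 0 0 := by
      rw [hasDerivAt_iff_isLittleO]
      simpa [g0] using hO
    exact h1.unique h2
  rw [← norm_eq_zero]
  by_contra hne
  have hc : 0 < ‖c‖ := lt_of_le_of_ne (norm_nonneg _) (Ne.symm hne)
  have hM' : 0 ≤ |M| := abs_nonneg M
  rw [hasDerivAt_iff_isLittleO] at hg'
  have h1 : ∀ᶠ x in 𝓝 (0 : ℝ), ‖g' x - x • c‖ ≤ ‖c‖ / 8 * |x| := by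
    have := hg'.bound (c := ‖c‖ / 8) (by positivity)
    simpa [d0] using this
  obtain ⟨r, hr, hball⟩ := Metric.eventually_nhds_iff_ball.1 (hg.and (h1.and hM))
  -- Chosen so that `M x ≤ ‖c‖ / 8`, which makes the cubic bound on `g x` at most `‖c‖ x² / 8`.
  let x : ℝ := min (r / 2) (‖c‖ / (8 * (|M| + 1)))
  have hx0 : 0 < x := lt_min (by positivity) (by positivity)
  have hxr : x < r := (min_le_left _ _).trans_lt (by linarith)
  have hxc : x * (8 * (|M| + 1)) ≤ ‖c‖ := by
    rw [← le_div_iff₀ (by positivity)]; exact min_le_right _ _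
  have hseg : ∀ y ∈ Icc 0 x, y ∈ Metric.ball (0 : ℝ) r := fun y hy => by
    rw [Metric.mem_ball, dist_zero_right, Real.norm_of_nonneg hy.1]
    exact hy.2.trans_lt hxr
  -- The mean value inequality for `g - y² c / 2` gives an error of at most `‖c‖ x² / 8` as well;
  -- together `‖c‖ x² / 2 ≤ ‖c‖ x² / 4`, which is absurd.
  have hmv := Convex.norm_image_sub_le_of_norm_hasDerivWithin_le (f := fun y => g y - (y ^ 2 / 2) • c)
    (f' := fun y => g' y - y • c) (s := Icc 0 x) (x := 0) (y := x) (C := ‖c‖ / 8 * x)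
    (fun y hy => by
      have h2 : HasDerivAt (fun y : ℝ => (y ^ 2 / 2) • c) (y • c) y := by
        have h3 : HasDerivAt (fun y : ℝ => y ^ 2 / 2) y y := by
          have := (hasDerivAt_pow 2 y).div_const 2
          simpa using this
        exact h3.smul_const c
      exact ((hball y (hseg y hy)).1.sub h2).hasDerivWithinAt)
    (fun y hy => by
      refine (hball y (hseg y hy)).2.1.trans ?_
      rw [abs_of_nonneg hy.1]
      gcongr
      exact hy.2) (convex_Icc 0 x) (left_mem_Icc.2 hx0.le) (right_mem_Icc.2 hx0.le)
  have h3 := (hball x (hseg x (right_mem_Icc.2 hx0.le))).2.2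
  simp only [g0, ne_eq, OfNat.ofNat_ne_zero, not_false_eq_true, zero_pow, zero_div, zero_smul, sub_zero] at hmv
  rw [Real.norm_of_nonneg hx0.le] at hmv
  have h4 : ‖(x ^ 2 / 2) • c‖ ≤ ‖g x - (x ^ 2 / 2) • c‖ + ‖g x‖ := by
    have := norm_sub_le (g x) (g x - (x ^ 2 / 2) • c)
    rw [sub_sub_cancel] at this
    linarith
  rw [norm_smul, Real.norm_of_nonneg (by positivity)] at h4
  rw [abs_of_pos hx0] at h3
  have h5 : M * x ^ 3 ≤ x ^ 2 * (‖c‖ / 8) := by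
    have : M * x ≤ ‖c‖ / 8 := by nlinarith [le_abs_self M]
    nlinarith [sq_nonneg x]
  nlinarith [mul_pos (pow_pos hx0 2) hc]

/-- The second order term of a twice differentiable map along a line is bounded by the second
derivative. -/
lemma exists_norm_second_order_le {V : Type*} [NormedAddCommGroup V] [NormedSpace ℝ V] {f : V → V}
    (hf : TwiceDifferentiableAt f 0) :
    ∃ C : ℝ, 0 ≤ C ∧ ∀ (ℓ : V →L[ℝ] ℂ) (v : V) (a₁ a₂ : ℂ) (M : ℝ),
      (∀ᶠ x in 𝓝 (0 : ℝ), ‖ℓ (f (x • v)) - x • a₁ - x ^ 2 • a₂‖ ≤ M * |x| ^ 3) →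
      ‖a₂‖ ≤ C * ‖ℓ‖ * ‖v‖ ^ 2 := by
  refine ⟨‖fderiv ℝ (fderiv ℝ f) 0‖, norm_nonneg _, fun ℓ v a₁ a₂ M h => ?_⟩
  let D := fderiv ℝ (fderiv ℝ f) 0
  have hlin : ∀ x : ℝ, HasDerivAt (fun x : ℝ => x • v) v x := fun x => by
    simpa using (hasDerivAt_id x).smul_const v
  have hlim : Tendsto (fun x : ℝ => x • v) (𝓝 0) (𝓝 0) := by
    have := (hlin 0).continuousAt.tendsto
    simpa using this
  have h1 : ∀ᶠ x in 𝓝 (0 : ℝ), HasDerivAt (fun x : ℝ => ℓ (f (x • v)) - x • a₁ - x ^ 2 • a₂)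
      (ℓ (fderiv ℝ f (x • v) v) - a₁ - (2 * x) • a₂) x := by
    filter_upwards [hlim.eventually hf.1] with x hx
    have e1 : HasDerivAt (fun x : ℝ => ℓ (f (x • v))) (ℓ (fderiv ℝ f (x • v) v)) x :=
      ℓ.hasFDerivAt.comp_hasDerivAt x (hx.hasFDerivAt.comp_hasDerivAt x (hlin x))
    have e2 : HasDerivAt (fun x : ℝ => x • a₁) a₁ x := by
      simpa using (hasDerivAt_id x).smul_const a₁
    have e3 : HasDerivAt (fun x : ℝ => x ^ 2 • a₂) ((2 * x) • a₂) x := by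
      have := (hasDerivAt_pow 2 x).smul_const a₂
      simpa using this
    exact (e1.sub e2).sub e3
  have h2 : HasDerivAt (fun x : ℝ => ℓ (fderiv ℝ f (x • v) v) - a₁ - (2 * x) • a₂)
      (ℓ (D v v) - (2 : ℝ) • a₂) 0 := by
    have e0 : HasFDerivAt (fderiv ℝ f) D ((0 : ℝ) • v) := by
      rw [zero_smul]; exact hf.2.hasFDerivAt
    have e1 : HasDerivAt (fun x : ℝ => fderiv ℝ f (x • v)) (D v) 0 :=
      e0.comp_hasDerivAt (0 : ℝ) (hlin 0)
    have e2 : HasDerivAt (fun x : ℝ => fderiv ℝ f (x • v) v) (D v v) 0 := by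
      have := e1.clm_apply (hasDerivAt_const (0 : ℝ) v)
      simpa using this
    have e3 : HasDerivAt (fun x : ℝ => ℓ (fderiv ℝ f (x • v) v)) (ℓ (D v v)) 0 :=
      ℓ.hasFDerivAt.comp_hasDerivAt (0 : ℝ) e2
    have e4 : HasDerivAt (fun x : ℝ => (2 * x) • a₂) ((2 : ℝ) • a₂) 0 := by
      have := ((hasDerivAt_id (0 : ℝ)).const_mul 2).smul_const a₂
      simpa using this
    exact (e3.sub_const a₁).sub e4
  -- The cubic remainder has zero second derivative, so `ℓ (D v v) = 2 a₂`; no uniformity of `M` is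
  -- needed.
  have h3 := sub_eq_zero.1 (second_deriv_eq_zero h1 h2 h)
  have h4 : ‖ℓ (D v v)‖ ≤ ‖D‖ * ‖ℓ‖ * ‖v‖ ^ 2 := by
    calc ‖ℓ (D v v)‖ ≤ ‖ℓ‖ * (‖D‖ * ‖v‖ * ‖v‖) :=
          (ℓ.le_opNorm _).trans (mul_le_mul_of_nonneg_left (D.le_opNorm₂ v v) (norm_nonneg _))
      _ = _ := by ring
  rw [h3, norm_smul, Real.norm_of_nonneg (by norm_num)] at h4
  linarith [norm_nonneg a₂]

section

variable {p q : ℝ≥0∞} [Fact (1 ≤ p)] [Fact (1 ≤ q)]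

/-- The pairing of the piece `(j, m)` with an element of `L²`. -/
def pairing (q p : ℝ≥0∞) [Fact (1 ≤ p)] [Fact (1 ≤ q)] (j : ℤ) (m : ℤ × ℤ) (ψ : Lp ℂ 2 (gamMeasure j m)) :
    LqLpL2 q p →L[ℝ] ℂ :=
  ((((innerSL ℂ ψ).comp (lp.evalCLM ℂ (fun m => Lp ℂ 2 (gamMeasure j m)) p m)).comp
    (lp.evalCLM ℂ (fun j : ℤ => lp (fun m : ℤ × ℤ => Lp ℂ 2 (gamMeasure j m)) p) q j)).comp
      (LqLpL2 q p).subtypeL).restrictScalars ℝ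

lemma pairing_apply (j : ℤ) (m : ℤ × ℤ) (ψ : Lp ℂ 2 (gamMeasure j m)) (u : LqLpL2 q p) :
    pairing q p j m ψ u = inner ℂ ψ ((u : Ambient q p) j m) := rfl

lemma norm_pairing_le (j : ℤ) (m : ℤ × ℤ) (ψ : Lp ℂ 2 (gamMeasure j m)) : ‖pairing q p j m ψ‖ ≤ ‖ψ‖ := by
  refine ContinuousLinearMap.opNorm_le_bound _ (norm_nonneg ψ) fun u => ?_
  rw [pairing_apply]
  refine (norm_inner_le_norm ψ _).trans (mul_le_mul_of_nonneg_left ?_ (norm_nonneg ψ))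
  have hp : p ≠ 0 := (zero_lt_one.trans_le Fact.out).ne'
  have hq : q ≠ 0 := (zero_lt_one.trans_le Fact.out).ne'
  exact (lp.norm_apply_le_norm hp _ m).trans (lp.norm_apply_le_norm hq _ j)

lemma exists_norm_elem_le (hp : 2 < p) (hp' : p < ⊤) : ∃ C, 0 ≤ C ∧ ∀ (f : Space → ℂ) (D : ℝ),
    Measurable f → 0 ≤ D → (∀ ζ, ‖f ζ‖ ≤ D * bracket ζ) → ‖elem q hp hp' f‖ ≤ C * D := by
  have hb : MemLp (fun ζ => (bracket ζ : ℂ)) 2 sobMeasure := by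
    refine memLp_of_le_bracket (D := 1) ?_ fun ζ => ?_
    · have := measurable_bracket
      fun_prop
    · rw [Complex.norm_real, Real.norm_of_nonneg (bracket_pos ζ).le, one_mul]
  have hs : 0 ≤ ∑' j, rate j := tsum_nonneg fun j => (rate_pos j).le
  refine ⟨(∑' j, rate j) * ‖hb.toLp _‖, mul_nonneg hs (norm_nonneg _), fun f D hf hD h => ?_⟩
  have hm := memLp_of_le_bracket hf h
  refine (norm_elem_le hp hp' hm).trans ?_
  rw [mul_assoc]
  refine mul_le_mul_of_nonneg_left ?_ hs
  rw [mul_comm]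
  refine Lp.norm_le_mul_norm_of_ae_le_mul ?_
  filter_upwards [hm.coeFn_toLp, hb.coeFn_toLp] with ζ h1 h2
  rw [h1, h2, Complex.norm_real, Real.norm_of_nonneg (bracket_pos ζ).le]
  exact h ζ

/-- Test with `ψ` equal to the piece itself and divide by its norm. -/
lemma norm_piece_le_of_pairing {j : ℤ} {m : ℤ × ℤ} (u : LqLpL2 q p) {C : ℝ} (hC : 0 ≤ C)
    (h : ∀ ψ, ‖pairing q p j m ψ u‖ ≤ C * ‖ψ‖) : ‖(u : Ambient q p) j m‖ ≤ C := by
  have h1 := h ((u : Ambient q p) j m)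
  rw [pairing_apply, inner_self_eq_norm_sq_to_K, norm_pow, RCLike.norm_ofReal, abs_norm, sq] at h1
  rcases eq_or_lt_of_le (norm_nonneg ((u : Ambient q p) j m)) with h0 | h0
  · rw [← h0]; exact hC
  · exact le_of_mul_le_mul_right h1 h0

lemma elem_real_smul (hp : 2 < p) (hp' : p < ⊤) {f : Space → ℂ} (hf : MemLp f 2 sobMeasure) (x : ℝ) :
    elem q hp hp' ((x : ℂ) • f) = x • elem q hp hp' f :=
  elem_smul hp hp' hf (x : ℂ)

lemma elem_sub_smul_sub_smul (hp : 2 < p) (hp' : p < ⊤) {f g h : Space → ℂ} (hf : MemLp f 2 sobMeasure)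
    (hg : MemLp g 2 sobMeasure) (hh : MemLp h 2 sobMeasure) (x y : ℝ) :
    elem q hp hp' (f - (x : ℂ) • g - (y : ℂ) • h) =
      elem q hp hp' f - x • elem q hp hp' g - y • elem q hp hp' h := by
  rw [← elem_real_smul hp hp' hg, ← elem_real_smul hp hp' hh,
    elem_sub hp hp' (hf.sub (hg.const_smul _)) (hh.const_smul _), elem_sub hp hp' hf (hg.const_smul _)]

lemma map_sub_smul_sub_smul {V : Type*} [NormedAddCommGroup V] [NormedSpace ℝ V] (ℓ : V →L[ℝ] ℂ)
    (a b c : V) (x y : ℝ) : ℓ a - x • ℓ b - y • ℓ c = ℓ (a - x • b - y • c) := by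
  rw [map_sub, map_sub, map_smul, map_smul]

/-- If the flow map is twice differentiable at zero then the second Picard iterate is bounded. -/
lemma exists_bound_of_twiceDifferentiableAt (hp : 2 < p) (hp' : p < ⊤) {T ε : ℝ} (hT : 0 < T) (hε : 0 < ε)
    {K : Set (ℝ → LqLpL2 q p)}
    (hK : ∀ u : ℝ → LqLpL2 q p, IsSolution T (u 0) u → IsRegular T u → u ∈ K)
    (hwp : ∀ u₀ : LqLpL2 q p, ‖u₀‖ < ε → ∃ u ∈ K, IsSolution T u₀ u ∧
        ∀ v ∈ K, IsSolution T u₀ v → EqOn v u (Icc (-T) T))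
    {F : ℝ → LqLpL2 q p → LqLpL2 q p}
    (hF : ∀ u₀ : LqLpL2 q p, ‖u₀‖ < ε → (fun t => F t u₀) ∈ K ∧ IsSolution T u₀ (fun t => F t u₀))
    {t : ℝ} (ht : t ∈ Icc (-T) T) (hd : TwiceDifferentiableAt (F t) 0) :
    ∃ C, 0 ≤ C ∧ ∀ (φ : Space → ℂ) (d : ℝ), Measurable φ → 0 ≤ d → (∀ ζ, ‖φ ζ‖ ≤ d * weight T 0 ζ) →
      ∀ (j : ℤ) (m : ℤ × ℤ), ‖(elem q hp hp' (duh (linEvol φ) (linEvol φ) t) : Ambient q p) j m‖ ≤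
        C * ‖elem q hp hp' φ‖ ^ 2 := by
  have h0 : (0 : ℝ) ∈ Icc (-T) T := ⟨by linarith, hT.le⟩
  obtain ⟨Ce, hCe, hCe'⟩ := exists_norm_elem_le (q := q) hp hp'
  obtain ⟨C, hC, hC'⟩ := exists_norm_second_order_le hd
  refine ⟨C, hC, fun φ d hφ hd0 hφd j m => ?_⟩
  refine norm_piece_le_of_pairing _ (by positivity) fun ψ => ?_
  have hφm : MemLp φ 2 sobMeasure := memLp_of_le_bracket hφ fun ζ =>
    (hφd ζ).trans (mul_le_mul_of_nonneg_left (weight_le_bracket h0 ζ) hd0)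
  have hL := bdd_linEvol (T := T) hφ hd0 hφd
  have hm1 := hL.memLp hT ht
  have hm2 := (hL.duh hT hL).memLp hT ht
  -- The expansion of the flow along `x φ`. Its error constant depends on `d`, hence on `φ`, but the
  -- resulting bound on the quadratic term involves only `‖φ‖` in the space.
  have key : ∀ᶠ x in 𝓝 (0 : ℝ), ‖pairing q p j m ψ (F t (x • elem q hp hp' φ)) -
      x • pairing q p j m ψ (elem q hp hp' (linEvol φ t)) -
      x ^ 2 • pairing q p j m ψ (elem q hp hp' (duh (linEvol φ) (linEvol φ) t))‖ ≤
      ‖ψ‖ * (Ce * (16 * bilConst ^ 2 * d ^ 3)) * |x| ^ 3 := by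
    have e1 : ∀ᶠ x in 𝓝 (0 : ℝ), 8 * bilConst * (|x| * d) < 1 := by
      have : ContinuousAt (fun x : ℝ => 8 * bilConst * (|x| * d)) 0 := by fun_prop
      exact this.eventually_lt_const (by simp)
    have e2 : ∀ᶠ x in 𝓝 (0 : ℝ), ‖x • elem q hp hp' φ‖ < ε := by
      have : ContinuousAt (fun x : ℝ => ‖x • elem q hp hp' φ‖) 0 := by fun_prop
      exact this.eventually_lt_const (by simpa using hε)
    filter_upwards [e1, e2] with x hx1 hx2
    have hxd : 0 ≤ |x| * d := by positivity
    have hb : ∀ ζ, ‖((x : ℂ) • φ) ζ‖ ≤ |x| * d * weight T 0 ζ := fun ζ => by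
      rw [Pi.smul_apply, norm_smul, Complex.norm_real, Real.norm_eq_abs, mul_assoc]
      exact mul_le_mul_of_nonneg_left (hφd ζ) (abs_nonneg x)
    have hφx : Measurable ((x : ℂ) • φ) := hφ.const_smul _
    have hLx := bdd_linEvol (T := T) hφx hxd hb
    obtain ⟨U, hU, hfix⟩ := exists_fixedPoint hT hLx hx1.le
    have hsol := isSolution_elem (q := q) hp hp' hT hU hφx (d := |x| * d) (fun ζ =>
      (hb ζ).trans (mul_le_mul_of_nonneg_left (weight_le_bracket h0 ζ) hxd)) hfix
    have hreg := isRegular_elem (q := q) hp hp' hT hU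
    have hUK := hK _ (by rw [hsol.initial]; exact hsol) hreg
    have hel : elem q hp hp' ((x : ℂ) • φ) = x • elem q hp hp' φ := elem_smul hp hp' hφm (x : ℂ)
    rw [hel] at hsol
    have hFx := hF _ hx2
    obtain ⟨u, -, -, huniq⟩ := hwp _ hx2
    -- The only place where uniqueness enters: the flow and the analytic solution both lie in `K`
    -- and solve the equation with the same data.
    have hFU : F t (x • elem q hp hp' φ) = elem q hp hp' (U t) :=
      (huniq _ hFx.1 hFx.2 ht).trans (huniq _ hUK hsol ht).symm
    have hmU := hU.memLp hT ht
    have hlin : pairing q p j m ψ (F t (x • elem q hp hp' φ)) -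
        x • pairing q p j m ψ (elem q hp hp' (linEvol φ t)) -
        x ^ 2 • pairing q p j m ψ (elem q hp hp' (duh (linEvol φ) (linEvol φ) t)) =
        pairing q p j m ψ (elem q hp hp' (U t - (x : ℂ) • linEvol φ t -
          ((x ^ 2 : ℝ) : ℂ) • duh (linEvol φ) (linEvol φ) t)) := by
      rw [hFU, elem_sub_smul_sub_smul hp hp' hmU hm1 hm2 x (x ^ 2)]
      exact map_sub_smul_sub_smul _ _ _ _ x (x ^ 2)
    rw [hlin]
    refine (ContinuousLinearMap.le_opNorm _ _).trans ?_
    have hbound : ‖elem q hp hp' (U t - (x : ℂ) • linEvol φ t -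
        ((x ^ 2 : ℝ) : ℂ) • duh (linEvol φ) (linEvol φ) t)‖ ≤ Ce * (16 * bilConst ^ 2 * (|x| * d) ^ 3) := by
      refine hCe' _ _ ?_ (mul_nonneg (by positivity) (by positivity)) fun ζ => ?_
      · exact ((hU.measurable_slice t).sub ((hL.measurable_slice t).const_smul (x : ℂ))).sub
          (((hL.duh hT hL).measurable_slice t).const_smul ((x ^ 2 : ℝ) : ℂ))
      · have h1 := norm_sub_second_order_le hT hLx hU hfix ht ζ
        rw [duh_linEvol_smul] at h1
        have h2 : linEvol ((x : ℂ) • φ) t ζ = (x : ℂ) * linEvol φ t ζ := by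
          simp only [linEvol, Pi.smul_apply, smul_eq_mul]; ring
        rw [h2] at h1
        have h3 : (U t - (x : ℂ) • linEvol φ t - ((x ^ 2 : ℝ) : ℂ) • duh (linEvol φ) (linEvol φ) t) ζ =
            U t ζ - (x : ℂ) * linEvol φ t ζ - (x : ℂ) ^ 2 * duh (linEvol φ) (linEvol φ) t ζ := by
          simp
        rw [h3]
        refine h1.trans ?_
        exact mul_le_mul_of_nonneg_left (weight_le_bracket ht ζ) (mul_nonneg (by positivity) (by positivity))
    calc _ ≤ ‖ψ‖ * (Ce * (16 * bilConst ^ 2 * (|x| * d) ^ 3)) :=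
          mul_le_mul (norm_pairing_le j m ψ) hbound (norm_nonneg _) (norm_nonneg _)
      _ = _ := by ring
  have := hC' (pairing q p j m ψ) (elem q hp hp' φ) _ _ _ key
  refine this.trans ?_
  calc _ ≤ C * ‖ψ‖ * ‖elem q hp hp' φ‖ ^ 2 := by
        gcongr
        exact norm_pairing_le j m ψ
    _ = _ := by ring

end

end

end KPII

/-! ### Volumes of boxes and pieces, the resonance function, and coherent interaction. -/

namespace KPII

noncomputable section

/-- Boxes in frequency space. -/
def box (a b : Fin 3 → ℝ) : Set Space := {ζ | ∀ i, ζ i ∈ Icc (a i) (b i)}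

lemma measurableSet_box (a b : Fin 3 → ℝ) : MeasurableSet (box a b) := by
  unfold box
  simp only [ofPred_forall]
  exact MeasurableSet.iInter fun i => measurable_coord i measurableSet_Icc

lemma volume_box (a b : Fin 3 → ℝ) : volume (box a b) = ∏ i, ENNReal.ofReal (b i - a i) := by
  rw [← Real.volume_Icc_pi, ← (EuclideanSpace.volume_preserving_symm_measurableEquiv_toLp (Fin 3)).measure_preimage
    measurableSet_Icc.nullMeasurableSet]
  congr 1
  ext ζ
  simp [box, Pi.le_def, forall_and]

/-- The boxes symmetric in the last two variables. -/
def sbox (a b r : ℝ) : Set Space := box ![a, -r, -r] ![b, r, r]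

lemma mem_sbox {a b r : ℝ} {ζ : Space} :
    ζ ∈ sbox a b r ↔ (a ≤ ζ 0 ∧ ζ 0 ≤ b) ∧ |ζ 1| ≤ r ∧ |ζ 2| ≤ r := by
  simp [sbox, box, Fin.forall_fin_succ, abs_le]

lemma measurableSet_sbox (a b r : ℝ) : MeasurableSet (sbox a b r) := measurableSet_box _ _

lemma volume_sbox {a b r : ℝ} (hab : a ≤ b) (hr : 0 ≤ r) :
    volume (sbox a b r) = ENNReal.ofReal ((b - a) * (4 * r ^ 2)) := by
  rw [sbox, volume_box, Fin.prod_univ_three]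
  simp only [Matrix.cons_val_zero, Matrix.cons_val_one, Matrix.cons_val]
  rw [← ENNReal.ofReal_mul (by linarith), ← ENNReal.ofReal_mul (by nlinarith)]
  congr 1
  ring

/-- The shear `(ξ, η) ↦ (ξ, η - k ξ)`. -/
lemma volume_shear (k₁ k₂ : ℝ) {B : Set (Fin 3 → ℝ)} (hB : MeasurableSet B) :
    volume {ζ : Space | ![ζ 0, ζ 1 - k₁ * ζ 0, ζ 2 - k₂ * ζ 0] ∈ B} = volume B := by
  let M : Matrix (Fin 3) (Fin 3) ℝ := !![1, 0, 0; -k₁, 1, 0; -k₂, 0, 1]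
  have hdet : M.det = 1 := by simp [M, Matrix.det_fin_three]
  have hmap := Real.map_matrix_volume_pi_eq_smul_volume_pi (M := M) (by rw [hdet]; exact one_ne_zero)
  have hc : Continuous (Matrix.toLin' M) := LinearMap.continuous_of_finiteDimensional _
  have h1 : volume (Matrix.toLin' M ⁻¹' B) = volume B := by
    rw [← Measure.map_apply hc.measurable hB, hmap, hdet]
    simp
  rw [← h1, ← (EuclideanSpace.volume_preserving_symm_measurableEquiv_toLp (Fin 3)).measure_preimage
    (hc.measurable hB).nullMeasurableSet]
  congr 1
  ext ζ
  have : ![ζ 0, ζ 1 - k₁ * ζ 0, ζ 2 - k₂ * ζ 0] = Matrix.toLin' M ζ.ofLp := by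
    funext i
    fin_cases i <;> simp [M, Matrix.mulVec, dotProduct, Fin.sum_univ_three] <;> ring
  simp [this]

/-- The shear by `λ k` preserves volume and maps the half `ξ > 0` of the piece into `[μ, 2μ] × [-μ²,
μ²]²`. -/
lemma volume_Gam_pos_le (j : ℤ) (m : ℤ × ℤ) :
    volume (Gam j m ∩ {ζ | 0 < ζ 0}) ≤ ENNReal.ofReal (4 * ((2 : ℝ) ^ j) ^ 5) := by
  set μ : ℝ := (2 : ℝ) ^ j with hμ
  have hμ0 : 0 < μ := by positivity
  have hB : volume (Icc ![μ, -μ ^ 2, -μ ^ 2] ![2 * μ, μ ^ 2, μ ^ 2]) = ENNReal.ofReal (4 * μ ^ 5) := by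
    rw [Real.volume_Icc_pi, Fin.prod_univ_three]
    simp only [Matrix.cons_val_zero, Matrix.cons_val_one, Matrix.cons_val]
    rw [← ENNReal.ofReal_mul (by linarith), ← ENNReal.ofReal_mul (by nlinarith [sq_nonneg μ])]
    congr 1
    ring
  rw [← hB, ← volume_shear (μ * m.1) (μ * m.2) measurableSet_Icc]
  refine measure_mono ?_
  rintro ζ ⟨⟨h1, h2, h3, h4⟩, h0⟩
  have h0' : 0 < ζ 0 := h0
  rw [abs_of_pos h0', ← hμ] at h1 h2
  rw [← hμ] at h3 h4
  have key : ∀ x k : ℝ, |x / ζ 0 - k| ≤ μ / 2 → |x - k * ζ 0| ≤ μ ^ 2 := by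
    intro x k h
    have e : x - k * ζ 0 = (x / ζ 0 - k) * ζ 0 := by field_simp
    rw [e, abs_mul, abs_of_pos h0']
    nlinarith [abs_nonneg (x / ζ 0 - k)]
  have k1 := abs_le.1 (key _ _ h3)
  have k2 := abs_le.1 (key _ _ h4)
  simp only [mem_ofPred_eq, mem_Icc, Pi.le_def, Fin.forall_fin_succ, Matrix.cons_val_zero, Matrix.cons_val_succ,
    IsEmpty.forall_iff, and_true]
  exact ⟨⟨h1, k1.1, k2.1⟩, h2.le, k1.2, k2.2⟩

/-- The resonance function. -/
lemma omega_add_sub {x y : Space} (hx : 0 < x 0) (hy : 0 < y 0) :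
    |omega (x + y) - omega x - omega y| ≤ 3 * x 0 * y 0 * (x 0 + y 0) +
      (x 1 ^ 2 + x 2 ^ 2) / x 0 + (y 1 ^ 2 + y 2 ^ 2) / y 0 := by
  have hxy : 0 < x 0 + y 0 := add_pos hx hy
  -- The Cauchy–Schwarz defect is a square over a positive number. All terms of the KP-II resonance
  -- function therefore have one sign, and the bound follows by dropping the subtracted squares.
  have key : ∀ a b : ℝ, 0 ≤ a ^ 2 / x 0 + b ^ 2 / y 0 - (a + b) ^ 2 / (x 0 + y 0) := by
    intro a b
    have e : a ^ 2 / x 0 + b ^ 2 / y 0 - (a + b) ^ 2 / (x 0 + y 0) =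
        (a * y 0 - b * x 0) ^ 2 / (x 0 * y 0 * (x 0 + y 0)) := by
      field_simp
      ring
    rw [e]
    positivity
  have k1 := key (x 1) (y 1)
  have k2 := key (x 2) (y 2)
  have e : omega (x + y) - omega x - omega y = 3 * x 0 * y 0 * (x 0 + y 0) +
      (x 1 ^ 2 / x 0 + y 1 ^ 2 / y 0 - (x 1 + y 1) ^ 2 / (x 0 + y 0)) +
      (x 2 ^ 2 / x 0 + y 2 ^ 2 / y 0 - (x 2 + y 2) ^ 2 / (x 0 + y 0)) := by
    simp only [omega, PiLp.add_apply, add_div]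
    ring
  have p0 : 0 ≤ 3 * x 0 * y 0 * (x 0 + y 0) := by positivity
  have p1 : 0 ≤ (x 1 + y 1) ^ 2 / (x 0 + y 0) := by positivity
  have p2 : 0 ≤ (x 2 + y 2) ^ 2 / (x 0 + y 0) := by positivity
  rw [e, abs_of_nonneg (by linarith), add_div, add_div]
  linarith

lemma propagator_resonance (s : ℝ) (ζ ζ₁ : Space) :
    propagator (0 - s) ζ * (propagator s ζ₁ * propagator s (ζ - ζ₁)) =
      Complex.exp (Complex.I * ((-(s * (omega ζ - omega ζ₁ - omega (ζ - ζ₁))) : ℝ) : ℂ)) := by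
  unfold propagator
  rw [← Complex.exp_add, ← Complex.exp_add]
  congr 1
  push_cast
  ring

/-- Nonnegative data interact constructively while the resonance function is small. -/
lemma le_norm_duh {T d : ℝ} (hT : 0 < T) {φ : Space → ℝ} (hφ : ∀ ζ, 0 ≤ φ ζ)
    (hL : Bdd T (linEvol fun ζ => (φ ζ : ℂ)) d) (ζ : Space)
    (hΩ : ∀ ζ₁, φ ζ₁ ≠ 0 → φ (ζ - ζ₁) ≠ 0 → T * |omega ζ - omega ζ₁ - omega (ζ - ζ₁)| ≤ 1 / 2)
    (hi : Integrable fun ζ₁ => φ ζ₁ * φ (ζ - ζ₁)) {t : ℝ} (ht : t ∈ Icc (-T) T) :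
    |ζ 0| * c₀ * (|t| / 2 * ∫ ζ₁, φ ζ₁ * φ (ζ - ζ₁)) ≤
      ‖duh (linEvol fun ζ => (φ ζ : ℂ)) (linEvol fun ζ => (φ ζ : ℂ)) t ζ‖ := by
  set u := linEvol fun ζ => (φ ζ : ℂ) with hu
  set m : ℝ := ∫ ζ₁, φ ζ₁ * φ (ζ - ζ₁) with hm
  have hd := hL.nonneg hT
  have hm0 : 0 ≤ m := integral_nonneg fun ζ₁ => mul_nonneg (hφ _) (hφ _)
  -- A phase of size at most `1/2` moves each unimodular factor by at most `1/2`, so at least half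
  -- of the nonnegative convolution integral survives.
  have hY : ∀ s ∈ uIoc 0 t, ‖propagator (0 - s) ζ * conv (u s) (u s) ζ - (m : ℂ)‖ ≤ m / 2 := by
    intro s hs
    have hs' := uIoc_subset hT ht hs
    have e : propagator (0 - s) ζ * conv (u s) (u s) ζ - (m : ℂ) =
        ∫ ζ₁, (propagator (0 - s) ζ * (u s ζ₁ * u s (ζ - ζ₁)) - ((φ ζ₁ * φ (ζ - ζ₁) : ℝ) : ℂ)) := by
      have i1 : Integrable fun ζ₁ => propagator (0 - s) ζ * (u s ζ₁ * u s (ζ - ζ₁)) :=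
        (integrable_conv hL hL hd hd hs' ζ).const_mul _
      have i2 : Integrable fun ζ₁ => ((φ ζ₁ * φ (ζ - ζ₁) : ℝ) : ℂ) := hi.ofReal
      rw [integral_sub i1 i2, integral_const_mul, integral_complex_ofReal]
      rfl
    rw [e]
    refine (norm_integral_le_of_norm_le (hi.div_const 2) (Eventually.of_forall fun ζ₁ => ?_)).trans_eq ?_
    · have e2 : propagator (0 - s) ζ * (u s ζ₁ * u s (ζ - ζ₁)) - ((φ ζ₁ * φ (ζ - ζ₁) : ℝ) : ℂ) =
          ((φ ζ₁ * φ (ζ - ζ₁) : ℝ) : ℂ) *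
            (Complex.exp (Complex.I * ((-(s * (omega ζ - omega ζ₁ - omega (ζ - ζ₁))) : ℝ) : ℂ)) - 1) := by
        rw [← propagator_resonance, hu]
        simp only [linEvol]
        push_cast
        ring
      rw [e2, norm_mul, Complex.norm_real, Real.norm_of_nonneg (mul_nonneg (hφ _) (hφ _))]
      by_cases h0 : φ ζ₁ * φ (ζ - ζ₁) = 0
      · simp [h0]
      · have h := hΩ ζ₁ (left_ne_zero_of_mul h0) (right_ne_zero_of_mul h0)
        have h1 := Real.norm_exp_I_mul_ofReal_sub_one_le (x := -(s * (omega ζ - omega ζ₁ - omega (ζ - ζ₁))))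
        have h2 : ‖-(s * (omega ζ - omega ζ₁ - omega (ζ - ζ₁)))‖ ≤ 1 / 2 := by
          rw [norm_neg, Real.norm_eq_abs, abs_mul]
          exact (mul_le_mul_of_nonneg_right (abs_le_of_mem hs') (abs_nonneg _)).trans h
        calc _ ≤ φ ζ₁ * φ (ζ - ζ₁) * (1 / 2) :=
              mul_le_mul_of_nonneg_left (h1.trans h2) (mul_nonneg (hφ _) (hφ _))
          _ = _ := by ring
    · rw [integral_div]
  have hint := intervalIntegrable_integrand hT hL hL ht 0 ζ
  have h1 : ‖(∫ s in (0 : ℝ)..t, propagator (0 - s) ζ * conv (u s) (u s) ζ) - (t : ℂ) * m‖ ≤ m / 2 * |t| := by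
    have e : (∫ s in (0 : ℝ)..t, propagator (0 - s) ζ * conv (u s) (u s) ζ) - (t : ℂ) * m =
        ∫ s in (0 : ℝ)..t, (propagator (0 - s) ζ * conv (u s) (u s) ζ - (m : ℂ)) := by
      rw [intervalIntegral.integral_sub hint intervalIntegrable_const, intervalIntegral.integral_const]
      simp
    rw [e]
    have := intervalIntegral.norm_integral_le_of_norm_le_const hY
    simpa using this
  have h2 : |t| / 2 * m ≤ ‖∫ s in (0 : ℝ)..t, propagator (0 - s) ζ * conv (u s) (u s) ζ‖ := by
    have h3 : ‖(t : ℂ) * m‖ = |t| * m := by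
      rw [norm_mul, Complex.norm_real, Complex.norm_real, Real.norm_eq_abs, Real.norm_of_nonneg hm0]
    have h4 := norm_sub_norm_le ((t : ℂ) * m) (∫ s in (0 : ℝ)..t, propagator (0 - s) ζ * conv (u s) (u s) ζ)
    rw [norm_sub_rev] at h4
    linarith
  have h3 : ‖∫ s in (0 : ℝ)..t, propagator (t - s) ζ * conv (u s) (u s) ζ‖ =
      ‖∫ s in (0 : ℝ)..t, propagator (0 - s) ζ * conv (u s) (u s) ζ‖ := by
    have e : (∫ s in (0 : ℝ)..t, propagator (t - s) ζ * conv (u s) (u s) ζ) =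
        propagator t ζ * ∫ s in (0 : ℝ)..t, propagator (0 - s) ζ * conv (u s) (u s) ζ := by
      rw [← intervalIntegral.integral_const_mul]
      congr 1
      funext s
      rw [← mul_assoc, ← propagator_add]
      congr 2
      ring
    rw [e, norm_mul, norm_propagator, one_mul]
  unfold duh
  rw [norm_mul, h3, norm_neg, norm_mul, norm_mul, Complex.norm_I, one_mul, Complex.norm_real, Complex.norm_real,
    Real.norm_of_nonneg c₀_pos.le, Real.norm_eq_abs]
  exact mul_le_mul_of_nonneg_left h2 (mul_nonneg (abs_nonneg _) c₀_pos.le)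

end

end KPII

/-! ### Norms of the low and high data, and the lower bound for their interaction. -/

namespace KPII

noncomputable section

/-- Bounded data with bounded support are admissible; the size of `d` is irrelevant, as it does not
enter the bound on the second iterate. -/
lemma norm_le_weight_of_support {φ : Space → ℂ} {M R : ℝ} (T : ℝ) (hT : 0 < T) (hM : 0 ≤ M)
    (hb : ∀ ζ, ‖φ ζ‖ ≤ M) (hs : ∀ ζ, φ ζ ≠ 0 → ‖ζ‖ ≤ R) :
    ∃ d, 0 ≤ d ∧ ∀ ζ, ‖φ ζ‖ ≤ d * weight T 0 ζ := by
  have hw : 0 < Real.exp (-(T + 1) * R) * ((1 + R ^ 2) ^ 2)⁻¹ := by positivity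
  refine ⟨M / (Real.exp (-(T + 1) * R) * ((1 + R ^ 2) ^ 2)⁻¹), by positivity, fun ζ => ?_⟩
  by_cases h0 : φ ζ = 0
  · rw [h0, norm_zero]
    exact mul_nonneg (by positivity) (weight_pos _ _ _).le
  · refine (hb ζ).trans ?_
    rw [div_mul_eq_mul_div, le_div_iff₀ hw]
    refine mul_le_mul_of_nonneg_left ?_ hM
    have hR := hs ζ h0
    unfold weight bracket
    rw [abs_zero, sub_zero]
    have h1 : Real.exp (-(T + 1) * R) ≤ Real.exp (-(T + 1) * ‖ζ‖) := by
      rw [Real.exp_le_exp]; nlinarith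
    gcongr

lemma norm_le_of_mem_sbox {a b r : ℝ} (ha : 0 ≤ a) {ζ : Space} (h : ζ ∈ sbox a b r) :
    ‖ζ‖ ≤ b + r + r := by
  rw [mem_sbox] at h
  have h0 : 0 ≤ ζ 0 := ha.trans h.1.1
  have h1 : ‖ζ‖ ^ 2 ≤ (b + r + r) ^ 2 := by
    rw [EuclideanSpace.norm_sq_eq, Fin.sum_univ_three]
    simp only [Real.norm_eq_abs]
    rw [abs_of_nonneg h0]
    have a1 := abs_nonneg (ζ 1)
    have a2 := abs_nonneg (ζ 2)
    have e1 : ζ 0 ^ 2 ≤ b ^ 2 := pow_le_pow_left₀ h0 h.1.2 2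
    have e2 : |ζ 1| ^ 2 ≤ r ^ 2 := pow_le_pow_left₀ a1 h.2.1 2
    have e3 : |ζ 2| ^ 2 ≤ r ^ 2 := pow_le_pow_left₀ a2 h.2.2 2
    have hb : 0 ≤ b := h0.trans h.1.2
    have hr : 0 ≤ r := a1.trans h.2.1
    nlinarith [mul_nonneg hb hr, mul_nonneg hr hr]
  have hb : 0 ≤ b := h0.trans h.1.2
  have hr : 0 ≤ r := (abs_nonneg _).trans h.2.1
  exact le_of_sq_le_sq h1 (by linarith)

section

variable {p q : ℝ≥0∞} [Fact (1 ≤ p)] [Fact (1 ≤ q)]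

/-- The norm of a function supported in one dyadic shell. -/
lemma norm_elem_le_shell (hp : 2 < p) (hp' : p < ⊤) {f : Space → ℂ} (hf : MemLp f 2 sobMeasure) (J : ℤ)
    (hs : ∀ ζ, f ζ ≠ 0 → ζ ∈ shell J) : ‖elem q hp hp' f‖ ≤ ‖shellElem hp hf J‖ := by
  refine (norm_elem_le_tsum hp hp' hf).trans_eq ?_
  refine tsum_eq_single J fun j hj => ?_
  refine le_antisymm (norm_shellElem_le_of_energy hp hp' hf j le_rfl ?_) (norm_nonneg _)
  have : ∫⁻ ζ in shell j, ‖f ζ‖ₑ ^ 2 = 0 := by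
    rw [← nonpos_iff_eq_zero]
    calc ∫⁻ ζ in shell j, ‖f ζ‖ₑ ^ 2 ≤ ∫⁻ _ in shell j, 0 := by
          refine setLIntegral_mono' (measurableSet_shell j) fun ζ hζ => ?_
          have h0 : f ζ = 0 := by
            by_contra h
            exact hj (level_unique hζ (hs ζ h))
          simp [h0]
      _ = 0 := by simp
  simp [this]

lemma measurable_ind {s : Set Space} (hs : MeasurableSet s) :
    Measurable (s.indicator (fun _ => (1 : ℂ))) := measurable_const.indicator hs

lemma lintegral_ind_sq (A : Set Space) {s : Set Space} (hs : MeasurableSet s) :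
    ∫⁻ ζ in A, ‖s.indicator (fun _ => (1 : ℂ)) ζ‖ₑ ^ 2 = volume (s ∩ A) := by
  have : ∀ ζ, ‖s.indicator (fun _ => (1 : ℂ)) ζ‖ₑ ^ 2 = s.indicator (fun _ => (1 : ℝ≥0∞)) ζ := by
    intro ζ
    by_cases h : ζ ∈ s <;> simp [h]
  simp only [this]
  rw [lintegral_indicator hs, setLIntegral_one, Measure.restrict_apply hs]

lemma memLp_ind_sbox {a b r : ℝ} (ha : 0 ≤ a) :
    MemLp ((sbox a b r).indicator (fun _ => (1 : ℂ))) 2 sobMeasure := by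
  obtain ⟨d, hd, hd'⟩ := norm_le_weight_of_support (φ := (sbox a b r).indicator (fun _ => (1 : ℂ)))
    (M := 1) (R := b + r + r) 1 one_pos zero_le_one (fun ζ => by
      by_cases h : ζ ∈ sbox a b r <;> simp [h]) (fun ζ h => by
      refine norm_le_of_mem_sbox ha ?_
      by_contra hn
      exact h (indicator_of_notMem hn _))
  exact memLp_of_le_bracket (measurable_ind (measurableSet_sbox a b r)) fun ζ =>
    (hd' ζ).trans (mul_le_mul_of_nonneg_left
      (weight_le_bracket (T := 1) ⟨by norm_num, by norm_num⟩ ζ) hd)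

/-- A function spread over many pieces has a small norm if `p > 2`. -/
lemma norm_elem_low_le (hp : 2 < p) (hp' : p < ⊤) (l : ℤ) {μ ρ : ℝ} (hμ : μ = (2 : ℝ) ^ l) (hρ : 0 ≤ ρ) :
    ‖elem q hp hp' ((sbox μ (3 / 2 * μ) ρ).indicator fun _ => (1 : ℂ))‖ ≤
      ((2 * μ ^ 3) ^ (p.toReal - 2) * (2 * μ ^ 2 * ρ ^ 2)) ^ (p.toReal)⁻¹ := by
  have hμ0 : 0 < μ := by rw [hμ]; positivity
  have hf := memLp_ind_sbox (a := μ) (b := 3 / 2 * μ) (r := ρ) hμ0.le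
  have hm := measurableSet_sbox μ (3 / 2 * μ) ρ
  refine (norm_elem_le_shell hp hp' hf l fun ζ h => ?_).trans
    (norm_shellElem_le hp hp' hf l (by positivity) (by positivity) (fun m => ?_) ?_)
  · have hζ : ζ ∈ sbox μ (3 / 2 * μ) ρ := by
      by_contra hn
      exact h (indicator_of_notMem hn _)
    rw [mem_sbox] at hζ
    have h0 : 0 ≤ ζ 0 := hμ0.le.trans hζ.1.1
    change _ ≤ _ ∧ _
    rw [abs_of_nonneg h0, ← hμ]
    exact ⟨hζ.1.1, by linarith [hζ.1.2]⟩
  -- Each piece carries energy at most `μ · 4μ⁵ = (2μ³)²`.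
  · rw [lintegral_ind_sq _ hm]
    have h1 : volume (sbox μ (3 / 2 * μ) ρ ∩ Gam l m) ≤ ENNReal.ofReal (4 * μ ^ 5) := by
      rw [hμ]
      refine (measure_mono ?_).trans (volume_Gam_pos_le l m)
      rintro ζ ⟨h2, h3⟩
      rw [mem_sbox] at h2
      exact ⟨h3, (by positivity : (0 : ℝ) < 2 ^ l).trans_le h2.1.1⟩
    rw [← hμ]
    calc ENNReal.ofReal μ * volume (sbox μ (3 / 2 * μ) ρ ∩ Gam l m) ≤
          ENNReal.ofReal μ * ENNReal.ofReal (4 * μ ^ 5) := by gcongr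
      _ = _ := by
          rw [← ENNReal.ofReal_mul hμ0.le]
          congr 1
          ring
  -- The whole box carries energy at most `μ · (μ/2) · 4ρ² = 2μ²ρ²`.
  · rw [lintegral_ind_sq _ hm, ← hμ]
    calc ENNReal.ofReal μ * volume (sbox μ (3 / 2 * μ) ρ ∩ shell l) ≤
          ENNReal.ofReal μ * volume (sbox μ (3 / 2 * μ) ρ) := by
          gcongr
          exact inter_subset_left
      _ = _ := by
          rw [volume_sbox (by linarith) hρ, ← ENNReal.ofReal_mul hμ0.le]
          congr 1
          ring

/-- The condition `μ < L` keeps the box in one shell; the `l²` bound suffices, since the high part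
needs no gain from `p`. -/
lemma norm_elem_high_le (hp : 2 < p) (hp' : p < ⊤) (J : ℤ) {L μ r B : ℝ} (hL : L = (2 : ℝ) ^ J)
    (hμ : 0 < μ) (hμL : μ < L) (hr : 0 ≤ r) (hB : 0 ≤ B) (hB2 : L * (μ * (4 * r ^ 2)) = B ^ 2) :
    ‖elem q hp hp' ((sbox L (L + μ) r).indicator fun _ => (1 : ℂ))‖ ≤ B := by
  have hL0 : 0 < L := by rw [hL]; positivity
  have hf := memLp_ind_sbox (a := L) (b := L + μ) (r := r) hL0.le
  have hm := measurableSet_sbox L (L + μ) r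
  refine (norm_elem_le_shell hp hp' hf J fun ζ h => ?_).trans
    (norm_shellElem_le_of_energy hp hp' hf J hB ?_)
  · have hζ : ζ ∈ sbox L (L + μ) r := by
      by_contra hn
      exact h (indicator_of_notMem hn _)
    rw [mem_sbox] at hζ
    have h0 : 0 ≤ ζ 0 := hL0.le.trans hζ.1.1
    change _ ≤ _ ∧ _
    rw [abs_of_nonneg h0, ← hL]
    exact ⟨hζ.1.1, by linarith [hζ.1.2]⟩
  · rw [lintegral_ind_sq _ hm, ← hL]
    calc ENNReal.ofReal L * volume (sbox L (L + μ) r ∩ shell J) ≤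
          ENNReal.ofReal L * volume (sbox L (L + μ) r) := by
          gcongr
          exact inter_subset_left
      _ = _ := by
          rw [volume_sbox (by linarith) hr, ← ENNReal.ofReal_mul hL0.le, ← hB2]
          congr 1
          ring

end

/-- The resonance function is small for low-high interactions. -/
lemma resonance_le {μ L : ℝ} (hμ : 0 < μ) (hμL : 4 * μ ≤ L) {x y : Space}
    (hx : x ∈ sbox μ (3 / 2 * μ) (μ * L)) (hy : y ∈ sbox L (L + μ) (2 * (μ * L))) :
    |omega (x + y) - omega x - omega y| ≤ 16 * (μ * L ^ 2) := by
  rw [mem_sbox] at hx hy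
  obtain ⟨⟨x0, x0'⟩, x1, x2⟩ := hx
  obtain ⟨⟨y0, y0'⟩, y1, y2⟩ := hy
  have hL : 0 < L := by linarith
  have px : 0 < x 0 := by linarith
  have py : 0 < y 0 := by linarith
  refine (omega_add_sub px py).trans ?_
  have s1 : x 1 ^ 2 ≤ (μ * L) ^ 2 := by rw [← sq_abs]; gcongr
  have s2 : x 2 ^ 2 ≤ (μ * L) ^ 2 := by rw [← sq_abs]; gcongr
  have s3 : y 1 ^ 2 ≤ (2 * (μ * L)) ^ 2 := by rw [← sq_abs]; gcongr
  have s4 : y 2 ^ 2 ≤ (2 * (μ * L)) ^ 2 := by rw [← sq_abs]; gcongr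
  have b1 : (x 1 ^ 2 + x 2 ^ 2) / x 0 ≤ 2 * (μ * L ^ 2) := by
    calc (x 1 ^ 2 + x 2 ^ 2) / x 0 ≤ ((μ * L) ^ 2 + (μ * L) ^ 2) / μ := by gcongr
      _ = _ := by field_simp; ring
  have b2 : (y 1 ^ 2 + y 2 ^ 2) / y 0 ≤ 2 * (μ * L ^ 2) := by
    calc (y 1 ^ 2 + y 2 ^ 2) / y 0 ≤ ((2 * (μ * L)) ^ 2 + (2 * (μ * L)) ^ 2) / L := by gcongr
      _ = 8 * (μ * (μ * L)) := by field_simp; ring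
      _ ≤ _ := by nlinarith [mul_pos hμ hL]
  -- From `4μ ≤ L`: `y₀ ≤ L + μ ≤ 5L/4` and `x₀ + y₀ ≤ 13L/8`. The three bounds add up to `2 + 2 +
  -- 12 = 16`.
  have b3 : 3 * x 0 * y 0 * (x 0 + y 0) ≤ 12 * (μ * L ^ 2) := by
    calc 3 * x 0 * y 0 * (x 0 + y 0) ≤ 3 * (3 / 2 * μ) * (5 / 4 * L) * (13 / 8 * L) := by
          gcongr <;> linarith
      _ ≤ _ := by nlinarith [mul_pos hμ (pow_pos hL 2)]
  linarith

/-- Lower bound for the low-high interaction. -/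
lemma le_norm_duh_low_high {T t μ L a b d : ℝ} (hT : 0 < T) (ht : t ∈ Icc (-T) T) (hμ : 0 < μ)
    (hμL : 4 * μ ≤ L) (hres : T * (16 * (μ * L ^ 2)) ≤ 1 / 2) (ha : 0 ≤ a) (hb : 0 ≤ b)
    {φ : Space → ℝ} (hφ : φ = fun ζ => a * (sbox μ (3 / 2 * μ) (μ * L)).indicator (fun _ => 1) ζ +
      b * (sbox L (L + μ) (2 * (μ * L))).indicator (fun _ => 1) ζ)
    (hL : Bdd T (linEvol fun ζ => (φ ζ : ℂ)) d) {ζ : Space}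
    (hζ : ζ ∈ sbox (L + 3 / 2 * μ) (L + 2 * μ) (μ * L)) :
    L * c₀ * (|t| / 2 * (a * b * (2 * μ * (μ * L) ^ 2))) ≤
      ‖duh (linEvol fun ζ => (φ ζ : ℂ)) (linEvol fun ζ => (φ ζ : ℂ)) t ζ‖ := by
  have hL0 : 0 < L := by linarith
  set G := sbox μ (3 / 2 * μ) (μ * L) with hG
  set E := sbox L (L + μ) (2 * (μ * L)) with hE
  have hGm : MeasurableSet G := measurableSet_sbox _ _ _
  have hEm : MeasurableSet E := measurableSet_sbox _ _ _
  have i01 : ∀ (S : Set Space) x, 0 ≤ S.indicator (fun _ => (1 : ℝ)) x := fun S x =>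
    indicator_nonneg (fun _ _ => zero_le_one) x
  have i1 : ∀ (S : Set Space) x, S.indicator (fun _ => (1 : ℝ)) x ≤ 1 := fun S x =>
    indicator_le_self' (fun _ _ => zero_le_one) x
  have hφ0 : ∀ ζ, 0 ≤ φ ζ := fun ζ => by
    rw [hφ]
    exact add_nonneg (mul_nonneg ha (i01 _ _)) (mul_nonneg hb (i01 _ _))
  have hφm : Measurable φ := by
    rw [hφ]
    exact ((measurable_const.indicator hGm).const_mul _).add ((measurable_const.indicator hEm).const_mul _)
  have hφb : ∀ ζ, φ ζ ≤ a + b := fun ζ => by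
    rw [hφ]
    exact add_le_add (mul_le_of_le_one_right ha (i1 _ _)) (mul_le_of_le_one_right hb (i1 _ _))
  have hsupp : ∀ x, φ x ≠ 0 → x ∈ G ∨ x ∈ E := fun x hx => by
    by_contra hn
    push Not at hn
    apply hx
    rw [hφ]
    simp [hn.1, hn.2]
  rw [mem_sbox] at hζ
  obtain ⟨⟨z0, z0'⟩, z1, z2⟩ := hζ
  have hsubc : ∀ (x : Space) i, (ζ - x) i = ζ i - x i := fun x i => rfl
  -- The high box is long enough in `ξ` and twice as wide in `η` as the low one, so for every output
  -- `ζ` all of `G` contributes to the convolution.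
  have hGE : ∀ x ∈ G, ζ - x ∈ E := by
    intro x hx
    rw [hG, mem_sbox] at hx
    rw [hE, mem_sbox]
    simp only [hsubc]
    refine ⟨⟨by linarith [hx.1.2], by linarith [hx.1.1]⟩, ?_, ?_⟩
    · exact (abs_sub _ _).trans (by linarith [hx.2.1])
    · exact (abs_sub _ _).trans (by linarith [hx.2.2])
  have hvG : volume G = ENNReal.ofReal (2 * μ * (μ * L) ^ 2) := by
    rw [hG, volume_sbox (by linarith) (by positivity)]
    congr 1
    ring
  have hvG' : volume G ≠ ⊤ := by
    rw [hvG]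
    exact ENNReal.ofReal_ne_top
  have hvE : volume E ≠ ⊤ := by
    rw [hE, volume_sbox (by linarith) (by positivity)]
    exact ENNReal.ofReal_ne_top
  have hφi : Integrable φ := by
    rw [hφ]
    exact (((integrableOn_const hvG').integrable_indicator hGm).const_mul a).add
      (((integrableOn_const hvE).integrable_indicator hEm).const_mul b)
  have hi : Integrable fun x => φ x * φ (ζ - x) := by
    refine hφi.mul_bdd (c := a + b) (hφm.comp (measurable_const.sub measurable_id)).aestronglyMeasurable
      (Eventually.of_forall fun x => ?_)
    rw [Real.norm_of_nonneg (hφ0 _)]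
    exact hφb _
  have hΩ : ∀ x, φ x ≠ 0 → φ (ζ - x) ≠ 0 → T * |omega ζ - omega x - omega (ζ - x)| ≤ 1 / 2 := by
    intro x h1 h2
    have key : |omega ζ - omega x - omega (ζ - x)| ≤ 16 * (μ * L ^ 2) := by
      -- If one frequency is in `G`, the other is in `E`. Two frequencies in `E` would give `ζ₀ ≥
      -- 2L`, beyond the output box since `2L > L + 2μ`.
      rcases hsupp x h1 with hx | hx
      · have := resonance_le hμ hμL hx (hGE x hx)
        rwa [add_sub_cancel] at this
      · rcases hsupp _ h2 with hy | hy
        · have := resonance_le hμ hμL hy hx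
          rw [sub_add_cancel] at this
          rwa [sub_right_comm] at this
        · exfalso
          rw [hE, mem_sbox] at hx hy
          have := hy.1.1
          rw [hsubc] at this
          linarith [hx.1.1]
    exact (mul_le_mul_of_nonneg_left key hT.le).trans hres
  have hm : a * b * (2 * μ * (μ * L) ^ 2) ≤ ∫ x, φ x * φ (ζ - x) := by
    have e : a * b * (2 * μ * (μ * L) ^ 2) = ∫ x, G.indicator (fun _ => a * b) x := by
      rw [integral_indicator hGm, setIntegral_const, Measure.real, hvG, ENNReal.toReal_ofReal (by positivity),
        smul_eq_mul, mul_comm]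
    rw [e]
    refine integral_mono_of_nonneg (Eventually.of_forall fun x => indicator_nonneg (fun _ _ => mul_nonneg ha hb) x)
      hi (Eventually.of_forall fun x => ?_)
    by_cases hx : x ∈ G
    · have h1 : a ≤ φ x := by
        rw [hφ]
        simp only [indicator_of_mem hx, mul_one]
        exact le_add_of_nonneg_right (mul_nonneg hb (i01 _ _))
      have h2 : b ≤ φ (ζ - x) := by
        rw [hφ]
        simp only [indicator_of_mem (hGE x hx), mul_one]
        exact le_add_of_nonneg_left (mul_nonneg ha (i01 _ _))
      simp only [indicator_of_mem hx]
      exact mul_le_mul h1 h2 hb (hφ0 _)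
    · simp only [indicator_of_notMem hx]
      exact mul_nonneg (hφ0 _) (hφ0 _)
  refine le_trans ?_ (le_norm_duh hT hφ0 hL ζ hΩ hi ht)
  have hz : L ≤ |ζ 0| := (by linarith : L ≤ ζ 0).trans (le_abs_self _)
  have hc := c₀_pos
  gcongr

end

end KPII

/-! ### The scaling inequality and the contradiction. -/

namespace KPII

noncomputable section

variable {p q : ℝ≥0∞} [Fact (1 ≤ p)] [Fact (1 ≤ q)]

/-- On the box `|η / ξ| ≤ μ ≤ L / 2` and `ξ ≤ L + 2μ < 2L`, so the output sits in the single piece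
`k = 0` and its norm is a plain `L²` norm. -/
lemma sbox_subset_Gam {J : ℤ} {L μ : ℝ} (hL : L = (2 : ℝ) ^ J) (hμ : 0 < μ) (hμL : 4 * μ ≤ L) :
    sbox (L + 3 / 2 * μ) (L + 2 * μ) (μ * L) ⊆ Gam J (0, 0) := by
  intro ζ hζ
  rw [mem_sbox] at hζ
  obtain ⟨⟨z0, z0'⟩, z1, z2⟩ := hζ
  have hL0 : 0 < L := by linarith
  have hz : 0 < ζ 0 := by linarith
  have key : ∀ x : ℝ, |x| ≤ μ * L → |x / ζ 0| ≤ L / 2 := fun x hx => by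
    rw [abs_div, abs_of_pos hz, div_le_iff₀ hz]
    nlinarith
  refine ⟨?_, ?_, ?_, ?_⟩
  · rw [← hL, abs_of_pos hz]; linarith
  · rw [← hL, abs_of_pos hz]; linarith
  · simpa [← hL] using key _ z1
  · simpa [← hL] using key _ z2

/-- Since `8 · 16 = 128 ≤ 12²`. -/
lemma le_of_sq_div_eight_le {y C : ℝ} (hC : 0 ≤ C) (h : y ^ 2 / 8 ≤ (4 * C) ^ 2) : y ≤ 12 * C := by
  refine le_of_sq_le_sq ?_ (by positivity)
  nlinarith [sq_nonneg C]

set_option maxHeartbeats 1000000 in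
/-- The consequence of the boundedness of the second Picard iterate for low-high interactions. -/
lemma low_high_inequality (hp : 2 < p) (hp' : p < ⊤) {T t C : ℝ} (hT : 0 < T) (ht : t ∈ Icc (-T) T)
    (hC : 0 ≤ C)
    (hbound : ∀ (φ : Space → ℂ) (d : ℝ), Measurable φ → 0 ≤ d → (∀ ζ, ‖φ ζ‖ ≤ d * weight T 0 ζ) →
      ∀ (j : ℤ) (m : ℤ × ℤ), ‖(elem q hp hp' (duh (linEvol φ) (linEvol φ) t) : Ambient q p) j m‖ ≤
        C * ‖elem q hp hp' φ‖ ^ 2)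
    {J l : ℤ} {L μ : ℝ} (hL : L = (2 : ℝ) ^ J) (hμ : μ = (2 : ℝ) ^ l) (hμL : 4 * μ ≤ L)
    (hres : T * (16 * (μ * L ^ 2)) ≤ 1 / 2) :
    c₀ * |t| * (L * μ * (μ * L) ^ 2) ≤
      12 * C * ((2 * μ ^ 3) ^ (p.toReal - 2) * (2 * μ ^ 2 * (μ * L) ^ 2)) ^ (p.toReal)⁻¹ := by
  have hμ0 : 0 < μ := by rw [hμ]; positivity
  have hL0 : 0 < L := by linarith
  set A : ℝ := ((2 * μ ^ 3) ^ (p.toReal - 2) * (2 * μ ^ 2 * (μ * L) ^ 2)) ^ (p.toReal)⁻¹ with hA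
  have hA0 : 0 < A := by positivity
  set s : ℝ := L * μ * (μ * L) ^ 2 with hs
  have hs0 : 0 < s := by positivity
  -- `B²` is the weighted energy of the high box, `L · μ · 4(2μL)² = 16 s`.
  set B : ℝ := 4 * Real.sqrt s with hBdef
  have hB0 : 0 < B := by positivity
  have hB2 : B ^ 2 = 16 * s := by
    rw [hBdef, mul_pow, Real.sq_sqrt hs0.le]; norm_num
  set G := sbox μ (3 / 2 * μ) (μ * L) with hG
  set E := sbox L (L + μ) (2 * (μ * L)) with hE
  set O := sbox (L + 3 / 2 * μ) (L + 2 * μ) (μ * L) with hO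
  have hGn : ‖elem q hp hp' (G.indicator fun _ => (1 : ℂ))‖ ≤ A :=
    norm_elem_low_le hp hp' l hμ (by positivity)
  have hEn : ‖elem q hp hp' (E.indicator fun _ => (1 : ℂ))‖ ≤ B :=
    norm_elem_high_le hp hp' J hL hμ0 (by linarith) (by positivity) hB0.le (by rw [hB2, hs]; ring)
  have hGm := memLp_ind_sbox (a := μ) (b := 3 / 2 * μ) (r := μ * L) hμ0.le
  have hEm := memLp_ind_sbox (a := L) (b := L + μ) (r := 2 * (μ * L)) hL0.le
  -- Each part is divided by the bound for its norm, so the data have norm at most 2 and the second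
  -- iterate at most `4C`.
  let φ : Space → ℝ := fun ζ => A⁻¹ * G.indicator (fun _ => 1) ζ + B⁻¹ * E.indicator (fun _ => 1) ζ
  have hφe : (fun ζ => (φ ζ : ℂ)) = ((A⁻¹ : ℝ) : ℂ) • (G.indicator fun _ => (1 : ℂ)) +
      ((B⁻¹ : ℝ) : ℂ) • (E.indicator fun _ => (1 : ℂ)) := by
    funext ζ
    have h1 : ∀ S : Set Space, ((S.indicator (fun _ => (1 : ℝ)) ζ : ℝ) : ℂ) = S.indicator (fun _ => (1 : ℂ)) ζ := by
      intro S
      by_cases h : ζ ∈ S <;> simp [h]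
    simp only [φ, Complex.ofReal_add, Complex.ofReal_mul, h1]
    rfl
  have hn : ‖elem q hp hp' fun ζ => (φ ζ : ℂ)‖ ≤ 2 := by
    rw [hφe, elem_add hp hp' (hGm.const_smul _) (hEm.const_smul _), elem_smul hp hp' hGm, elem_smul hp hp' hEm]
    refine (norm_add_le _ _).trans ?_
    rw [norm_smul, norm_smul, Complex.norm_real, Complex.norm_real, Real.norm_of_nonneg (by positivity),
      Real.norm_of_nonneg (by positivity)]
    have e1 : A⁻¹ * ‖elem q hp hp' (G.indicator fun _ => (1 : ℂ))‖ ≤ 1 := by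
      rw [inv_mul_le_iff₀ hA0, mul_one]; exact hGn
    have e2 : B⁻¹ * ‖elem q hp hp' (E.indicator fun _ => (1 : ℂ))‖ ≤ 1 := by
      rw [inv_mul_le_iff₀ hB0, mul_one]; exact hEn
    linarith
  have hφm : Measurable fun ζ => (φ ζ : ℂ) := by
    rw [hφe]
    exact ((measurable_ind (measurableSet_sbox _ _ _)).const_smul _).add
      ((measurable_ind (measurableSet_sbox _ _ _)).const_smul _)
  have hφb : ∀ ζ, ‖(φ ζ : ℂ)‖ ≤ A⁻¹ + B⁻¹ := fun ζ => by
    have i0 : ∀ S : Set Space, 0 ≤ S.indicator (fun _ => (1 : ℝ)) ζ := fun S =>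
      indicator_nonneg (fun _ _ => zero_le_one) ζ
    have i1 : ∀ S : Set Space, S.indicator (fun _ => (1 : ℝ)) ζ ≤ 1 := fun S =>
      indicator_le_self' (fun _ _ => zero_le_one) ζ
    rw [Complex.norm_real, Real.norm_of_nonneg (add_nonneg (mul_nonneg (by positivity) (i0 _))
      (mul_nonneg (by positivity) (i0 _)))]
    exact add_le_add (mul_le_of_le_one_right (by positivity) (i1 _))
      (mul_le_of_le_one_right (by positivity) (i1 _))
  have hφs : ∀ ζ, (φ ζ : ℂ) ≠ 0 → ‖ζ‖ ≤ (3 / 2 * μ + μ * L + μ * L) + (L + μ + 2 * (μ * L) + 2 * (μ * L)) := by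
    intro ζ h
    by_cases h1 : ζ ∈ G
    · have := norm_le_of_mem_sbox hμ0.le h1
      have : 0 < L + μ + 2 * (μ * L) + 2 * (μ * L) := by positivity
      linarith
    · by_cases h2 : ζ ∈ E
      · have := norm_le_of_mem_sbox hL0.le h2
        have : 0 < 3 / 2 * μ + μ * L + μ * L := by positivity
        linarith
      · exact absurd (by simp [φ, h1, h2]) h
  obtain ⟨d, hd, hφd⟩ := norm_le_weight_of_support T hT (by positivity) hφb hφs
  have hLin := bdd_linEvol (T := T) hφm hd hφd
  have hmd := (hLin.duh hT hLin).memLp hT ht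
  have hup := hbound _ d hφm hd hφd J (0, 0)
  have hup' : ‖(memLp_gam hmd J (0, 0)).toLp _‖ ≤ 4 * C := by
    rw [coe_elem hp hp' hmd] at hup
    refine hup.trans ?_
    have : ‖elem q hp hp' fun ζ => (φ ζ : ℂ)‖ ^ 2 ≤ 2 ^ 2 := pow_le_pow_left₀ (norm_nonneg _) hn 2
    nlinarith
  set X : ℝ := L * c₀ * (|t| / 2 * (A⁻¹ * B⁻¹ * (2 * μ * (μ * L) ^ 2))) with hX
  have hX0 : 0 ≤ X := by
    have := c₀_pos
    positivity
  -- `X` is the pointwise lower bound on the output box `O`, and `2s = L · |O|` is the weighted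
  -- volume of that box.
  have hlow : ENNReal.ofReal (2 * s * X ^ 2) ≤ ENNReal.ofReal (‖(memLp_gam hmd J (0, 0)).toLp _‖ ^ 2) := by
    rw [norm_toLp_sq, lintegral_gamMeasure, ← hL]
    have hOv : volume O = ENNReal.ofReal (1 / 2 * μ * (4 * (μ * L) ^ 2)) := by
      rw [hO, volume_sbox (by linarith) (by positivity)]
      congr 1
      ring
    calc ENNReal.ofReal (2 * s * X ^ 2) = ENNReal.ofReal L * (ENNReal.ofReal (X ^ 2) * volume O) := by
          rw [hOv, ← ENNReal.ofReal_mul (sq_nonneg X), ← ENNReal.ofReal_mul hL0.le]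
          congr 1
          rw [hs]
          ring
      _ = ENNReal.ofReal L * ∫⁻ _ in O, ENNReal.ofReal (X ^ 2) := by rw [setLIntegral_const]
      _ ≤ ENNReal.ofReal L * ∫⁻ ζ in O, ‖duh (linEvol fun ζ => (φ ζ : ℂ)) (linEvol fun ζ => (φ ζ : ℂ)) t ζ‖ₑ ^ 2 := by
          refine mul_le_mul_right (setLIntegral_mono' (measurableSet_sbox _ _ _) fun ζ hζ => ?_) _
          rw [← ofReal_norm, ← ENNReal.ofReal_pow (norm_nonneg _)]
          exact ENNReal.ofReal_le_ofReal (pow_le_pow_left₀ hX0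
            (le_norm_duh_low_high hT ht hμ0 hμL hres (by positivity) (by positivity) rfl hLin hζ) 2)
      _ ≤ _ := by
          refine mul_le_mul_right ?_ _
          exact lintegral_mono_set (sbox_subset_Gam hL hμ0 hμL)
  rw [ENNReal.ofReal_le_ofReal_iff (sq_nonneg _)] at hlow
  have h1 : 2 * s * X ^ 2 ≤ (4 * C) ^ 2 := hlow.trans (pow_le_pow_left₀ (norm_nonneg _) hup' 2)
  have h2 : X = c₀ * |t| * s * A⁻¹ * B⁻¹ := by rw [hX, hs]; ring
  -- The high frequency norm cancels: `B² = 16 s` removes one power of `s`, and only `A` remains.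
  have h3 : 2 * s * X ^ 2 = (c₀ * |t| * s * A⁻¹) ^ 2 / 8 := by
    rw [h2, mul_pow _ (B⁻¹), inv_pow, hB2]
    field_simp
    norm_num
    ring
  rw [h3] at h1
  have h4 : c₀ * |t| * s * A⁻¹ ≤ 12 * C := le_of_sq_div_eight_le hC h1
  rwa [← div_eq_mul_inv, div_le_iff₀ hA0] at h4

/-- With `μ = c / L²` the left side scales like `L⁻³`, while both factors in the bracket have base
scaling `L⁻⁶`, so the right side scales like `L^(-6+6/P) = L^(-3-e)`. Here `e = 3 - 6/P` is positive
exactly because `P > 2`. -/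
lemma false_of_scaling {P c k M : ℝ} (hP : 2 < P) (hc : 0 < c) (hk : 0 < k)
    (h : ∀ᶠ J : ℕ in atTop, ∀ L μ : ℝ, L = 2 ^ J → μ = c / L ^ 2 →
      k * (L * μ * (μ * L) ^ 2) ≤ M * ((2 * μ ^ 3) ^ (P - 2) * (2 * μ ^ 2 * (μ * L) ^ 2)) ^ P⁻¹) : False := by
  have hP0 : 0 < P := by linarith
  set A₀ : ℝ := ((2 * c ^ 3) ^ (P - 2) * (2 * c ^ 4)) ^ P⁻¹ with hA₀
  have hA₀pos : 0 < A₀ := by positivity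
  set e : ℝ := 3 - 6 / P with he
  have he0 : 0 < e := by
    rw [he, sub_pos, div_lt_iff₀ hP0]; linarith
  have key : ∀ L : ℝ, 0 < L → ((2 * (c / L ^ 2) ^ 3) ^ (P - 2) *
      (2 * (c / L ^ 2) ^ 2 * ((c / L ^ 2) * L) ^ 2)) ^ P⁻¹ = A₀ * L ^ (-e - 3) := by
    intro L hL
    have e1 : 2 * (c / L ^ 2) ^ 3 = (2 * c ^ 3) * L ^ (-6 : ℝ) := by
      rw [Real.rpow_neg hL.le, show (6 : ℝ) = (6 : ℕ) by norm_num, Real.rpow_natCast]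
      field_simp
    have e2 : 2 * (c / L ^ 2) ^ 2 * ((c / L ^ 2) * L) ^ 2 = (2 * c ^ 4) * L ^ (-6 : ℝ) := by
      rw [Real.rpow_neg hL.le, show (6 : ℝ) = (6 : ℕ) by norm_num, Real.rpow_natCast]
      field_simp
    rw [e1, e2, Real.mul_rpow (x := 2 * c ^ 3) (by positivity) (by positivity), ← Real.rpow_mul hL.le,
      mul_mul_mul_comm, ← Real.rpow_add hL, Real.mul_rpow (by positivity) (by positivity), ← Real.rpow_mul hL.le]
    congr 2
    rw [he]
    field_simp
    ring
  have hlim : Tendsto (fun J : ℕ => ((2 : ℝ) ^ J) ^ e) atTop atTop :=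
    (tendsto_rpow_atTop he0).comp (tendsto_pow_atTop_atTop_of_one_lt one_lt_two)
  obtain ⟨J, hJ, hJ'⟩ := (h.and (hlim.eventually_gt_atTop (M * A₀ / (k * c ^ 3)))).exists
  have hL : (0 : ℝ) < 2 ^ J := by positivity
  have h1 := hJ _ _ rfl rfl
  rw [key _ hL] at h1
  set L : ℝ := 2 ^ J with hLdef
  have e3 : L * (c / L ^ 2) * ((c / L ^ 2) * L) ^ 2 = c ^ 3 * L ^ (-3 : ℝ) := by
    rw [Real.rpow_neg hL.le, show (3 : ℝ) = (3 : ℕ) by norm_num, Real.rpow_natCast]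
    field_simp
  have e4 : L ^ (-e - 3) = L ^ (-3 : ℝ) / L ^ e := by
    rw [← Real.rpow_sub hL]
    congr 1
    ring
  rw [e3, e4] at h1
  have hpos : 0 < L ^ (-3 : ℝ) := by positivity
  have hpos' : 0 < L ^ e := by positivity
  have h2 : k * c ^ 3 * L ^ e ≤ M * A₀ := by
    have h3 : (k * c ^ 3) * L ^ (-3 : ℝ) ≤ (M * A₀ / L ^ e) * L ^ (-3 : ℝ) := by
      calc _ = k * (c ^ 3 * L ^ (-3 : ℝ)) := by ring
        _ ≤ _ := h1
        _ = _ := by ring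
    have h4 := le_of_mul_le_mul_right h3 hpos
    rwa [le_div_iff₀ hpos'] at h4
  rw [div_lt_iff₀ (by positivity)] at hJ'
  linarith

end

end KPII

theorem theorem1p3 (q p : ℝ≥0∞) [Fact (1 ≤ p)] [Fact (1 ≤ q)] (hp : 2 < p) (hp' : p < ⊤)
    (T ε : ℝ) (hT : 0 < T) (hε : 0 < ε)
    (K : Set (ℝ → KPII.LqLpL2 q p))
    (hK : ∀ u : ℝ → KPII.LqLpL2 q p,
      KPII.IsSolution T (u 0) u → KPII.IsRegular T u → u ∈ K)
    (hwp : ∀ u₀ : KPII.LqLpL2 q p, ‖u₀‖ < ε →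
      ∃ u ∈ K, KPII.IsSolution T u₀ u ∧
        ∀ v ∈ K, KPII.IsSolution T u₀ v → EqOn v u (Icc (-T) T))
    (F : ℝ → KPII.LqLpL2 q p → KPII.LqLpL2 q p)
    (hF : ∀ u₀ : KPII.LqLpL2 q p, ‖u₀‖ < ε →
      (fun t => F t u₀) ∈ K ∧ KPII.IsSolution T u₀ (fun t => F t u₀)) :
    ∀ t ∈ Icc (-T) T, t ≠ 0 → ¬ KPII.TwiceDifferentiableAt (F t) 0 := by
  intro t ht ht0 hd
  obtain ⟨C, hC, hbound⟩ := KPII.exists_bound_of_twiceDifferentiableAt hp hp' hT hε hK hwp hF ht hd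
  -- With `c = 2^(-r)` and `32 T < 2^r` the total phase is at most `16 T c ≤ 1/2`, and `μ =
  -- 2^(-r-2J)` is dyadic.
  obtain ⟨r, hr⟩ := pow_unbounded_of_one_lt (32 * T) (one_lt_two (α := ℝ))
  refine KPII.false_of_scaling (P := p.toReal) (c := 1 / 2 ^ r) (k := KPII.c₀ * |t|) (M := 12 * C) ?_
    (by positivity) (mul_pos KPII.c₀_pos (abs_pos.2 ht0)) ?_
  · have := (ENNReal.toReal_lt_toReal (by norm_num) hp'.ne).2 hp
    simpa using this
  -- `J ≥ 2` gives `L ≥ 4 ≥ 4μ`, the separation of low and high frequencies.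
  · filter_upwards [eventually_ge_atTop 2] with J hJ L μ hL hμ
    have hr1 : (1 : ℝ) ≤ 2 ^ r := one_le_pow₀ one_le_two
    have hL4 : (4 : ℝ) ≤ L := by
      rw [hL]
      calc (4 : ℝ) = 2 ^ 2 := by norm_num
        _ ≤ 2 ^ J := pow_le_pow_right₀ one_le_two hJ
    have hL0 : 0 < L := by linarith
    have hμL2 : μ * L ^ 2 = 1 / 2 ^ r := by rw [hμ]; field_simp
    have hμ1 : μ ≤ 1 := by
      rw [hμ, div_div, div_le_one (by positivity)]
      nlinarith
    refine KPII.low_high_inequality hp hp' hT ht hC hbound (J := J) (l := -(r + 2 * J : ℕ)) ?_ ?_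
      (by linarith) ?_
    · rw [hL, zpow_natCast]
    · rw [hμ, hL, zpow_neg, zpow_natCast, div_div, one_div, pow_add, pow_mul']
    · rw [hμL2, mul_one_div, mul_div_assoc', div_le_iff₀ (by positivity)]
      linarith
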